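/- For $k\ge 1$, a $\Sigma_k$ machine is an alternating multitape Turing machine that begins its computation in an existential state and, on every computation path, switches between existential and universal states at most $k-1$ times. For $f:\mathbb N\to\mathbb N$, let $\Sigma_k\text{-}\mathrm{TIME}(f)$ be the class of languages $L\subseteq\{0,1\}^*$ accepted by a $\Sigma_k$ machine all of whose computation paths on inputs of length $n$ have at most $f(n)$ steps. Let $$\mathrm{LinH}=\bigcup_{k\ge 1}\Sigma_k\text{-}\mathrm{TIME}(O(n)),\qquad \mathrm{EH}=\bigcup_{k\ge 1}\Sigma_k\text{-}\mathrm{TIME}(2^{O(n)})$$ be the linear-time hierarchy and the exponential-time hierarchy (with linear exponent), where $\Sigma_k\text{-}\mathrm{TIME}(O(n))$ and $\Sigma_k\text{-}\mathrm{TIME}(2^{O(n)})$ denote the unions of $\Sigma_k\text{-}\mathrm{TIME}(g)$ and of $\Sigma_k\text{-}\mathrm{TIME}(2^{g})$, respectively, over all $g:\mathbb N\to\mathbb N$ with $g(n)=O(n)$. Then $\mathrm{EH}\neq\mathrm{LinH}$. -/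

import Mathlib

/-- The four kinds of states of an alternating Turing machine. States of kind `accept` and
`reject` are halting. -/
inductive StateKind where
  | existential
  | universal
  | accept
  | reject

/-- The kind belongs to a non-halting state. -/
def StateKind.Running (a : StateKind) : Prop :=
  a = .existential ∨ a = .universal

/-- Passing from a state of the first kind to a state of the second kind is a switch between
existential and universal states. -/
def StateKind.Switch (a b : StateKind) : Prop :=
  (a = .existential ∧ b = .universal) ∨ (a = .universal ∧ b = .existential)

/-- An alternating multitape Turing machine with input alphabet `{0,1}`. It has `extraTapes + 1`
two-way infinite tapes; its tape alphabet `Option (Bool ⊕ Aux)` consists of the blank `none`, the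
two input symbols and finitely many auxiliary symbols. Given a state and the scanned symbols,
`moves` is the set of possible actions: a new state and, for each tape, the symbol that is written
and the direction in which the head then moves (`none`: it stays). -/
structure ATM where
  State : Type
  finite_state : Finite State
  Aux : Type
  finite_aux : Finite Aux
  extraTapes : ℕ
  kind : State → StateKind
  start : State
  moves : State → (Fin (extraTapes + 1) → Option (Bool ⊕ Aux)) →
    Set (State × (Fin (extraTapes + 1) → Option (Bool ⊕ Aux) × Option Turing.Dir))

namespace ATM

/-- Tape symbols. -/
abbrev Symbol (M : ATM) : Type := Option (Bool ⊕ M.Aux)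

/-- Configurations: a state together with the tape contents and head positions. -/
structure Cfg (M : ATM) where
  state : M.State
  tape : Fin (M.extraTapes + 1) → Turing.Tape M.Symbol

/-- Write a symbol in the scanned cell, then move the head. -/
def act {Γ : Type} [Inhabited Γ] (a : Γ × Option Turing.Dir) (T : Turing.Tape Γ) :
    Turing.Tape Γ :=
  match a.2 with
  | none => T.write a.1
  | some d => (T.write a.1).move d

/-- The initial configuration: the input is on tape `0`, whose head scans the first input symbol;
all the other tapes are blank. -/
def init (M : ATM) (x : List Bool) : M.Cfg where
  state := M.start
  tape i := if i = 0 then Turing.Tape.mk₁ (x.map fun b => some (Sum.inl b)) else Turing.Tape.mk₁ []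

/-- One computation step. -/
def Step (M : ATM) (c c' : M.Cfg) : Prop :=
  (M.kind c.state).Running ∧
    ∃ a ∈ M.moves c.state (fun i => (c.tape i).head),
      c'.state = a.1 ∧ ∀ i, c'.tape i = act (a.2 i) (c.tape i)

/-- `M.Reaches x t s c`: on input `x`, some computation path of `M` with `t` steps and exactly `s`
switches between existential and universal states ends in the configuration `c`. -/
inductive Reaches (M : ATM) (x : List Bool) : ℕ → ℕ → M.Cfg → Prop
  | init : Reaches M x 0 0 (M.init x)
  | stay {t s : ℕ} {c c' : M.Cfg} : Reaches M x t s c → M.Step c c' →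
      ¬ (M.kind c.state).Switch (M.kind c'.state) → Reaches M x (t + 1) s c'
  | switch {t s : ℕ} {c c' : M.Cfg} : Reaches M x t s c → M.Step c c' →
      (M.kind c.state).Switch (M.kind c'.state) → Reaches M x (t + 1) (s + 1) c'

/-- Accepting configurations: an existential configuration needs an accepting successor, a
universal one needs all its successors to be accepting. A non-halting state in which the machine
is stuck does not accept. -/
inductive AcceptsFrom (M : ATM) : M.Cfg → Prop
  | accept {c : M.Cfg} : M.kind c.state = .accept → AcceptsFrom M c
  | existential {c c' : M.Cfg} : M.kind c.state = .existential → M.Step c c' →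
      AcceptsFrom M c' → AcceptsFrom M c
  | universal {c : M.Cfg} : M.kind c.state = .universal → (∃ c', M.Step c c') →
      (∀ c', M.Step c c' → AcceptsFrom M c') → AcceptsFrom M c

/-- The language accepted by `M`. -/
def language (M : ATM) : Language Bool := {x | M.AcceptsFrom (M.init x)}

/-- `M` is a `Σ_k` machine (`k ≥ 1`): it begins in an existential state, and on no computation
path does it make more than `k - 1` switches between existential and universal states. -/
def IsSigma (M : ATM) (k : ℕ) : Prop :=
  1 ≤ k ∧ M.kind M.start = .existential ∧
    ∀ (x : List Bool) (t s : ℕ) (c : M.Cfg), M.Reaches x t s c → s ≤ k - 1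

/-- Every computation path of `M` on every input of length `n` has at most `f n` steps. -/
def RunsInTime (M : ATM) (f : ℕ → ℕ) : Prop :=
  ∀ (x : List Bool) (t s : ℕ) (c : M.Cfg), M.Reaches x t s c → t ≤ f x.length

end ATM

/-- `g(n) = O(n)`. -/
def IsLinearBound (g : ℕ → ℕ) : Prop :=
  (fun n => (g n : ℝ)) =O[Filter.atTop] (fun n => (n : ℝ))

/-- `Σ_k-TIME(f)`. -/
def SigmaTime (k : ℕ) (f : ℕ → ℕ) : Set (Language Bool) :=
  {L | ∃ M : ATM, M.IsSigma k ∧ M.RunsInTime f ∧ M.language = L}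

/-- `Σ_k-TIME(O(n))`. -/
def SigmaLin (k : ℕ) : Set (Language Bool) :=
  {L | ∃ g : ℕ → ℕ, IsLinearBound g ∧ L ∈ SigmaTime k g}

/-- `Σ_k-TIME(2^{O(n)})`. -/
def SigmaE (k : ℕ) : Set (Language Bool) :=
  {L | ∃ g : ℕ → ℕ, IsLinearBound g ∧ L ∈ SigmaTime k (fun n => 2 ^ g n)}

/-- The linear-time hierarchy. -/
def LinH : Set (Language Bool) := ⋃ k : ℕ, SigmaLin k

/-- The exponential-time hierarchy with linear exponents. -/
def EH : Set (Language Bool) := ⋃ k : ℕ, SigmaE k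

/-! Suppose that `EH = LinH`. Padding a word to exponential length turns a linear time bound into an
exponential one, and machines with a time bound can be complemented. So every `L` in `LinH` gives a
language `{x | pad x ∉ L}` in `EH`, hence again in `LinH` (`setOf_pad_notMem_mem_eh`). Three rounds,
starting from a fixed `U` in `LinH`, put `D = {x | pad (pad (pad x)) ∉ U}` into `LinH`; three is
odd, so one negation survives. If `M` is a linear-time machine for `D`, a contradiction follows once
some `x` satisfies: `M` accepts `x` if and only if `pad (pad (pad x)) ∈ U`. This is
`ATM.exists_sat_iff_acceptsFrom`.

The obstacle is that `U` has a fixed number of alternations, while `M` may have any number. The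
padded input is so long, however, that `U` can guess the list of all accepting configurations of `M`
as a single word. Acceptance becomes a game: a set of configurations is winning if, for every member
and every challenge (a move of `M`), some answer leads to a member again, where a universal state
must obey a challenge that is a legal move. Accepting configurations form a winning set
(`Coding.isWinning_words`). Conversely, since computations are short, every member of a winning set
that shows enough cells around the heads is accepting (`Coding.acceptsFrom_of_isWinning`). One
quantifier over sets thus absorbs all alternations of `M`. The game rule is local, concerning
windows of three cells, and is a finite table, which the input `x` lists.

`U` is defined by one formula `Fm.game` about words, with concatenation and equality of lengths,
whose quantifiers are bounded by the input length. Any such formula is evaluated in linear time with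
boundedly many alternations: each quantifier guesses a string on a tape of its own, and atoms are
checked by one sweep (`Fm.ensures_eval`, `Fm.setOf_sat_mem_linH`).

Sizes: if `x` has length `n`, the first padding supplies a margin of `2 ^ n - 1` cells on both sides
of the input, more than a linear-time computation can reach. There are at most `d ^ (3 * 2 ^ n)`
words for such configurations, where `d` is the number of cells, and their list fits into the length
after three paddings (`size_bound`). -/

namespace Turing.Tape

/-! ### Tapes as functions on the integers -/

theorem nth_injective {Γ : Type*} [Inhabited Γ] : Function.Injective (nth (Γ := Γ)) := by
  rintro ⟨a, L, R⟩ ⟨a', L', R'⟩ h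
  have h0 : a = a' := congrFun h 0
  have hR : R = R' := ListBlank.ext fun n => congrFun h ((n + 1 : ℕ) : ℤ)
  have hL : L = L' := ListBlank.ext fun n => congrFun h (-((n + 1 : ℕ) : ℤ))
  subst h0 hR hL
  rfl

theorem mk₁_nth {Γ : Type*} [Inhabited Γ] (l : List Γ) (p : ℤ) :
    (mk₁ l).nth p = if 0 ≤ p then l.getI p.toNat else default := by
  rcases p with n | n
  · simp [mk₁, mk₂]
  · have : (mk₁ l).nth (Int.negSucc n) = (ListBlank.mk ([] : List Γ)).nth n := rfl
    rw [this, ListBlank.nth_mk]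
    simp

end Turing.Tape

namespace ATM

/-- The displacement of a head. -/
def shift : Option Turing.Dir → ℤ
  | none => 0
  | some .left => -1
  | some .right => 1

@[simp] theorem shift_none : shift none = 0 := rfl
@[simp] theorem shift_left : shift (some .left) = -1 := rfl
@[simp] theorem shift_right : shift (some .right) = 1 := rfl

theorem act_nth {Γ : Type} [Inhabited Γ] (a : Γ × Option Turing.Dir) (T : Turing.Tape Γ) (p : ℤ) :
    (act a T).nth p = if p + shift a.2 = 0 then a.1 else T.nth (p + shift a.2) := by
  rcases a with ⟨a, _ | _ | _⟩ <;> simp [act, sub_eq_add_neg] <;> rfl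

/-! ### Bounds along computation paths, and acceptance -/

variable {M : ATM}

/-- `M.Path c t s c'`: some computation path leads from `c` to `c'` in `t` steps with `s`
switches. -/
inductive Path (M : ATM) : M.Cfg → ℕ → ℕ → M.Cfg → Prop
  | nil (c : M.Cfg) : Path M c 0 0 c
  | stay {c c₁ c' : M.Cfg} {t s : ℕ} : M.Step c c₁ → ¬ (M.kind c.state).Switch (M.kind c₁.state) →
      Path M c₁ t s c' → Path M c (t + 1) s c'
  | switch {c c₁ c' : M.Cfg} {t s : ℕ} : M.Step c c₁ → (M.kind c.state).Switch (M.kind c₁.state) →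
      Path M c₁ t s c' → Path M c (t + 1) (s + 1) c'

theorem Path.snoc_stay {c c₁ c' : M.Cfg} {t s : ℕ} (h : M.Path c t s c₁) (h₁ : M.Step c₁ c')
    (hs : ¬ (M.kind c₁.state).Switch (M.kind c'.state)) : M.Path c (t + 1) s c' := by
  induction h with
  | nil => exact .stay h₁ hs (.nil _)
  | stay a b _ ih => exact .stay a b (ih h₁ hs)
  | switch a b _ ih => exact .switch a b (ih h₁ hs)

theorem Path.snoc_switch {c c₁ c' : M.Cfg} {t s : ℕ} (h : M.Path c t s c₁) (h₁ : M.Step c₁ c')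
    (hs : (M.kind c₁.state).Switch (M.kind c'.state)) : M.Path c (t + 1) (s + 1) c' := by
  induction h with
  | nil => exact .switch h₁ hs (.nil _)
  | stay a b _ ih => exact .stay a b (ih h₁ hs)
  | switch a b _ ih => exact .switch a b (ih h₁ hs)

/-- `Reaches` grows at its end and `Path` at its beginning. The latter suits inductions that peel
off the first step from an arbitrary configuration. -/
theorem Reaches.path {x : List Bool} {t s : ℕ} {c : M.Cfg} (h : M.Reaches x t s c) :
    M.Path (M.init x) t s c := by
  induction h with
  | init => exact .nil _
  | stay _ a b ih => exact ih.snoc_stay a b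
  | switch _ a b ih => exact ih.snoc_switch a b

theorem Reaches.trans_path {x : List Bool} {t s : ℕ} {c : M.Cfg} (h : M.Reaches x t s c)
    {t' s' : ℕ} {c' : M.Cfg} (p : M.Path c t' s' c') : M.Reaches x (t + t') (s + s') c' := by
  induction p generalizing t s with
  | nil => exact h
  | stay a b _ ih =>
    have := ih (h.stay a b)
    rwa [Nat.add_right_comm, Nat.add_assoc] at this
  | switch a b _ ih =>
    have := ih (h.switch a b)
    rwa [Nat.add_right_comm, Nat.add_assoc, Nat.add_right_comm s, Nat.add_assoc s] at this

/-- All computation paths from `c` have at most `T` steps and at most `K` switches. -/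
def Bounded (M : ATM) (T K : ℕ) (c : M.Cfg) : Prop :=
  ∀ ⦃t s : ℕ⦄ ⦃c' : M.Cfg⦄, M.Path c t s c' → t ≤ T ∧ s ≤ K

theorem Bounded.of_step {T K : ℕ} {c : M.Cfg}
    (h : ∀ c', M.Step c c' → ∃ K', M.Bounded T K' c' ∧ K' ≤ K ∧
      ((M.kind c.state).Switch (M.kind c'.state) → K' + 1 ≤ K)) : M.Bounded (T + 1) K c := by
  intro t s c' p
  cases p with
  | nil => simp
  | stay a b p =>
    obtain ⟨K', h₁, h₂, -⟩ := h _ a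
    have := h₁ p
    omega
  | switch a b p =>
    obtain ⟨K', h₁, -, h₂⟩ := h _ a
    have := h₁ p
    have := h₂ b
    omega

/-- Valid for switching steps as well, with the bound on switches merely kept; the step itself is a
path of length one, so `T` is positive. -/
theorem Bounded.step_stay {T K : ℕ} {c c' : M.Cfg} (h : M.Bounded T K c) (hs : M.Step c c') :
    ∃ T', T = T' + 1 ∧ M.Bounded T' K c' := by
  classical
  have h1 : ∀ t s d, M.Path c' t s d → t + 1 ≤ T ∧ s ≤ K := by
    intro t s d p
    by_cases hsw : (M.kind c.state).Switch (M.kind c'.state)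
    · have := h (.switch hs hsw p)
      omega
    · exact h (.stay hs hsw p)
  obtain ⟨T', rfl⟩ : ∃ T', T = T' + 1 :=
    Nat.exists_eq_add_of_le' (by simpa using (h1 _ _ _ (.nil c')).1)
  exact ⟨T', rfl, fun t s d p => by have := h1 t s d p; omega⟩

theorem Bounded.step_switch {T K : ℕ} {c c' : M.Cfg} (h : M.Bounded T K c) (hs : M.Step c c')
    (hsw : (M.kind c.state).Switch (M.kind c'.state)) :
    ∃ T' K', T = T' + 1 ∧ K = K' + 1 ∧ M.Bounded T' K' c' := by
  have h1 : ∀ t s d, M.Path c' t s d → t + 1 ≤ T ∧ s + 1 ≤ K :=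
    fun t s d p => h (.switch hs hsw p)
  obtain ⟨T', rfl⟩ : ∃ T', T = T' + 1 :=
    Nat.exists_eq_add_of_le' (by simpa using (h1 _ _ _ (.nil c')).1)
  obtain ⟨K', rfl⟩ : ∃ K', K = K' + 1 :=
    Nat.exists_eq_add_of_le' (by simpa using (h1 _ _ _ (.nil c')).2)
  exact ⟨T', K', rfl, rfl, fun t s d p => by have := h1 t s d p; omega⟩

theorem Bounded.mono {T K T' K' : ℕ} {c : M.Cfg} (h : M.Bounded T K c) (hT : T ≤ T')
    (hK : K ≤ K') : M.Bounded T' K' c := fun _ _ _ p =>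
  ⟨(h p).1.trans hT, (h p).2.trans hK⟩

theorem bounded_init {k : ℕ} {f : ℕ → ℕ} (h₁ : M.IsSigma k) (h₂ : M.RunsInTime f)
    (x : List Bool) : M.Bounded (f x.length) (k - 1) (M.init x) := by
  intro t s c p
  have := Reaches.init.trans_path p
  rw [Nat.zero_add, Nat.zero_add] at this
  exact ⟨h₂ _ _ _ _ this, h₁.2.2 _ _ _ _ this⟩

/-- All computation paths from `c` have at most `T` steps and at most `K` switches, and `c` leads
to acceptance if and only if `P` holds. -/
def Good (M : ATM) (T K : ℕ) (P : Prop) (c : M.Cfg) : Prop :=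
  M.Bounded T K c ∧ (M.AcceptsFrom c ↔ P)

/-- The start is existential, so `K` switches mean `K + 1` blocks of quantifiers. -/
theorem mem_sigmaTime {K : ℕ} {f : ℕ → ℕ} {L : Language Bool} (hs : M.kind M.start = .existential)
    (h : ∀ x, M.Good (f x.length) K (x ∈ L) (M.init x)) : L ∈ SigmaTime (K + 1) f := by
  refine ⟨M, ⟨Nat.le_add_left _ _, hs, fun x t s c hr => ?_⟩, fun x t s c hr => ?_, ?_⟩
  · simpa using ((h x).1 hr.path).2
  · exact ((h x).1 hr.path).1
  · ext x
    exact (h x).2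

theorem not_running_accept : ¬ StateKind.accept.Running := by simp [StateKind.Running]
theorem not_running_reject : ¬ StateKind.reject.Running := by simp [StateKind.Running]

theorem good_accept {T K : ℕ} {c : M.Cfg} (hk : M.kind c.state = .accept) : M.Good T K True c := by
  refine ⟨?_, iff_of_true (.accept hk) trivial⟩
  intro t s c' p
  cases p with
  | nil => simp
  | stay a _ _ => exact absurd (hk ▸ a.1) not_running_accept
  | switch a _ _ => exact absurd (hk ▸ a.1) not_running_accept

theorem good_reject {T K : ℕ} {c : M.Cfg} (hk : M.kind c.state = .reject) :
    M.Good T K False c := by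
  refine ⟨?_, iff_of_false (fun h => ?_) id⟩
  · intro t s c' p
    cases p with
    | nil => simp
    | stay a _ _ => exact absurd (hk ▸ a.1) not_running_reject
    | switch a _ _ => exact absurd (hk ▸ a.1) not_running_reject
  · cases h <;> simp_all

theorem acceptsFrom_existential {c : M.Cfg} (hk : M.kind c.state = .existential) :
    M.AcceptsFrom c ↔ ∃ c', M.Step c c' ∧ M.AcceptsFrom c' := by
  constructor
  · intro h
    cases h with
    | accept h => simp_all
    | existential _ h₁ h₂ => exact ⟨_, h₁, h₂⟩
    | universal h => simp_all
  · rintro ⟨c', h₁, h₂⟩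
    exact .existential hk h₁ h₂

theorem acceptsFrom_universal {c : M.Cfg} (hk : M.kind c.state = .universal) :
    M.AcceptsFrom c ↔ (∃ c', M.Step c c') ∧ ∀ c', M.Step c c' → M.AcceptsFrom c' := by
  constructor
  · intro h
    cases h with
    | accept h => simp_all
    | existential h => simp_all
    | universal _ h₁ h₂ => exact ⟨h₁, h₂⟩
  · rintro ⟨h₁, h₂⟩
    exact .universal hk h₁ h₂

/-! ### Configurations in absolute coordinates -/

/-- The configuration `c` is in state `q`, the contents of its tapes are `A`, and its heads are at
the positions `h`. -/
def Rep (M : ATM) (c : M.Cfg) (q : M.State) (A : Fin (M.extraTapes + 1) → ℤ → M.Symbol)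
    (h : Fin (M.extraTapes + 1) → ℤ) : Prop :=
  c.state = q ∧ ∀ i p, (c.tape i).nth p = A i (h i + p)

/-- The action of a move on tape contents. -/
def wr {k : ℕ} {Γ : Type} (A : Fin k → ℤ → Γ) (h : Fin k → ℤ)
    (w : Fin k → Γ × Option Turing.Dir) : Fin k → ℤ → Γ :=
  fun i => Function.update (A i) (h i) (w i).1

/-- The action of a move on head positions. -/
def mv {k : ℕ} {Γ : Type} (h : Fin k → ℤ) (w : Fin k → Γ × Option Turing.Dir) : Fin k → ℤ :=
  fun i => h i + shift (w i).2

section Rep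

variable {q : M.State} {A : Fin (M.extraTapes + 1) → ℤ → M.Symbol}
  {h : Fin (M.extraTapes + 1) → ℤ} {c : M.Cfg}

theorem Rep.head (hr : M.Rep c q A h) :
    (fun i => (c.tape i).head) = fun i => A i (h i) := by
  funext i
  have := hr.2 i 0
  simpa using this

theorem Rep.act (hr : M.Rep c q A h) (q' : M.State)
    (w : Fin (M.extraTapes + 1) → M.Symbol × Option Turing.Dir) :
    M.Rep ⟨q', fun i => ATM.act (w i) (c.tape i)⟩ q' (wr A h w) (mv h w) := by
  refine ⟨rfl, fun i p => ?_⟩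
  simp only [act_nth, wr, mv, hr.2]
  by_cases hp : p + shift (w i).2 = 0
  · rw [if_pos hp, show h i + shift (w i).2 + p = h i by omega, Function.update_self]
  · rw [if_neg hp, Function.update_of_ne (by omega)]
    congr 1
    omega

theorem Rep.step (hr : M.Rep c q A h) {c' : M.Cfg} (hs : M.Step c c') :
    ∃ a ∈ M.moves q (fun i => A i (h i)), M.Rep c' a.1 (wr A h a.2) (mv h a.2) := by
  obtain ⟨-, a, ha, h₁, h₂⟩ := hs
  rw [hr.head, hr.1] at ha
  refine ⟨a, ha, ?_⟩
  have := hr.act a.1 a.2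
  rcases c' with ⟨s, T⟩
  obtain rfl : T = _ := funext h₂
  obtain rfl : s = _ := h₁
  exact this

theorem Rep.exists_step (hr : M.Rep c q A h) (hk : (M.kind q).Running)
    {a : M.State × (Fin (M.extraTapes + 1) → M.Symbol × Option Turing.Dir)}
    (ha : a ∈ M.moves q (fun i => A i (h i))) :
    ∃ c', M.Step c c' ∧ M.Rep c' a.1 (wr A h a.2) (mv h a.2) :=
  ⟨_, ⟨by rwa [hr.1], a, by rwa [hr.head, hr.1], rfl, fun _ => rfl⟩, hr.act a.1 a.2⟩

end Rep

/-- All configurations in state `q` with tape contents `A` and head positions `h` satisfy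
`Good T K P`. -/
def Ensures (M : ATM) (q : M.State) (A : Fin (M.extraTapes + 1) → ℤ → M.Symbol)
    (h : Fin (M.extraTapes + 1) → ℤ) (T K : ℕ) (P : Prop) : Prop :=
  ∀ c, M.Rep c q A h → M.Good T K P c

namespace Ensures

variable {q : M.State} {A : Fin (M.extraTapes + 1) → ℤ → M.Symbol}
  {h : Fin (M.extraTapes + 1) → ℤ} {T K : ℕ} {P : Prop}

theorem mono {T' K' : ℕ} {P' : Prop} (H : M.Ensures q A h T K P) (hT : T ≤ T') (hK : K ≤ K')
    (hP : P ↔ P') : M.Ensures q A h T' K' P' := fun c hc =>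
  ⟨(H c hc).1.mono hT hK, (H c hc).2.trans hP⟩

theorem accept (hk : M.kind q = .accept) (hP : P) : M.Ensures q A h T K P := fun c hc => by
  have := good_accept (T := T) (K := K) (c := c) (by rw [hc.1, hk])
  simpa [hP] using this

theorem reject (hk : M.kind q = .reject) (hP : ¬ P) : M.Ensures q A h T K P := fun c hc => by
  have := good_reject (T := T) (K := K) (c := c) (by rw [hc.1, hk])
  simpa [hP] using this

/-- The switches after the move `a` are bounded by `K`, including the one by `a` itself. -/
def SwitchLe (b b' : StateKind) (K' K : ℕ) : Prop := K' ≤ K ∧ (b.Switch b' → K' + 1 ≤ K)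

theorem bounded
    {Q : M.State × (Fin (M.extraTapes + 1) → M.Symbol × Option Turing.Dir) → Prop}
    (H : ∀ a ∈ M.moves q (fun i => A i (h i)), ∃ K', SwitchLe (M.kind q) (M.kind a.1) K' K ∧
      M.Ensures a.1 (wr A h a.2) (mv h a.2) T K' (Q a)) {c : M.Cfg} (hc : M.Rep c q A h) :
    M.Bounded (T + 1) K c := by
  refine Bounded.of_step fun c' hs => ?_
  obtain ⟨a, ha, hr⟩ := hc.step hs
  obtain ⟨K', h₁, h₂⟩ := H a ha
  refine ⟨K', (h₂ c' hr).1, h₁.1, ?_⟩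
  rw [hc.1, hr.1]
  exact h₁.2

theorem existential
    (Q : M.State × (Fin (M.extraTapes + 1) → M.Symbol × Option Turing.Dir) → Prop)
    (hk : M.kind q = .existential)
    (H : ∀ a ∈ M.moves q (fun i => A i (h i)), ∃ K', SwitchLe (M.kind q) (M.kind a.1) K' K ∧
      M.Ensures a.1 (wr A h a.2) (mv h a.2) T K' (Q a))
    (hP : P ↔ ∃ a ∈ M.moves q (fun i => A i (h i)), Q a) :
    M.Ensures q A h (T + 1) K P := by
  intro c hc
  refine ⟨bounded H hc, ?_⟩
  rw [acceptsFrom_existential (by rw [hc.1, hk]), hP]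
  constructor
  · rintro ⟨c', hs, hacc⟩
    obtain ⟨a, ha, hr⟩ := hc.step hs
    exact ⟨a, ha, ((H a ha).choose_spec.2 c' hr).2.1 hacc⟩
  · rintro ⟨a, ha, hQ⟩
    obtain ⟨c', hs, hr⟩ := hc.exists_step (Or.inl hk) ha
    exact ⟨c', hs, ((H a ha).choose_spec.2 c' hr).2.2 hQ⟩

theorem universal
    (Q : M.State × (Fin (M.extraTapes + 1) → M.Symbol × Option Turing.Dir) → Prop)
    (hk : M.kind q = .universal)
    (H : ∀ a ∈ M.moves q (fun i => A i (h i)), ∃ K', SwitchLe (M.kind q) (M.kind a.1) K' K ∧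
      M.Ensures a.1 (wr A h a.2) (mv h a.2) T K' (Q a))
    (hne : (M.moves q (fun i => A i (h i))).Nonempty)
    (hP : P ↔ ∀ a ∈ M.moves q (fun i => A i (h i)), Q a) :
    M.Ensures q A h (T + 1) K P := by
  intro c hc
  refine ⟨bounded H hc, ?_⟩
  rw [acceptsFrom_universal (by rw [hc.1, hk]), hP]
  constructor
  · rintro ⟨-, hall⟩ a ha
    obtain ⟨c', hs, hr⟩ := hc.exists_step (Or.inr hk) ha
    exact ((H a ha).choose_spec.2 c' hr).2.1 (hall c' hs)
  · intro hall
    constructor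
    · obtain ⟨a, ha⟩ := hne
      obtain ⟨c', hs, -⟩ := hc.exists_step (Or.inr hk) ha
      exact ⟨c', hs⟩
    · intro c' hs
      obtain ⟨a, ha, hr⟩ := hc.step hs
      exact ((H a ha).choose_spec.2 c' hr).2.2 (hall a ha)

/-- With exactly one possible move, existential and universal states behave alike. -/
theorem det {K' : ℕ} {a : M.State × (Fin (M.extraTapes + 1) → M.Symbol × Option Turing.Dir)}
    (hk : (M.kind q).Running) (hm : M.moves q (fun i => A i (h i)) = {a})
    (hsw : SwitchLe (M.kind q) (M.kind a.1) K' K)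
    (H : M.Ensures a.1 (wr A h a.2) (mv h a.2) T K' P) : M.Ensures q A h (T + 1) K P := by
  rcases hk with hk | hk
  · refine existential (fun _ => P) hk ?_ ?_
    · rw [hm]
      rintro _ rfl
      exact ⟨K', hsw, H⟩
    · rw [hm]
      simp
  · refine universal (fun _ => P) hk ?_ ?_ ?_
    · rw [hm]
      rintro _ rfl
      exact ⟨K', hsw, H⟩
    · rw [hm]
      exact Set.singleton_nonempty _
    · rw [hm]
      simp

theorem SwitchLe.refl_of_eq {b b' : StateKind} {K : ℕ} (hb : b = b') : SwitchLe b b' K K := by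
  subst hb
  refine ⟨le_rfl, ?_⟩
  rintro (⟨h₁, h₂⟩ | ⟨h₁, h₂⟩) <;> simp_all

theorem SwitchLe.of_halt {b b' : StateKind} {K : ℕ} (hb : b' = .accept ∨ b' = .reject) :
    SwitchLe b b' K K := by
  refine ⟨le_rfl, ?_⟩
  rintro (⟨h₁, h₂⟩ | ⟨h₁, h₂⟩) <;> simp_all

theorem SwitchLe.succ {b b' : StateKind} {K : ℕ} : SwitchLe b b' K (K + 1) :=
  ⟨Nat.le_succ _, fun _ => le_rfl⟩

end Ensures

/-- A word over the input alphabet on a blank tape, starting at position `0`. -/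
def onTape {Aux : Type} (x : List Bool) (p : ℤ) : Option (Bool ⊕ Aux) :=
  if 0 ≤ p then (x[p.toNat]?).map Sum.inl else none

theorem mk₁_nth_eq_onTape {Aux : Type} (x : List Bool) (p : ℤ) :
    (Turing.Tape.mk₁ (x.map fun b => (some (Sum.inl b) : Option (Bool ⊕ Aux)))).nth p =
      onTape x p := by
  rw [Turing.Tape.mk₁_nth, onTape]
  split_ifs
  · rw [List.getI_eq_getElem?_getD, List.getElem?_map]
    cases x[p.toNat]? <;> rfl
  · rfl

theorem rep_init (x : List Bool) :
    M.Rep (M.init x) M.start (fun i => if i = 0 then onTape x else fun _ => none) (fun _ => 0) := by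
  refine ⟨rfl, fun i p => ?_⟩
  simp only [init, zero_add]
  split_ifs
  · exact mk₁_nth_eq_onTape x p
  · rw [Turing.Tape.mk₁_nth]
    simp only [List.getI_nil, ite_self]
    rfl

end ATM

/-! ### Programs with finitely many used control states -/

/-- A program for machines without auxiliary symbols: the control states form a possibly infinite
type, but the states in use belong to a finite set. -/
structure Prog (k : ℕ) where
  Ctl : Type
  kind : Ctl → StateKind
  start : Ctl
  next : Ctl → (Fin (k + 1) → Option (Bool ⊕ Empty)) →
    Set (Ctl × (Fin (k + 1) → Option (Bool ⊕ Empty) × Option Turing.Dir))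
  used : Set Ctl
  finite_used : used.Finite
  start_mem : start ∈ used
  closed : ∀ s ∈ used, ∀ r, ∀ a ∈ next s r, a.1 ∈ used

namespace Prog

variable {k : ℕ} (p : Prog k)

/-- The alternating Turing machine of a program. -/
def toATM : ATM where
  State := p.used
  finite_state := p.finite_used
  Aux := Empty
  finite_aux := inferInstance
  extraTapes := k
  kind s := p.kind s
  start := ⟨p.start, p.start_mem⟩
  moves s r := {a | (a.1.1, a.2) ∈ p.next s r}

/-- The analogue of `ATM.Ensures` for programs. -/
def Ensures (s : p.Ctl) (A : Fin (k + 1) → ℤ → Option (Bool ⊕ Empty)) (h : Fin (k + 1) → ℤ)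
    (T K : ℕ) (P : Prop) : Prop :=
  ∀ hs : s ∈ p.used, p.toATM.Ensures ⟨s, hs⟩ A h T K P

variable {p} {s : p.Ctl} {A : Fin (k + 1) → ℤ → Option (Bool ⊕ Empty)} {h : Fin (k + 1) → ℤ}
  {T K : ℕ} {P : Prop}

namespace Ensures

theorem mono {T' K' : ℕ} {P' : Prop} (H : p.Ensures s A h T K P) (hT : T ≤ T') (hK : K ≤ K')
    (hP : P ↔ P') : p.Ensures s A h T' K' P' := fun hs => (H hs).mono hT hK hP

theorem accept (hk : p.kind s = .accept) (hP : P) : p.Ensures s A h T K P := fun _ =>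
  ATM.Ensures.accept hk hP

theorem reject (hk : p.kind s = .reject) (hP : ¬ P) : p.Ensures s A h T K P := fun _ =>
  ATM.Ensures.reject hk hP

open ATM.Ensures (SwitchLe)

theorem existential
    (Q : p.Ctl × (Fin (k + 1) → Option (Bool ⊕ Empty) × Option Turing.Dir) → Prop)
    (hk : p.kind s = .existential)
    (H : ∀ a ∈ p.next s (fun i => A i (h i)), ∃ K', SwitchLe (p.kind s) (p.kind a.1) K' K ∧
      p.Ensures a.1 (ATM.wr A h a.2) (ATM.mv h a.2) T K' (Q a))
    (hP : P ↔ ∃ a ∈ p.next s (fun i => A i (h i)), Q a) :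
    p.Ensures s A h (T + 1) K P := by
  intro hs
  refine ATM.Ensures.existential (fun a => Q (a.1.1, a.2)) hk
    (fun a ha => let ⟨K', h₁, h₂⟩ := H _ ha; ⟨K', h₁, h₂ a.1.2⟩) ?_
  rw [hP]
  constructor
  · rintro ⟨a, ha, hQ⟩
    exact ⟨(⟨a.1, p.closed s hs _ _ ha⟩, a.2), ha, hQ⟩
  · rintro ⟨a, ha, hQ⟩
    exact ⟨_, ha, hQ⟩

theorem universal
    (Q : p.Ctl × (Fin (k + 1) → Option (Bool ⊕ Empty) × Option Turing.Dir) → Prop)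
    (hk : p.kind s = .universal)
    (H : ∀ a ∈ p.next s (fun i => A i (h i)), ∃ K', SwitchLe (p.kind s) (p.kind a.1) K' K ∧
      p.Ensures a.1 (ATM.wr A h a.2) (ATM.mv h a.2) T K' (Q a))
    (hne : (p.next s (fun i => A i (h i))).Nonempty)
    (hP : P ↔ ∀ a ∈ p.next s (fun i => A i (h i)), Q a) :
    p.Ensures s A h (T + 1) K P := by
  intro hs
  refine ATM.Ensures.universal (fun a => Q (a.1.1, a.2)) hk
    (fun a ha => let ⟨K', h₁, h₂⟩ := H _ ha; ⟨K', h₁, h₂ a.1.2⟩) ?_ ?_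
  · obtain ⟨a, ha⟩ := hne
    exact ⟨(⟨a.1, p.closed s hs _ _ ha⟩, a.2), ha⟩
  · rw [hP]
    constructor
    · intro hall a ha
      exact hall _ ha
    · intro hall a ha
      exact hall (⟨a.1, p.closed s hs _ _ ha⟩, a.2) ha

/-- Existential and universal branching in one: `P` holds if and only if some branch satisfies `Q`,
where for universal branching both sides are negated. -/
theorem branch {pol : Bool} {P : Prop}
    (Q : p.Ctl × (Fin (k + 1) → Option (Bool ⊕ Empty) × Option Turing.Dir) → Prop)
    (hk : p.kind s = if pol then .existential else .universal)
    (H : ∀ a ∈ p.next s (fun i => A i (h i)), ∃ K', SwitchLe (p.kind s) (p.kind a.1) K' K ∧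
      p.Ensures a.1 (ATM.wr A h a.2) (ATM.mv h a.2) T K' (pol = true ↔ Q a))
    (hne : (p.next s (fun i => A i (h i))).Nonempty)
    (hP : P ↔ ∃ a ∈ p.next s (fun i => A i (h i)), Q a) :
    p.Ensures s A h (T + 1) K (pol = true ↔ P) := by
  cases pol
  · refine universal (fun a => ¬ Q a) (by simpa using hk) ?_ hne ?_
    · simpa using H
    · simp [hP]
  · refine existential Q (by simpa using hk) ?_ ?_
    · simpa using H
    · simp [hP]

theorem det {K' : ℕ} {a : p.Ctl × (Fin (k + 1) → Option (Bool ⊕ Empty) × Option Turing.Dir)}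
    (hk : (p.kind s).Running) (hm : p.next s (fun i => A i (h i)) = {a})
    (hsw : SwitchLe (p.kind s) (p.kind a.1) K' K)
    (H : p.Ensures a.1 (ATM.wr A h a.2) (ATM.mv h a.2) T K' P) :
    p.Ensures s A h (T + 1) K P := by
  rcases hk with hk | hk
  · refine existential (fun _ => P) hk ?_ ?_
    · rw [hm]
      rintro _ rfl
      exact ⟨K', hsw, H⟩
    · rw [hm]
      simp
  · refine universal (fun _ => P) hk ?_ ?_ ?_
    · rw [hm]
      rintro _ rfl
      exact ⟨K', hsw, H⟩
    · rw [hm]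
      exact Set.singleton_nonempty _
    · rw [hm]
      simp

end Ensures

end Prog

theorem ATM.wr_self {k : ℕ} {Γ : Type} (A : Fin k → ℤ → Γ) (h : Fin k → ℤ)
    (D : Fin k → Option Turing.Dir) : ATM.wr A h (fun i => (A i (h i), D i)) = A := by
  funext i
  simp [ATM.wr]

/-! ### Formulas about strings and their evaluation by machines -/

/-- Formulas about strings, with variables in `Fin K`: `cats i js` says that the value of `i` is the
concatenation of the values of the variables `js`, and `eqc i j` says that `false` occurs equally
often in the values of `i` and `j`. -/
inductive Fm (K : ℕ)
  | cats (i : Fin K) (js : List (Fin K))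
  | eqc (i j : Fin K)
  | not (φ : Fm K)
  | and (φ ψ : Fm K)
  | ex (i : Fin K) (φ : Fm K)

/-- The string is empty or ends with `false`. -/
def Terminated (y : List Bool) : Prop := y = [] ∨ ∃ z, y = z ++ [false]

namespace Fm

variable {K : ℕ}

/-- Satisfaction, where quantifiers range over the terminated strings of length at most `N`. -/
def Sat (N : ℕ) : Fm K → (Fin K → List Bool) → Prop
  | cats i js, σ => σ i = (js.map σ).flatten
  | eqc i j, σ => (σ i).count false = (σ j).count false
  | not φ, σ => ¬ Sat N φ σ
  | and φ ψ, σ => Sat N φ σ ∧ Sat N ψ σ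
  | ex i φ, σ => ∃ y, Terminated y ∧ y.length ≤ N ∧ Sat N φ (Function.update σ i y)

/-- Every variable is bound at most once on each branch, free variables belong to `U`, and no atom
uses a variable twice. -/
def WF : Fm K → Finset (Fin K) → Prop
  | cats i js, U => i ∈ U ∧ (∀ j ∈ js, j ∈ U) ∧ (i :: js).Nodup
  | eqc i j, U => i ∈ U ∧ j ∈ U ∧ i ≠ j
  | not φ, U => WF φ U
  | and φ ψ, U => WF φ U ∧ WF ψ U
  | ex i φ, U => i ∉ U ∧ WF φ (insert i U)

instance decidableWF : (φ : Fm K) → (U : Finset (Fin K)) → Decidable (WF φ U)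
  | cats _ _, _ => inferInstanceAs (Decidable (_ ∧ _ ∧ _))
  | eqc _ _, _ => inferInstanceAs (Decidable (_ ∧ _ ∧ _))
  | not φ, U => decidableWF φ U
  | and φ ψ, U => @instDecidableAnd _ _ (decidableWF φ U) (decidableWF ψ U)
  | ex _ φ, _ => @instDecidableAnd _ _ inferInstance (decidableWF φ _)

/-- Control states of the evaluation of formulas. -/
inductive Ctl (K : ℕ)
  | toEnd | load | load' | accept | reject
  | eval (pol : Bool) (φ : Fm K)
  | guessLast (pol : Bool) (i : Fin K) (φ : Fm K)
  | guess (pol : Bool) (i : Fin K) (φ : Fm K)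

namespace Ctl

/-- The answer `b`, read with polarity `pol`. -/
def answer (pol b : Bool) : Ctl K := if pol = b then accept else reject

/-- Kinds of control states. -/
def kind : Ctl K → StateKind
  | accept => .accept
  | reject => .reject
  | eval pol (.and _ _) => if !pol then .existential else .universal
  | eval pol (.ex _ _) => if pol then .existential else .universal
  | guessLast pol _ _ => if pol then .existential else .universal
  | guess pol _ _ => if pol then .existential else .universal
  | _ => .existential

/-- Leave the tape contents unchanged, and move the head on the tape `i`. -/
def move (r : Fin K → Option (Bool ⊕ Empty)) (i : Fin K) (d : Turing.Dir) (j : Fin K) :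
    Option (Bool ⊕ Empty) × Option Turing.Dir := (r j, if j = i then some d else none)

/-- Leave the tape contents unchanged, and move the heads on the tapes `i` and `i'`. -/
def move₂ (r : Fin K → Option (Bool ⊕ Empty)) (i i' : Fin K) (d : Turing.Dir) (j : Fin K) :
    Option (Bool ⊕ Empty) × Option Turing.Dir := (r j, if j = i ∨ j = i' then some d else none)

/-- Leave the tapes as they are. -/
def stay (r : Fin K → Option (Bool ⊕ Empty)) (j : Fin K) :
    Option (Bool ⊕ Empty) × Option Turing.Dir := (r j, none)

/-- Write `b` on the tape `i`, and move its head to the left. -/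
def put (r : Fin K → Option (Bool ⊕ Empty)) (i : Fin K) (b : Bool) (j : Fin K) :
    Option (Bool ⊕ Empty) × Option Turing.Dir :=
  if j = i then (some (.inl b), some .left) else (r j, none)

end Ctl

open Ctl Turing

/-- The transitions of the evaluation of formulas. -/
def next {k : ℕ} (φ₀ : Fm (k + 2)) : Ctl (k + 2) → (Fin (k + 2) → Option (Bool ⊕ Empty)) →
    Set (Ctl (k + 2) × (Fin (k + 2) → Option (Bool ⊕ Empty) × Option Turing.Dir))
  -- While the input is scanned, the same number of cells is marked on every tape reserved for a
  -- quantified variable; the marks later limit the length of guessed strings.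
  | toEnd, r => {if r 0 = none then (load, Ctl.move r 0 .left) else
      (toEnd, fun i => if i = 0 then (r i, some .right) else if i = 1 then (r i, none) else
        (some (.inl false), some .right))}
  | load, r => {if r 0 = none then (eval true φ₀, move₂ r 0 1 .right) else
      if r 0 = some (.inl false) then
        (load, fun i => if i = 0 then (r i, some .left) else put r 1 false i) else
        (load', put r 1 false)}
  | load', r => {(load, fun i => if i = 0 then (r i, some .left) else put r 1 true i)}
  | accept, _ => ∅
  | reject, _ => ∅
  -- Negation is never simulated by exchanging kinds afterwards: the polarity `pol` records the
  -- wanted truth value. Atoms only move heads to the right and are evaluated last on a branch, so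
  -- nothing needs to be rewound.
  | eval pol (.cats i []), r => {(if r i = none then answer pol true else answer pol false, stay r)}
  | eval pol (.cats i (j :: js)), r => {if r j = none then (eval pol (.cats i js), stay r) else
      if r i = r j then (eval pol (.cats i (j :: js)), move₂ r i j .right) else
      (answer pol false, stay r)}
  | eval pol (.eqc i j), r => {
      if r i = some (.inl true) then (eval pol (.eqc i j), Ctl.move r i .right) else
      if r j = some (.inl true) then (eval pol (.eqc i j), Ctl.move r j .right) else
      if r i = r j then
        if r i = none then (answer pol true, stay r) else
        (eval pol (.eqc i j), move₂ r i j .right) else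
      (answer pol false, stay r)}
  | eval pol (.not φ), r => {(eval (!pol) φ, stay r)}
  | eval pol (.and φ ψ), r => {(eval pol φ, stay r), (eval pol ψ, stay r)}
  | eval pol (.ex i φ), r => {(guessLast pol i φ, Ctl.move r i .left)}
  | guessLast pol i φ, r => {(eval pol φ, Ctl.move r i .right)} ∪
      {a | r i ≠ none ∧ a = (guess pol i φ, put r i false)}
  | guess pol i φ, r => {(eval pol φ, Ctl.move r i .right)} ∪
      {a | r i ≠ none ∧ ∃ b, a = (guess pol i φ, put r i b)}

/-- The control states used in the evaluation of a formula. -/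
def states : Fm K → Set (Ctl K)
  | cats i js => {s | ∃ pol : Bool, ∃ l ∈ {l | l ∈ js.tails}, eval pol (cats i l) = s}
  | eqc i j => {s | ∃ pol : Bool, eval pol (eqc i j) = s}
  | not φ => {s | ∃ pol : Bool, eval pol (not φ) = s} ∪ states φ
  | and φ ψ => {s | ∃ pol : Bool, eval pol (and φ ψ) = s} ∪ (states φ ∪ states ψ)
  | ex i φ => {s | ∃ pol : Bool, eval pol (ex i φ) = s} ∪ {s | ∃ pol : Bool, guessLast pol i φ = s} ∪
      {s | ∃ pol : Bool, guess pol i φ = s} ∪ states φ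

theorem finite_states (φ : Fm K) : φ.states.Finite := by
  induction φ with
  | cats i js =>
    have : states (cats i js) = ⋃ pol : Bool, (fun l => eval pol (cats i l)) '' {l | l ∈ js.tails} := by
      ext s
      simp [states]
    rw [this]
    exact Set.finite_iUnion fun _ => (List.finite_toSet _).image _
  | eqc i j => exact Set.finite_range _
  | not φ ih => exact (Set.finite_range _).union ih
  | and φ ψ ih₁ ih₂ => exact (Set.finite_range _).union (ih₁.union ih₂)
  | ex i φ ih =>
    exact (((Set.finite_range _).union (Set.finite_range _)).union (Set.finite_range _)).union ih

theorem eval_mem_states (pol : Bool) (φ : Fm K) : eval pol φ ∈ φ.states := by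
  cases φ <;> simp [states]

/-- The control states used in the evaluation of a formula on an input. -/
def allStates (φ : Fm K) : Set (Ctl K) := {toEnd, load, load', accept, reject} ∪ φ.states

theorem answer_mem (pol b : Bool) : (answer pol b : Ctl K) ∈ ({accept, reject} : Set (Ctl K)) := by
  unfold answer
  split_ifs <;> simp

/-- Evaluation descends only to subformulas and, within a concatenation atom, to tails of its list.
This gives finitely many states although the type `Ctl` contains all formulas. -/
theorem closed_states {k : ℕ} (φ₀ φ : Fm (k + 2)) {s : Ctl (k + 2)} (hs : s ∈ φ.states)
    (r : Fin (k + 2) → Option (Bool ⊕ Empty)) {a} (ha : a ∈ next φ₀ s r) :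
    a.1 ∈ ({accept, reject} : Set (Ctl (k + 2))) ∪ φ.states := by
  induction φ with
  | cats i js =>
    obtain ⟨pol, l, hl, rfl⟩ := hs
    simp only [List.mem_tails, Set.mem_ofPred_eq] at hl
    rcases l with _ | ⟨j, l⟩
    · simp only [next, Set.mem_singleton_iff] at ha
      subst ha
      left
      split_ifs <;> exact answer_mem _ _
    · simp only [next, Set.mem_singleton_iff] at ha
      subst ha
      split_ifs
      · exact .inr ⟨pol, l, by simpa using (List.suffix_cons j l).trans hl, rfl⟩
      · exact .inr ⟨pol, _, by simpa using hl, rfl⟩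
      · exact .inl (answer_mem _ _)
  | eqc i j =>
    obtain ⟨pol, rfl⟩ := hs
    simp only [next, Set.mem_singleton_iff] at ha
    subst ha
    split_ifs
    all_goals first | exact .inl (answer_mem _ _) | exact .inr ⟨pol, rfl⟩
  | not φ ih =>
    rcases hs with ⟨pol, rfl⟩ | hs
    · simp only [next, Set.mem_singleton_iff] at ha
      subst ha
      exact .inr (.inr (eval_mem_states _ _))
    · exact (ih hs).imp_right .inr
  | and φ ψ ih₁ ih₂ =>
    rcases hs with ⟨pol, rfl⟩ | hs | hs
    · simp only [next, Set.mem_singleton_iff, Set.mem_insert_iff] at ha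
      rcases ha with rfl | rfl
      · exact .inr (.inr (.inl (eval_mem_states _ _)))
      · exact .inr (.inr (.inr (eval_mem_states _ _)))
    · exact (ih₁ hs).imp_right fun h => .inr (.inl h)
    · exact (ih₂ hs).imp_right fun h => .inr (.inr h)
  | ex i φ ih =>
    rcases hs with ((⟨pol, rfl⟩ | ⟨pol, rfl⟩) | ⟨pol, rfl⟩) | hs
    · simp only [next, Set.mem_singleton_iff] at ha
      subst ha
      exact .inr (.inl (.inl (.inr ⟨pol, rfl⟩)))
    · rcases ha with rfl | ⟨-, rfl⟩
      · exact .inr (.inr (eval_mem_states _ _))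
      · exact .inr (.inl (.inr ⟨pol, rfl⟩))
    · rcases ha with rfl | ⟨-, b, rfl⟩
      · exact .inr (.inr (eval_mem_states _ _))
      · exact .inr (.inl (.inr ⟨pol, rfl⟩))
    · exact (ih hs).imp_right .inr

/-- The program that evaluates a formula. -/
def prog {k : ℕ} (φ : Fm (k + 2)) : Prog (k + 1) where
  Ctl := Ctl (k + 2)
  kind := kind
  start := toEnd
  next := next φ
  used := φ.allStates
  finite_used := (Set.toFinite _).union φ.finite_states
  start_mem := by simp [allStates]
  closed s hs r a ha := by
    rcases hs with (rfl | rfl | rfl | rfl | rfl) | hs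
    · simp only [next, Set.mem_singleton_iff] at ha
      subst ha
      left
      split_ifs <;> simp
    · simp only [next, Set.mem_singleton_iff] at ha
      subst ha
      split_ifs
      · exact .inr (eval_mem_states _ _)
      · left; simp
      · left; simp
    · simp only [next, Set.mem_singleton_iff] at ha
      subst ha
      left; simp
    · simp [next] at ha
    · simp [next] at ha
    · refine (closed_states φ φ hs r ha).imp_left ?_
      rintro (h | h) <;> simp_all

end Fm

/-! ### Correctness of the evaluation -/

/-- The tape `A` holds, from the position `h` on, the string `y` followed by blanks. -/
def Holds {Aux : Type} (A : ℤ → Option (Bool ⊕ Aux)) (h : ℤ) (y : List Bool) : Prop :=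
  ∀ p : ℕ, A (h + p) = (y[p]?).map Sum.inl

namespace Holds

variable {Aux : Type} {A : ℤ → Option (Bool ⊕ Aux)} {h : ℤ} {y : List Bool} {b : Bool}

theorem head_nil (H : Holds A h []) : A h = none := by simpa using H 0

theorem head_cons (H : Holds A h (b :: y)) : A h = some (.inl b) := by simpa using H 0

theorem tail (H : Holds A h (b :: y)) : Holds A (h + 1) y := fun p => by
  have := H (p + 1)
  rw [List.getElem?_cons_succ] at this
  rw [← this]
  congr 1
  push_cast
  ring

theorem cons (h₁ : A h = some (.inl b)) (H : Holds A (h + 1) y) : Holds A h (b :: y) := by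
  rintro (_ | p)
  · simpa using h₁
  · rw [List.getElem?_cons_succ, ← H p]
    congr 1
    push_cast
    ring

theorem cons_update [DecidableEq ℤ] (H : Holds A (h + 1) y) :
    Holds (Function.update A h (some (.inl b))) h (b :: y) := by
  refine cons (Function.update_self ..) fun p => ?_
  rw [Function.update_of_ne (by omega)]
  exact H p

theorem head_eq_none_iff (H : Holds A h y) : A h = none ↔ y = [] := by
  cases y with
  | nil => simpa using H.head_nil
  | cons b y => simp [H.head_cons]

end Holds

namespace Fm

open Ctl Turing ATM.Ensures

variable {k : ℕ} {φ₀ : Fm (k + 2)} {A : Fin (k + 2) → ℤ → Option (Bool ⊕ Empty)}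
  {h : Fin (k + 2) → ℤ}

theorem ensures_answer {pol b : Bool} {P : Prop} {T K : ℕ} (hP : b = true ↔ P) :
    (prog φ₀).Ensures (answer pol b) A h T K (pol = true ↔ P) := by
  unfold answer
  split_ifs with hb
  · refine Prog.Ensures.accept rfl ?_
    subst hb
    exact hP
  · refine Prog.Ensures.reject rfl ?_
    cases pol <;> cases b <;> simp_all

theorem switchLe_answer {b : StateKind} {pol b' : Bool} {K : ℕ} :
    SwitchLe b ((answer pol b' : Ctl (k + 2)).kind) K K := by
  refine SwitchLe.of_halt ?_
  unfold answer
  split_ifs <;> simp [kind]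

theorem wr_move (D : Fin (k + 2)) (d : Dir) :
    ATM.wr A h (Ctl.move (fun i => A i (h i)) D d) = A := ATM.wr_self ..

theorem wr_move₂ (D D' : Fin (k + 2)) (d : Dir) :
    ATM.wr A h (Ctl.move₂ (fun i => A i (h i)) D D' d) = A := ATM.wr_self ..

theorem wr_stay : ATM.wr A h (Ctl.stay (fun i => A i (h i))) = A := ATM.wr_self ..

theorem mv_stay (r : Fin (k + 2) → Option (Bool ⊕ Empty)) : ATM.mv h (Ctl.stay r) = h := by
  funext i
  simp [ATM.mv, Ctl.stay]

theorem mv_move (r : Fin (k + 2) → Option (Bool ⊕ Empty)) (D i : Fin (k + 2)) (d : Dir) :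
    ATM.mv h (Ctl.move r D d) i = if i = D then h i + ATM.shift (some d) else h i := by
  simp only [ATM.mv, Ctl.move]
  split_ifs <;> simp

theorem mv_move₂ (r : Fin (k + 2) → Option (Bool ⊕ Empty)) (D D' i : Fin (k + 2)) (d : Dir) :
    ATM.mv h (Ctl.move₂ r D D' d) i =
      if i = D ∨ i = D' then h i + ATM.shift (some d) else h i := by
  simp only [ATM.mv, Ctl.move₂]
  split_ifs <;> simp

theorem mv_put (r : Fin (k + 2) → Option (Bool ⊕ Empty)) (D i : Fin (k + 2)) (b : Bool) :
    ATM.mv h (Ctl.put r D b) i = if i = D then h i - 1 else h i := by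
  simp only [ATM.mv, Ctl.put]
  split_ifs <;> simp [sub_eq_add_neg]

theorem wr_put (D i : Fin (k + 2)) (b : Bool) :
    ATM.wr A h (Ctl.put (fun i => A i (h i)) D b) i =
      if i = D then Function.update (A i) (h i) (some (.inl b)) else A i := by
  simp only [ATM.wr, Ctl.put]
  split_ifs <;> simp

/-- Each step deletes an exhausted variable from the list or advances over equal letters, so `(σ
i).length + js.length` decreases. The variables are distinct because each tape has only one head. -/
theorem ensures_cats (pol : Bool) (i : Fin (k + 2)) (js : List (Fin (k + 2)))
    (σ : Fin (k + 2) → List Bool) (hnd : (i :: js).Nodup)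
    (hA : ∀ j ∈ i :: js, Holds (A j) (h j) (σ j)) (N : ℕ) :
    (prog φ₀).Ensures (eval pol (cats i js)) A h ((σ i).length + js.length + 1) 0
      (pol = true ↔ (cats i js).Sat N σ) := by
  induction hn : (σ i).length + js.length generalizing σ js h with
  | zero =>
    obtain rfl : js = [] := List.eq_nil_of_length_eq_zero (by omega)
    have hi : σ i = [] := List.eq_nil_of_length_eq_zero (by omega)
    have h0 : A i (h i) = none := by
      have := hA i (by simp)
      rw [hi] at this
      exact this.head_nil
    refine Prog.Ensures.det (K' := 0) (Or.inl rfl) rfl ?_ ?_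
    · simp only [h0]
      exact switchLe_answer
    · simp only [h0]
      exact ensures_answer (by simp [Sat, hi])
  | succ n ih =>
    rcases js with _ | ⟨j, js⟩
    · have hi : σ i ≠ [] := by
        rintro h0
        simp [h0] at hn
      have h0 : A i (h i) ≠ none := by
        rwa [Ne, (hA i (by simp)).head_eq_none_iff]
      refine Prog.Ensures.det (K' := 0) (Or.inl rfl) rfl ?_ ?_
      · simp only [h0]
        exact switchLe_answer
      · simp only [h0]
        exact ensures_answer (by simp [Sat, hi])
    · have hij : i ≠ j := by
        rintro rfl
        simp at hnd
      have hAi := hA i (by simp)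
      have hAj := hA j (by simp)
      by_cases hj : A j (h j) = none
      · have hσ : σ j = [] := by rwa [hAj.head_eq_none_iff] at hj
        refine Prog.Ensures.det (K' := 0) (Or.inl rfl) rfl ?_ ?_
        · simp only [hj, if_true]
          exact SwitchLe.refl_of_eq rfl
        · simp only [hj, if_true, wr_stay, mv_stay]
          have := ih (h := h) js σ (hnd.sublist (by simp)) (fun l hl => hA l (by simp at hl ⊢; tauto))
            (by simp at hn; omega)
          exact this.mono le_rfl le_rfl (by simp [Sat, hσ])
      · obtain ⟨b, t, hσj⟩ : ∃ b t, σ j = b :: t := by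
          rw [hAj.head_eq_none_iff] at hj
          exact List.exists_cons_of_ne_nil hj
        rw [hσj] at hAj
        by_cases hb : A i (h i) = A j (h j)
        · obtain ⟨t', hσi⟩ : ∃ t', σ i = b :: t' := by
            rcases hc : σ i with _ | ⟨b', t'⟩
            · rw [hc] at hAi
              rw [hAi.head_nil, hAj.head_cons] at hb
              simp at hb
            · rw [hc] at hAi
              rw [hAi.head_cons, hAj.head_cons] at hb
              simp at hb
              exact ⟨t', by rw [hb]⟩
          rw [hσi] at hAi
          refine Prog.Ensures.det (K' := 0) (Or.inl rfl) rfl ?_ ?_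
          · simp only [hj, hb, if_true, if_false]
            exact SwitchLe.refl_of_eq rfl
          · simp only [hj, hb, if_true, if_false, wr_move₂]
            -- The remaining suffixes become the new values; the truth of the equation does not
            -- change.
            set σ' := Function.update (Function.update σ i t') j t with hσ'
            have hi' : σ' i = t' := by rw [hσ', Function.update_of_ne hij, Function.update_self]
            have hj' : σ' j = t := by rw [hσ', Function.update_self]
            have ho : ∀ l, l ≠ i → l ≠ j → σ' l = σ l := fun l h1 h2 => by
              rw [hσ', Function.update_of_ne h2, Function.update_of_ne h1]
            have hnd' := hnd
            simp only [List.nodup_cons, List.mem_cons, not_or] at hnd'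
            have := ih (h := ATM.mv h (move₂ (fun i => A i (h i)) i j .right)) (j :: js) σ' hnd
              (fun l hl => ?_) (by simp [hσi] at hn; simp [hi']; omega)
            · refine this.mono le_rfl le_rfl ?_
              have hjs : js.map σ' = js.map σ := List.map_congr_left fun l hl =>
                ho l (by rintro rfl; exact hnd'.1.2 hl) (by rintro rfl; exact hnd'.2.1 hl)
              simp [Sat, hi', hj', hσi, hσj, hjs]
            · rw [mv_move₂]
              by_cases h1 : l = i
              · subst h1
                simpa [hi'] using hAi.tail
              by_cases h2 : l = j
              · subst h2
                simpa [hj'] using hAj.tail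
              simpa [h1, h2, ho l h1 h2] using hA l hl
        · refine Prog.Ensures.det (K' := 0) (Or.inl rfl) rfl ?_ ?_
          · simp only [hj, hb, if_false]
            exact switchLe_answer
          · simp only [hj, hb, if_false]
            refine ensures_answer ?_
            simp only [Sat, List.map_cons, List.flatten_cons, hσj, Bool.false_eq_true, false_iff]
            intro hc
            rw [hc] at hAi
            rw [List.cons_append] at hAi
            rw [hAi.head_cons, hAj.head_cons] at hb
            exact hb rfl

/-- Letters `true` are skipped on either tape, and letters `false` are cancelled in pairs; every
step shortens one of the remaining strings. -/
theorem ensures_eqc (pol : Bool) (i j : Fin (k + 2)) (σ : Fin (k + 2) → List Bool) (hij : i ≠ j)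
    (hi : Holds (A i) (h i) (σ i)) (hj : Holds (A j) (h j) (σ j)) (N : ℕ) :
    (prog φ₀).Ensures (eval pol (eqc i j)) A h ((σ i).length + (σ j).length + 1) 0
      (pol = true ↔ (eqc i j).Sat N σ) := by
  induction hn : (σ i).length + (σ j).length using Nat.strong_induction_on generalizing σ h with
  | _ n ih =>
  have key : ∀ h' : Fin (k + 2) → ℤ, ∀ u v : List Bool, Holds (A i) (h' i) u → Holds (A j) (h' j) v →
      u.length + v.length < n →
      ((u.count false = v.count false) ↔ ((σ i).count false = (σ j).count false)) →
      (prog φ₀).Ensures (eval pol (eqc i j)) A h' n 0 (pol = true ↔ (eqc i j).Sat N σ) := by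
    intro h' u v hu hv hlt hiff
    have hi' : Function.update (Function.update σ i u) j v i = u := by
      rw [Function.update_of_ne hij, Function.update_self]
    have hj' : Function.update (Function.update σ i u) j v j = v := Function.update_self ..
    have := ih _ hlt (h := h') (Function.update (Function.update σ i u) j v)
      (by rwa [hi']) (by rwa [hj']) (by rw [hi', hj'])
    refine this.mono (by omega) le_rfl ?_
    simp only [Sat, hi', hj', hiff]
  by_cases h1 : A i (h i) = some (.inl true)
  · obtain ⟨t, ht⟩ : ∃ t, σ i = true :: t := by
      rcases hc : σ i with _ | ⟨b', t'⟩
      · rw [hc] at hi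
        simp [hi.head_nil] at h1
      · rw [hc] at hi
        simp [hi.head_cons] at h1
        exact ⟨t', by rw [h1]⟩
    refine Prog.Ensures.det (K' := 0) (Or.inl rfl) rfl ?_ ?_
    · simp only [h1, if_true]
      exact SwitchLe.refl_of_eq rfl
    · simp only [h1, if_true, wr_move]
      refine key _ t (σ j) ?_ ?_ ?_ ?_
      · rw [mv_move, if_pos rfl]
        rw [ht] at hi
        exact hi.tail
      · rwa [mv_move, if_neg hij.symm]
      · simp [← hn, ht]
      · simp [ht]
  by_cases h2 : A j (h j) = some (.inl true)
  · obtain ⟨t, ht⟩ : ∃ t, σ j = true :: t := by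
      rcases hc : σ j with _ | ⟨b', t'⟩
      · rw [hc] at hj
        simp [hj.head_nil] at h2
      · rw [hc] at hj
        simp [hj.head_cons] at h2
        exact ⟨t', by rw [h2]⟩
    refine Prog.Ensures.det (K' := 0) (Or.inl rfl) rfl ?_ ?_
    · simp only [h1, h2, if_true, if_false]
      exact SwitchLe.refl_of_eq rfl
    · simp only [h1, h2, if_true, if_false, wr_move]
      refine key _ (σ i) t ?_ ?_ ?_ ?_
      · rwa [mv_move, if_neg hij]
      · rw [mv_move, if_pos rfl]
        rw [ht] at hj
        exact hj.tail
      · simp [← hn, ht]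
      · simp [ht]
  have hi2 : σ i = [] ∨ ∃ t, σ i = false :: t := by
    rcases hc : σ i with _ | ⟨_ | _, t'⟩
    · exact .inl rfl
    · exact .inr ⟨_, rfl⟩
    · rw [hc] at hi
      exact absurd hi.head_cons h1
  have hj2 : σ j = [] ∨ ∃ t, σ j = false :: t := by
    rcases hc : σ j with _ | ⟨_ | _, t'⟩
    · exact .inl rfl
    · exact .inr ⟨_, rfl⟩
    · rw [hc] at hj
      exact absurd hj.head_cons h2
  refine Prog.Ensures.det (K' := 0) (Or.inl rfl) rfl ?_ ?_
  · simp only [h1, h2, if_false]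
    split_ifs
    · exact switchLe_answer
    · exact SwitchLe.refl_of_eq rfl
    · exact switchLe_answer
  · simp only [h1, h2, if_false]
    rcases hi2 with hi2 | ⟨t, hi2⟩ <;> rcases hj2 with hj2 | ⟨t', hj2⟩ <;>
      rw [hi2] at hi <;> rw [hj2] at hj
    · simp only [hi.head_nil, hj.head_nil, if_true]
      exact ensures_answer (by simp [Sat, hi2, hj2])
    · simp only [hi.head_nil, hj.head_cons, reduceCtorEq, if_false]
      exact ensures_answer (by simp [Sat, hi2, hj2])
    · simp only [hi.head_cons, hj.head_nil, reduceCtorEq, if_false]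
      exact ensures_answer (by simp [Sat, hi2, hj2])
    · simp only [hi.head_cons, hj.head_cons, reduceCtorEq, if_false, if_true, wr_move₂]
      refine key _ t t' ?_ ?_ ?_ ?_
      · rw [mv_move₂, if_pos (.inl rfl)]
        exact hi.tail
      · rw [mv_move₂, if_pos (.inr rfl)]
        exact hj.tail
      · simp [← hn, hi2, hj2]
        omega
      · simp [hi2, hj2]

/-- The tapes of the variables in `U` hold their values; the heads of all other tapes are at the
right end of a block of `N` nonblank cells. -/
structure Ready (U : Finset (Fin (k + 2))) (σ : Fin (k + 2) → List Bool) (N : ℕ)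
    (A : Fin (k + 2) → ℤ → Option (Bool ⊕ Empty)) (h : Fin (k + 2) → ℤ) : Prop where
  holds : ∀ i ∈ U, Holds (A i) (h i) (σ i)
  fresh : ∀ i ∉ U, Holds (A i) (h i) [] ∧ (∀ p < N, A i (h i - 1 - (p : ℕ)) ≠ none) ∧
    A i (h i - 1 - (N : ℕ)) = none

/-- A bound on the number of switches in the evaluation of a formula. -/
def switches {K : ℕ} : Fm K → ℕ
  | cats _ _ => 0
  | eqc _ _ => 0
  | not φ => switches φ + 1
  | and φ ψ => max (switches φ) (switches ψ) + 1
  | ex _ φ => switches φ + 1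

/-- A bound on the time for the evaluation of a formula on strings of length at most `L`. -/
def time {K : ℕ} (L : ℕ) : Fm K → ℕ
  | cats _ js => L + js.length + 1
  | eqc _ _ => L + L + 1
  | not φ => time L φ + 1
  | and φ ψ => max (time L φ) (time L ψ) + 1
  | ex _ φ => time L φ + L + 3

theorem kind_eval_running {K : ℕ} (pol : Bool) (φ : Fm K) : ((eval pol φ).kind).Running := by
  cases φ <;> cases pol <;> simp [kind, StateKind.Running]

section guess

variable {φ : Fm (k + 2)} {U : Finset (Fin (k + 2))} {N L : ℕ} {pol : Bool} {i : Fin (k + 2)}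
  {T K : ℕ}

/-- The tapes other than `i` are as in `Ready`. -/
def ReadyAway (U : Finset (Fin (k + 2))) (i : Fin (k + 2)) (σ : Fin (k + 2) → List Bool) (N : ℕ)
    (A : Fin (k + 2) → ℤ → Option (Bool ⊕ Empty)) (h : Fin (k + 2) → ℤ) : Prop :=
  ∀ i' ≠ i, (i' ∈ U → Holds (A i') (h i') (σ i')) ∧ (i' ∉ U → Holds (A i') (h i') [] ∧
      (∀ p < N, A i' (h i' - 1 - (p : ℕ)) ≠ none) ∧ A i' (h i' - 1 - (N : ℕ)) = none)

theorem ReadyAway.congr {σ : Fin (k + 2) → List Bool} {A' : Fin (k + 2) → ℤ → Option (Bool ⊕ Empty)}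
    {h' : Fin (k + 2) → ℤ} (H : ReadyAway U i σ N A h) (hA : ∀ j ≠ i, A' j = A j)
    (hh : ∀ j ≠ i, h' j = h j) : ReadyAway U i σ N A' h' := fun j hj => by
  rw [hA j hj, hh j hj]
  exact H j hj

/-- Between guesses the head stands one cell to the left of the string `y` written so far. Moving
right ends the guess; unused marks remain on the left, where they do no harm because `Holds` looks
only to the right. -/
theorem ensures_exit_guess
    (ih : ∀ σ A h, Ready (insert i U) σ N A h → (∀ j ∈ insert i U, (σ j).length ≤ L) →
      (prog φ₀).Ensures (eval pol φ) A h T K (pol = true ↔ φ.Sat N σ))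
    {σ : Fin (k + 2) → List Bool} {y : List Bool} (hr : ReadyAway U i σ N A h)
    (hy : Holds (A i) (h i + 1) y) (hL : ∀ j ∈ U, (σ j).length ≤ L) (hyL : y.length ≤ L) :
    (prog φ₀).Ensures (eval pol φ) (ATM.wr A h (Ctl.move (fun i => A i (h i)) i .right))
      (ATM.mv h (Ctl.move (fun i => A i (h i)) i .right)) T K
      (pol = true ↔ φ.Sat N (Function.update σ i y)) := by
  refine ih (Function.update σ i y) _ _ ⟨fun j hj => ?_, fun j hj => ?_⟩ (fun j hj => ?_)
  · rw [wr_move, mv_move]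
    by_cases hji : j = i
    · subst hji
      simpa using hy
    · simpa [hji] using (hr j hji).1 (by simpa [hji] using hj)
  · simp only [Finset.mem_insert, not_or] at hj
    rw [wr_move, mv_move, if_neg hj.1]
    exact (hr j hj.1).2 hj.2
  · by_cases hji : j = i
    · subst hji
      rwa [Function.update_self]
    · rw [Function.update_of_ne hji]
      exact hL j (by simpa [hji] using hj)

/-- The string grows to the left by overwriting marks. The induction is on the number `m` of marks
left: the final value is the written part `y` preceded by at most `m` freely chosen letters. -/
theorem ensures_guess
    (ih : ∀ σ A h, Ready (insert i U) σ N A h → (∀ j ∈ insert i U, (σ j).length ≤ L) →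
      (prog φ₀).Ensures (eval pol φ) A h T K (pol = true ↔ φ.Sat N σ))
    (σ : Fin (k + 2) → List Bool) (m : ℕ) (y : List Bool) (hr : ReadyAway U i σ N A h)
    (hy : Holds (A i) (h i + 1) y) (hm : ∀ p < m, A i (h i - (p : ℕ)) ≠ none)
    (hm' : A i (h i - (m : ℕ)) = none)
    (hL : ∀ j ∈ U, (σ j).length ≤ L) (hyL : m + y.length ≤ L) :
    (prog φ₀).Ensures (guess pol i φ) A h (m + 1 + T) (K + 1)
      (pol = true ↔ ∃ z : List Bool, z.length ≤ m ∧ φ.Sat N (Function.update σ i (z ++ y))) := by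
  induction m generalizing y A h with
  | zero =>
    simp only [Nat.cast_zero, sub_zero] at hm'
    rw [show 0 + 1 + T = T + 1 by ring]
    refine Prog.Ensures.branch (fun _ => φ.Sat N (Function.update σ i y)) rfl ?_ ?_ ?_
    · rintro a (rfl | ⟨h0, -⟩)
      · exact ⟨K, SwitchLe.succ, ensures_exit_guess ih hr hy hL (by omega)⟩
      · exact absurd hm' h0
    · exact ⟨_, .inl rfl⟩
    · constructor
      · rintro ⟨z, hz, hs⟩
        obtain rfl : z = [] := List.eq_nil_of_length_eq_zero (by omega)
        exact ⟨_, .inl rfl, hs⟩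
      · rintro ⟨-, -, hs⟩
        exact ⟨[], le_rfl, hs⟩
  | succ m ihm =>
    have h0 : A i (h i) ≠ none := by simpa using hm 0 (by omega)
    rw [show m + 1 + 1 + T = (m + 1 + T) + 1 by ring]
    refine Prog.Ensures.branch (p := prog φ₀) (fun a : Ctl (k + 2) × _ =>
      (a.1 = eval pol φ ∧ φ.Sat N (Function.update σ i y)) ∨
      (a.1 = guess pol i φ ∧ ∃ b, a.2 = put (fun i => A i (h i)) i b ∧ ∃ z : List Bool,
        z.length ≤ m ∧ φ.Sat N (Function.update σ i (z ++ b :: y)))) rfl ?_ ?_ ?_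
    · rintro a (rfl | ⟨-, b, rfl⟩)
      · refine ⟨K, SwitchLe.succ, ?_⟩
        refine (ensures_exit_guess ih hr hy hL (by omega)).mono (by omega) le_rfl ?_
        simp
      · refine ⟨K + 1, SwitchLe.refl_of_eq rfl, ?_⟩
        refine (ihm (b :: y) ?_ ?_ ?_ ?_ ?_).mono le_rfl le_rfl ?_
        · exact hr.congr (fun j hj => by rw [wr_put, if_neg hj]) (fun j hj => by rw [mv_put, if_neg hj])
        · rw [wr_put, mv_put, if_pos rfl, if_pos rfl, sub_add_cancel]
          exact hy.cons_update
        · intro p hp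
          rw [wr_put, mv_put, if_pos rfl, if_pos rfl, Function.update_of_ne (by omega)]
          have := hm (p + 1) (by omega)
          rwa [show h i - 1 - (p : ℤ) = h i - ((p + 1 : ℕ) : ℤ) by push_cast; ring]
        · rw [wr_put, mv_put, if_pos rfl, if_pos rfl, Function.update_of_ne (by omega)]
          rwa [show h i - 1 - (m : ℤ) = h i - ((m + 1 : ℕ) : ℤ) by push_cast; ring]
        · simp only [List.length_cons]
          omega
        · have hinj : ∀ b', put (fun i => A i (h i)) i b = put (fun i => A i (h i)) i b' → b = b' := by
            intro b' hb
            have := congrFun hb i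
            simpa [put] using this
          simp only [reduceCtorEq, false_and, true_and, false_or]
          refine iff_congr Iff.rfl ⟨fun hz => ⟨b, rfl, hz⟩, ?_⟩
          rintro ⟨b', hb', hz⟩
          rwa [hinj b' hb']
    · exact ⟨_, .inl rfl⟩
    · constructor
      · rintro ⟨z, hz, hs⟩
        rcases List.eq_nil_or_concat z with rfl | ⟨z, b, rfl⟩
        · exact ⟨_, .inl rfl, .inl ⟨rfl, hs⟩⟩
        · refine ⟨_, .inr ⟨h0, b, rfl⟩, .inr ⟨rfl, b, rfl, z, by simpa using hz, ?_⟩⟩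
          simpa using hs
      · rintro ⟨a, -, ⟨-, hs⟩ | ⟨-, b, -, z, hz, hs⟩⟩
        · exact ⟨[], Nat.zero_le _, hs⟩
        · exact ⟨z ++ [b], by simpa using hz, by simpa using hs⟩

/-- The letter written first is the last one of the string. Forcing it to be `false` makes exactly
the nonempty terminated strings reachable; leaving at once gives the empty string. -/
theorem ensures_guessLast
    (ih : ∀ σ A h, Ready (insert i U) σ N A h → (∀ j ∈ insert i U, (σ j).length ≤ L) →
      (prog φ₀).Ensures (eval pol φ) A h T K (pol = true ↔ φ.Sat N σ))
    (σ : Fin (k + 2) → List Bool) (hr : ReadyAway U i σ N A h)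
    (hy : Holds (A i) (h i + 1) []) (hm : ∀ p < N, A i (h i - (p : ℕ)) ≠ none)
    (hm' : A i (h i - (N : ℕ)) = none)
    (hL : ∀ j ∈ U, (σ j).length ≤ L) (hyL : N ≤ L) :
    (prog φ₀).Ensures (guessLast pol i φ) A h (N + 1 + T) (K + 1)
      (pol = true ↔ (ex i φ).Sat N σ) := by
  rcases N with _ | N
  · simp only [Nat.cast_zero, sub_zero] at hm'
    rw [show 0 + 1 + T = T + 1 by ring]
    refine Prog.Ensures.branch (fun _ => φ.Sat 0 (Function.update σ i [])) rfl ?_ ?_ ?_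
    · rintro a (rfl | ⟨h0, -⟩)
      · exact ⟨K, SwitchLe.succ, ensures_exit_guess ih hr hy hL (by simp)⟩
      · exact absurd hm' h0
    · exact ⟨_, .inl rfl⟩
    · constructor
      · rintro ⟨z, -, hz, hs⟩
        obtain rfl : z = [] := List.eq_nil_of_length_eq_zero (by omega)
        exact ⟨_, .inl rfl, hs⟩
      · rintro ⟨-, -, hs⟩
        exact ⟨[], .inl rfl, le_rfl, hs⟩
  · have h0 : A i (h i) ≠ none := by simpa using hm 0 (by omega)
    rw [show N + 1 + 1 + T = (N + 1 + T) + 1 by ring]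
    refine Prog.Ensures.branch (p := prog φ₀) (fun a : Ctl (k + 2) × _ =>
      (a.1 = eval pol φ ∧ φ.Sat (N + 1) (Function.update σ i [])) ∨
      (a.1 = guess pol i φ ∧ ∃ z : List Bool,
        z.length ≤ N ∧ φ.Sat (N + 1) (Function.update σ i (z ++ [false])))) rfl ?_ ?_ ?_
    · rintro a (rfl | ⟨-, rfl⟩)
      · refine ⟨K, SwitchLe.succ, ?_⟩
        refine (ensures_exit_guess ih hr hy hL (by simp)).mono (by omega) le_rfl ?_
        simp
      · refine ⟨K + 1, SwitchLe.refl_of_eq rfl, ?_⟩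
        refine (ensures_guess ih σ N [false] ?_ ?_ ?_ ?_ hL ?_).mono le_rfl le_rfl (by simp)
        · exact hr.congr (fun j hj => by rw [wr_put, if_neg hj]) (fun j hj => by rw [mv_put, if_neg hj])
        · rw [wr_put, mv_put, if_pos rfl, if_pos rfl, sub_add_cancel]
          exact hy.cons_update
        · intro p hp
          rw [wr_put, mv_put, if_pos rfl, if_pos rfl, Function.update_of_ne (by omega)]
          have := hm (p + 1) (by omega)
          rwa [show h i - 1 - (p : ℤ) = h i - ((p + 1 : ℕ) : ℤ) by push_cast; ring]
        · rw [wr_put, mv_put, if_pos rfl, if_pos rfl, Function.update_of_ne (by omega)]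
          rwa [show h i - 1 - (N : ℤ) = h i - ((N + 1 : ℕ) : ℤ) by push_cast; ring]
        · simpa using hyL
    · exact ⟨_, .inl rfl⟩
    · constructor
      · rintro ⟨z, rfl | ⟨z, rfl⟩, hz, hs⟩
        · exact ⟨_, .inl rfl, .inl ⟨rfl, hs⟩⟩
        · exact ⟨_, .inr ⟨h0, rfl⟩, .inr ⟨rfl, z, by simpa using hz, hs⟩⟩
      · rintro ⟨a, -, ⟨-, hs⟩ | ⟨-, z, hz, hs⟩⟩
        · exact ⟨[], .inl rfl, by simp, hs⟩
        · exact ⟨z ++ [false], .inr ⟨z, rfl⟩, by simpa using hz, hs⟩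

end guess

end Fm

namespace Fm

open Ctl Turing ATM.Ensures

variable {k : ℕ} {φ₀ : Fm (k + 2)}

/-- A conjunction branches to two different formulas, but the branch condition must be a predicate
of the move; it is read off from the target state. -/
theorem exists_eval_eq {K : ℕ} (pol : Bool) (φ : Fm K) (P : Fm K → Prop) :
    (∃ χ, (eval pol φ : Ctl K) = eval pol χ ∧ P χ) ↔ P φ := by simp

/-- A quantifier needs a tape that still carries its marks, which is why `WF` forbids binding a
variable that is already in `U`. The bound `L` is separate from `N` since the value on tape `1` may
be longer than the input. -/
theorem ensures_eval (φ : Fm (k + 2)) {U : Finset (Fin (k + 2))} (pol : Bool)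
    {σ : Fin (k + 2) → List Bool} {N L : ℕ} {A : Fin (k + 2) → ℤ → Option (Bool ⊕ Empty)}
    {h : Fin (k + 2) → ℤ} (hwf : φ.WF U) (hr : Ready U σ N A h)
    (hL : ∀ j ∈ U, (σ j).length ≤ L) (hN : N ≤ L) :
    (prog φ₀).Ensures (eval pol φ) A h (φ.time L) φ.switches (pol = true ↔ φ.Sat N σ) := by
  induction φ generalizing U pol σ A h with
  | cats i js =>
    obtain ⟨hi, hjs, hnd⟩ := hwf
    have hU : ∀ j ∈ i :: js, j ∈ U := by
      intro j hj
      rcases List.mem_cons.1 hj with rfl | hj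
      · exact hi
      · exact hjs j hj
    refine (ensures_cats pol i js σ hnd (fun j hj => hr.holds j (hU j hj)) N).mono ?_ le_rfl Iff.rfl
    have := hL i hi
    simp only [time]
    omega
  | eqc i j =>
    obtain ⟨hi, hj, hij⟩ := hwf
    refine (ensures_eqc pol i j σ hij (hr.holds i hi) (hr.holds j hj) N).mono ?_ le_rfl Iff.rfl
    have := hL i hi
    have := hL j hj
    simp only [time]
    omega
  | not φ ih =>
    refine Prog.Ensures.det (p := prog φ₀) (K' := φ.switches) (kind_eval_running pol (Fm.not φ)) rfl SwitchLe.succ ?_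
    rw [wr_stay, mv_stay]
    refine (ih (!pol) hwf hr hL).mono le_rfl le_rfl ?_
    cases pol <;> simp [Sat]
  | and φ ψ ih₁ ih₂ =>
    have h₁ := ih₁ pol hwf.1 hr hL
    have h₂ := ih₂ pol hwf.2 hr hL
    have H : ∀ a ∈ (prog φ₀).next (eval pol (and φ ψ)) (fun i => A i (h i)),
        ∃ K', SwitchLe ((prog φ₀).kind (eval pol (and φ ψ))) ((prog φ₀).kind a.1) K'
          (and φ ψ).switches ∧
        (prog φ₀).Ensures a.1 (ATM.wr A h a.2) (ATM.mv h a.2) (max (φ.time L) (ψ.time L)) K'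
          (pol = true ↔ ∃ χ, a.1 = eval pol χ ∧ χ.Sat N σ) := by
      refine fun a ha => ⟨max φ.switches ψ.switches, SwitchLe.succ, ?_⟩
      rcases ha with rfl | rfl
      · rw [wr_stay, mv_stay]
        exact h₁.mono (le_max_left ..) (le_max_left ..)
          (iff_congr Iff.rfl (exists_eval_eq pol φ (Sat N · σ)).symm)
      · rw [wr_stay, mv_stay]
        exact h₂.mono (le_max_right ..) (le_max_right ..)
          (iff_congr Iff.rfl (exists_eval_eq pol ψ (Sat N · σ)).symm)
    cases pol
    · refine Prog.Ensures.existential _ rfl H ⟨fun hs => ?_, ?_⟩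
      · by_cases hφ : φ.Sat N σ
        · refine ⟨_, .inr rfl, iff_of_false (by simp) fun hc => ?_⟩
          exact absurd (hs.2 ⟨hφ, (exists_eval_eq ..).1 hc⟩) (by simp)
        · exact ⟨_, .inl rfl, iff_of_false (by simp) fun hc => hφ ((exists_eval_eq ..).1 hc)⟩
      · rintro ⟨a, rfl | rfl, ha⟩
        · exact iff_of_false (by simp) fun hs =>
            absurd (ha.2 ((exists_eval_eq false φ _).2 hs.1)) (by simp)
        · exact iff_of_false (by simp) fun hs =>
            absurd (ha.2 ((exists_eval_eq false ψ _).2 hs.2)) (by simp)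
    · refine Prog.Ensures.universal _ rfl H ⟨_, .inl rfl⟩ ⟨fun hs => ?_, fun ha => ?_⟩
      · rintro a (rfl | rfl)
        · exact iff_of_true rfl ((exists_eval_eq true φ _).2 (hs.1 rfl).1)
        · exact iff_of_true rfl ((exists_eval_eq true ψ _).2 (hs.1 rfl).2)
      · exact iff_of_true rfl ⟨(exists_eval_eq true φ _).1 ((ha _ (.inl rfl)).1 rfl),
          (exists_eval_eq true ψ _).1 ((ha _ (.inr rfl)).1 rfl)⟩
  | ex i φ ih =>
    obtain ⟨hi, hwf⟩ := hwf
    rw [time, show φ.time L + L + 3 = (φ.time L + L + 2) + 1 by ring]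
    have hf := hr.fresh i hi
    refine Prog.Ensures.det (p := prog φ₀) (K' := φ.switches + 1) (kind_eval_running pol (Fm.ex i φ)) rfl
      (SwitchLe.refl_of_eq rfl) ?_
    rw [wr_move]
    refine (ensures_guessLast (T := φ.time L) (K := φ.switches) (U := U) (L := L)
      (fun σ A h hr hL => ih pol hwf hr hL) σ ?_ ?_ ?_ ?_ hL hN).mono (by omega) le_rfl Iff.rfl
    · intro j hj
      rw [mv_move, if_neg hj]
      exact ⟨hr.holds j, hr.fresh j⟩
    · rw [mv_move, if_pos rfl]
      simpa using hf.1
    · rw [mv_move, if_pos rfl]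
      simpa [sub_eq_add_neg] using hf.2.1
    · rw [mv_move, if_pos rfl]
      simpa [sub_eq_add_neg] using hf.2.2

/-! ### Loading the input -/

/-- The coding of the letters of a word: `false` becomes `0` and `true` becomes `10`. -/
def letterCode (w : List Bool) : List Bool :=
  w.flatMap fun b => if b then [true, false] else [false]

theorem length_letterCode_le (w : List Bool) : (letterCode w).length ≤ 2 * w.length := by
  induction w with
  | nil => simp [letterCode]
  | cons b w ih =>
    rw [letterCode, List.flatMap_cons, ← letterCode, List.length_append, List.length_cons]
    cases b <;> simp <;> omega

/-- The assignment for the input `w`. -/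
def inputs (w : List Bool) (i : Fin (k + 2)) : List Bool :=
  if i = 0 then w else if i = 1 then letterCode w else []

/-- A block of `m` nonblank cells. -/
def marks (m : ℕ) (z : ℤ) : Option (Bool ⊕ Empty) :=
  if 0 ≤ z ∧ z < m then some (.inl false) else none

theorem onTape_holds {Aux : Type} (w : List Bool) : Holds (ATM.onTape (Aux := Aux) w) 0 w := by
  intro p
  simp [ATM.onTape]

theorem update_marks (m : ℕ) :
    Function.update (marks m) m (some (.inl false)) = marks (m + 1) := by
  funext z
  simp only [Function.update_apply, marks]
  split_ifs <;> first | rfl | (exfalso; omega)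

section load

variable {φ : Fm (k + 2)} (hwf : φ.WF {0, 1}) (w : List Bool)

include hwf

/-- The part `v` is already copied and `u` is still to be read, from right to left. A letter `true`
takes two steps because its code has two letters, whence `2 * u.length`. -/
theorem ensures_load (u v : List Bool) (huv : u ++ v = w)
    {A : Fin (k + 2) → ℤ → Option (Bool ⊕ Empty)} {h : Fin (k + 2) → ℤ}
    (hA : ∀ i, i ≠ 1 → A i = if i = 0 then ATM.onTape w else marks w.length)
    (hh : ∀ i, i ≠ 1 → h i = if i = 0 then (u.length : ℤ) - 1 else w.length)
    (h1 : Holds (A 1) (h 1 + 1) (letterCode v)) :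
    (prog φ).Ensures load A h (2 * u.length + 1 + φ.time (2 * w.length)) (φ.switches + 1)
      (φ.Sat w.length (inputs w)) := by
  induction u using List.reverseRecOn generalizing v A h with
  | nil =>
    obtain rfl : v = w := huv
    have h0 : A 0 (h 0) = none := by
      rw [hA 0 (by simp), hh 0 (by simp)]
      simp [ATM.onTape]
    rw [show 2 * ([] : List Bool).length + 1 + φ.time (2 * v.length) = φ.time (2 * v.length) + 1 by
      simp [Nat.add_comm]]
    refine Prog.Ensures.det (p := prog φ) (K' := φ.switches) (Or.inl rfl) rfl SwitchLe.succ ?_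
    simp only [h0, if_true, wr_move₂]
    refine (ensures_eval φ (σ := inputs v) (N := v.length) true hwf ⟨?_, ?_⟩ ?_ ?_).mono le_rfl le_rfl (by simp)
    · intro i hi
      rw [mv_move₂]
      simp only [Finset.mem_insert, Finset.mem_singleton] at hi
      rw [if_pos hi]
      rcases hi with rfl | rfl
      · rw [hA 0 (by simp), hh 0 (by simp)]
        simpa [inputs] using onTape_holds v
      · simpa [inputs] using h1
    · intro i hi
      rw [mv_move₂]
      simp only [Finset.mem_insert, Finset.mem_singleton] at hi
      rw [if_neg hi]
      rw [not_or] at hi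
      rw [hA i hi.2, hh i hi.2, if_neg hi.1, if_neg hi.1]
      refine ⟨fun p => ?_, fun p hp => ?_, ?_⟩
      · rw [marks, if_neg (by omega)]
        rfl
      · rw [marks, if_pos (by omega)]
        simp
      · rw [marks, if_neg (by omega)]
    · intro i hi
      simp only [Finset.mem_insert, Finset.mem_singleton] at hi
      rcases hi with rfl | rfl
      · simp [inputs]
        omega
      · simpa [inputs] using length_letterCode_le v
    · omega
  | append_singleton u b ih =>
    have h0 : A 0 (h 0) = some (.inl b) := by
      rw [hA 0 (by simp), hh 0 (by simp), ← huv]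
      simp [ATM.onTape]
    rw [show 2 * (u ++ [b]).length + 1 + φ.time (2 * w.length) =
      (2 * u.length + 1 + φ.time (2 * w.length) + 1) + 1 by simp; ring]
    cases b
    · refine Prog.Ensures.det (p := prog φ) (K' := φ.switches + 1) (Or.inl rfl) rfl ?_ ?_
      · simp only [h0]
        exact SwitchLe.refl_of_eq rfl
      · simp only [h0, reduceCtorEq, if_false, if_true]
        refine (ih (false :: v) (by simp [← huv]) ?_ ?_ ?_).mono (by omega) le_rfl Iff.rfl
        · intro i hi
          rw [← hA i hi]
          by_cases hi0 : i = 0 <;> simp [ATM.wr, put, hi, hi0, h0]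
        · intro i hi
          have := hh i hi
          by_cases hi0 : i = 0
          · subst hi0
            simp [ATM.mv, this]
            omega
          · simpa [ATM.mv, put, hi, hi0] using this
        · have := h1.cons_update (b := false)
          simpa [ATM.wr, ATM.mv, put, letterCode] using this
    · refine Prog.Ensures.det (p := prog φ) (K' := φ.switches + 1) (Or.inl rfl) rfl ?_ ?_
      · simp only [h0]
        exact SwitchLe.refl_of_eq rfl
      · simp only [h0, reduceCtorEq, if_false, Option.some.injEq, Sum.inl.injEq]
        refine Prog.Ensures.det (p := prog φ) (K' := φ.switches + 1) (Or.inl rfl) rfl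
          (SwitchLe.refl_of_eq rfl) ?_
        refine (ih (true :: v) (by simp [← huv]) ?_ ?_ ?_).mono le_rfl le_rfl Iff.rfl
        · intro i hi
          rw [← hA i hi]
          by_cases hi0 : i = 0 <;> simp [ATM.wr, ATM.mv, put, hi, hi0]
        · intro i hi
          have := hh i hi
          by_cases hi0 : i = 0
          · subst hi0
            simp [ATM.mv, put, this]
            omega
          · simpa [ATM.mv, put, hi, hi0] using this
        · have := h1.cons_update (b := false)
          rw [← sub_add_cancel (h 1) 1] at this
          have := Holds.cons_update (b := true) this
          simpa [ATM.wr, ATM.mv, put, letterCode, sub_eq_add_neg] using this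

theorem ensures_toEnd (m n : ℕ) (hm : m + n = w.length)
    {A : Fin (k + 2) → ℤ → Option (Bool ⊕ Empty)} {h : Fin (k + 2) → ℤ}
    (hA : ∀ i, A i = if i = 0 then ATM.onTape w else if i = 1 then fun _ => none else marks m)
    (hh : ∀ i, h i = if i = 1 then 0 else (m : ℤ)) :
    (prog φ).Ensures toEnd A h (n + 1 + (2 * w.length + 1 + φ.time (2 * w.length)))
      (φ.switches + 1) (φ.Sat w.length (inputs w)) := by
  induction n generalizing m A h with
  | zero =>
    have h0 : A 0 (h 0) = none := by
      rw [hA 0, hh 0]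
      simp [ATM.onTape, ← hm]
    rw [Nat.zero_add, Nat.add_comm 1]
    refine Prog.Ensures.det (p := prog φ) (K' := φ.switches + 1) (Or.inl rfl) rfl ?_ ?_
    · simp only [h0, if_true]
      exact SwitchLe.refl_of_eq rfl
    · simp only [h0, if_true, wr_move]
      refine ensures_load hwf w w [] (by simp) ?_ ?_ ?_
      · intro i hi
        rw [hA, if_neg hi, ← hm]
        simp
      · intro i hi
        rw [mv_move, hh, if_neg hi, ← hm]
        split_ifs <;> simp [sub_eq_add_neg]
      · rw [hA]
        intro p
        simp [letterCode]
  | succ n ih =>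
    have h0 : A 0 (h 0) ≠ none := by
      rw [hA 0, hh 0]
      simp [ATM.onTape, ← hm]
    rw [show n + 1 + 1 + (2 * w.length + 1 + φ.time (2 * w.length)) =
      n + 1 + (2 * w.length + 1 + φ.time (2 * w.length)) + 1 by ring]
    refine Prog.Ensures.det (p := prog φ) (K' := φ.switches + 1) (Or.inl rfl) rfl ?_ ?_
    · simp only [h0, if_false]
      exact SwitchLe.refl_of_eq rfl
    · simp only [h0, if_false]
      refine ih (m + 1) (by omega) ?_ ?_
      · intro i
        have h1 := hA i
        have h2 := hh i
        by_cases hi0 : i = 0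
        · subst hi0
          simpa [ATM.wr] using h1
        by_cases hi1 : i = 1
        · subst hi1
          simpa [ATM.wr] using h1
        · simp only [hi0, hi1, if_false] at h1 h2
          simp only [ATM.wr, hi0, hi1, if_false, h1, h2]
          exact_mod_cast update_marks m
      · intro i
        have h2 := hh i
        by_cases hi0 : i = 0
        · subst hi0
          simp [ATM.mv, h2]
        by_cases hi1 : i = 1
        · subst hi1
          simpa [ATM.mv] using h2
        · simp only [hi1, if_false] at h2
          simp [ATM.mv, hi0, hi1, h2]

end load

theorem exists_time_le {K : ℕ} (φ : Fm K) : ∃ a, ∀ L, φ.time L ≤ a * (L + 1) := by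
  induction φ with
  | cats i js => exact ⟨js.length + 1, fun L => by simp only [time]; nlinarith⟩
  | eqc i j => exact ⟨2, fun L => by simp only [time]; omega⟩
  | not φ ih =>
    obtain ⟨a, ha⟩ := ih
    exact ⟨a + 1, fun L => by have := ha L; simp only [time]; linarith⟩
  | and φ ψ ih₁ ih₂ =>
    obtain ⟨a, ha⟩ := ih₁
    obtain ⟨b, hb⟩ := ih₂
    refine ⟨a + b + 1, fun L => ?_⟩
    have := ha L
    have := hb L
    have : max (φ.time L) (ψ.time L) ≤ φ.time L + ψ.time L := by omega
    simp only [time]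
    linarith
  | ex i φ ih =>
    obtain ⟨a, ha⟩ := ih
    exact ⟨a + 3, fun L => by have := ha L; simp only [time]; linarith⟩

end Fm

/-! ### Linear bounds, and formulas in the linear-time hierarchy -/

theorem isLinearBound_of_le {g : ℕ → ℕ} {a b : ℕ} (h : ∀ n, g n ≤ a * n + b) :
    IsLinearBound g := by
  refine Asymptotics.IsBigO.of_bound (a + b) ?_
  filter_upwards [Filter.eventually_ge_atTop 1] with n hn
  rw [Real.norm_natCast, Real.norm_natCast]
  have := h n
  have : g n ≤ (a + b) * n := by nlinarith
  exact_mod_cast this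

theorem IsLinearBound.exists_le {g : ℕ → ℕ} (hg : IsLinearBound g) :
    ∃ C, ∀ n, g n ≤ C * n + C := by
  obtain ⟨c, hc⟩ := hg.bound
  obtain ⟨n₀, hn₀⟩ := Filter.eventually_atTop.1 hc
  -- The sum covers the finitely many arguments below `n₀`, where the asymptotic bound says nothing.
  refine ⟨⌈c⌉₊ + ∑ i ∈ Finset.range n₀, g i, fun n => ?_⟩
  by_cases hn : n₀ ≤ n
  · have h1 := hn₀ n hn
    rw [Real.norm_natCast, Real.norm_natCast] at h1
    have h2 : (g n : ℝ) ≤ (⌈c⌉₊ * n : ℕ) := by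
      push_cast
      exact h1.trans (mul_le_mul_of_nonneg_right (Nat.le_ceil c) (Nat.cast_nonneg n))
    have h3 : g n ≤ ⌈c⌉₊ * n := by exact_mod_cast h2
    nlinarith [Nat.zero_le (∑ i ∈ Finset.range n₀, g i)]
  · have : g n ≤ ∑ i ∈ Finset.range n₀, g i :=
      Finset.single_le_sum (fun i _ => Nat.zero_le (g i)) (Finset.mem_range.2 (by omega))
    nlinarith [Nat.zero_le ⌈c⌉₊, Nat.zero_le (∑ i ∈ Finset.range n₀, g i)]

/-- Satisfaction of a formula on an input is decided in the linear-time hierarchy. -/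
theorem Fm.setOf_sat_mem_linH {k : ℕ} (φ : Fm (k + 2)) (hwf : φ.WF {0, 1}) :
    ({w | φ.Sat w.length (inputs w)} : Language Bool) ∈ LinH := by
  obtain ⟨a, ha⟩ := φ.exists_time_le
  -- One switch may occur on entering the evaluation, and the level exceeds the number of switches
  -- by one.
  refine Set.mem_iUnion.2 ⟨φ.switches + 1 + 1,
    fun n => n + 1 + (2 * n + 1 + φ.time (2 * n)), ?_, ?_⟩
  · refine isLinearBound_of_le (a := 3 + 2 * a) (b := a + 2) fun n => ?_
    have := ha (2 * n)
    nlinarith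
  · refine ATM.mem_sigmaTime (M := (prog φ).toATM) rfl fun x => ?_
    refine ensures_toEnd hwf x 0 x.length (by simp) ?_ ?_ _ _ (ATM.rep_init x)
    · intro i
      by_cases hi : i = (0 : Fin (k + 2))
      · subst hi
        rfl
      · refine (if_neg hi).trans ?_
        rw [if_neg hi]
        split_ifs
        · rfl
        · funext z
          rw [marks, if_neg (by omega)]
          rfl
    · intro i
      simp

/-! ### Padding and complementation -/

/-- The kind of a state after the exchange of acceptance and rejection. -/
def StateKind.dual : StateKind → StateKind
  | .existential => .universal
  | .universal => .existential
  | .accept => .reject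
  | .reject => .accept

/-- A word followed by a marker and exponentially many copies of `false`. -/
def pad (x : List Bool) : List Bool :=
  x ++ [true] ++ List.replicate (2 ^ x.length - 1) false

namespace ATM

theorem length_pad (x : List Bool) : (pad x).length = x.length + 2 ^ x.length := by
  have := Nat.one_le_two_pow (n := x.length)
  simp only [pad, List.length_append, List.length_cons, List.length_nil, List.length_replicate]
  omega

/-- Control states of the computation of `pad`. -/
inductive PadCtl
  | copy | countLeft | countRight | rewind

instance finite_padCtl : Finite PadCtl :=
  Finite.of_surjective ![PadCtl.copy, .countLeft, .countRight, .rewind] <| by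
    rintro (_ | _ | _ | _)
    exacts [⟨0, rfl⟩, ⟨1, rfl⟩, ⟨2, rfl⟩, ⟨3, rfl⟩]

/-- Act on the first and on the last tape. -/
def onEnds {k : ℕ} {Γ : Type} (r : Fin (k + 2) → Γ) (u v : Γ × Option Turing.Dir)
    (i : Fin (k + 2)) : Γ × Option Turing.Dir :=
  if i = 0 then u else if i = Fin.last _ then v else (r i, none)

open Classical in
/-- The machine which replaces its input `x` by `pad x` and then runs `M` with acceptance and
rejection exchanged. The last tape holds a binary counter. -/
noncomputable abbrev padDual (M : ATM) : ATM where
  State := PadCtl ⊕ Option M.State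
  finite_state := by
    have := M.finite_state
    infer_instance
  Aux := M.Aux
  finite_aux := M.finite_aux
  extraTapes := M.extraTapes + 1
  kind
    | .inl _ => .existential
    | .inr none => .accept
    | .inr (some q) => (M.kind q).dual
  start := .inl .copy
  moves
    | .inl .copy, r => {if r 0 = none then
        (.inl .countLeft, onEnds r (some (.inl true), some .right) (r (Fin.last _), some .left)) else
        (.inl .copy, onEnds r (r 0, some .right) (some (.inl true), some .right))}
    | .inl .countLeft, r => {
        if r (Fin.last _) = some (.inl true) then
          (.inl .countRight, onEnds r (r 0, none) (some (.inl false), some .right)) else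
        if r (Fin.last _) = none then
          (.inl .rewind, onEnds r (r 0, some .left) (r (Fin.last _), none)) else
        (.inl .countLeft, onEnds r (r 0, none) (r (Fin.last _), some .left))}
    | .inl .countRight, r => {
        if r (Fin.last _) = none then
          (.inl .countLeft, onEnds r (some (.inl false), some .right) (r (Fin.last _), some .left)) else
        (.inl .countRight, onEnds r (r 0, none) (some (.inl true), some .right))}
    | .inl .rewind, r => {
        if r 0 = none then
          (.inr (some M.start), onEnds r (r 0, some .right) (r (Fin.last _), none)) else
        (.inl .rewind, onEnds r (r 0, some .left) (r (Fin.last _), none))}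
    | .inr none, _ => ∅
    -- A stuck configuration of `M` does not accept, so its dual needs an additional move to an
    -- accepting state.
    | .inr (some q), r => {a | (M.moves q (fun i => r i.castSucc) = ∅ ∧
          a = (.inr none, fun i => (r i, none))) ∨
        ∃ b ∈ M.moves q (fun i => r i.castSucc),
          a = (.inr (some b.1), Fin.snoc b.2 (r (Fin.last _), none))}

variable {M : ATM}

/-- A configuration of `M.padDual` simulates a configuration of `M`. -/
def Simulates (c : M.padDual.Cfg) (c₀ : M.Cfg) : Prop :=
  c.state = .inr (some c₀.state) ∧ ∀ i, c.tape (Fin.castSucc i) = c₀.tape i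

section simulates

variable {c : M.padDual.Cfg} {c₀ : M.Cfg}

theorem running_dual {a : StateKind} : a.dual.Running ↔ a.Running := by
  cases a <;> simp [StateKind.dual, StateKind.Running]

theorem switch_dual {a b : StateKind} : a.dual.Switch b.dual ↔ a.Switch b := by
  cases a <;> cases b <;> simp [StateKind.dual, StateKind.Switch]

theorem Simulates.kind (h : Simulates c c₀) :
    M.padDual.kind c.state = (M.kind c₀.state).dual := by
  rw [h.1]

theorem Simulates.head (h : Simulates c c₀) (i : Fin (M.extraTapes + 1)) :
    (c.tape i.castSucc).head = (c₀.tape i).head := by rw [h.2]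

theorem Simulates.moves (h : Simulates c c₀) :
    M.padDual.moves c.state (fun i => (c.tape i).head) =
      {a | (M.moves c₀.state (fun i => (c₀.tape i).head) = ∅ ∧
          a = (.inr none, fun i => ((c.tape i).head, none))) ∨
        ∃ b ∈ M.moves c₀.state (fun i => (c₀.tape i).head),
          a = (.inr (some b.1), Fin.snoc b.2 ((c.tape (Fin.last _)).head, none))} := by
  rw [h.1]
  have : (fun i : Fin (M.extraTapes + 1) => (c₀.tape i).head) =
    fun i => (c.tape (Fin.castSucc i)).head := funext fun i => (h.head i).symm
  rw [this]

/-- Steps of `M.padDual` that simulate steps of `M`. -/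
theorem Simulates.step_of_step (h : Simulates c c₀) {c₀' : M.Cfg} (hs : M.Step c₀ c₀') :
    ∃ c', M.padDual.Step c c' ∧ Simulates c' c₀' := by
  obtain ⟨hrun, b, hb, h₁, h₂⟩ := hs
  let a : M.padDual.State × (Fin (M.padDual.extraTapes + 1) → M.padDual.Symbol × Option Turing.Dir) :=
    (.inr (some b.1), Fin.snoc b.2 ((c.tape (Fin.last _)).head, none))
  refine ⟨⟨a.1, fun i => ATM.act (a.2 i) (c.tape i)⟩, ⟨?_, a, ?_, rfl, fun _ => rfl⟩, ?_, ?_⟩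
  · rw [h.kind]
    exact running_dual.2 hrun
  · rw [h.moves]
    exact .inr ⟨b, hb, rfl⟩
  · rw [h₁]
  · intro i
    rw [h₂, ← h.2 i]
    exact congrArg (fun w => ATM.act w _) (Fin.snoc_castSucc (α := fun _ => M.Symbol × Option Turing.Dir)
      ((c.tape (Fin.last _)).head, none) b.2 i)

theorem Simulates.of_step (h : Simulates c c₀) {c' : M.padDual.Cfg} (hs : M.padDual.Step c c') :
    ((∀ c₀', ¬ M.Step c₀ c₀') ∧ c'.state = .inr none) ∨
      ∃ c₀', M.Step c₀ c₀' ∧ Simulates c' c₀' := by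
  obtain ⟨hrun, a, ha, h₁, h₂⟩ := hs
  rw [h.moves] at ha
  rw [h.kind, running_dual] at hrun
  rcases ha with ⟨he, rfl⟩ | ⟨b, hb, rfl⟩
  · refine .inl ⟨?_, h₁⟩
    rintro c₀' ⟨-, b, hb, -⟩
    rw [he] at hb
    exact hb
  · refine .inr ⟨⟨b.1, fun i => ATM.act (b.2 i) (c₀.tape i)⟩, ⟨hrun, b, hb, rfl, fun _ => rfl⟩,
      h₁, fun i => ?_⟩
    rw [h₂]
    change _ = ATM.act (b.2 i) (c₀.tape i)
    rw [← h.2 i]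
    exact congrArg (fun w => ATM.act w _) (Fin.snoc_castSucc (α := fun _ => M.Symbol × Option Turing.Dir)
      ((c.tape (Fin.last _)).head, none) b.2 i)

theorem Simulates.exists_step (h : Simulates c c₀) (hr : (M.kind c₀.state).Running) :
    ∃ c', M.padDual.Step c c' := by
  by_cases he : (M.moves c₀.state (fun i => (c₀.tape i).head)).Nonempty
  · obtain ⟨b, hb⟩ := he
    obtain ⟨c', hc', -⟩ := h.step_of_step (c₀' := ⟨b.1, fun i => ATM.act (b.2 i) (c₀.tape i)⟩)
      ⟨hr, b, hb, rfl, fun _ => rfl⟩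
    exact ⟨c', hc'⟩
  · rw [Set.not_nonempty_iff_eq_empty] at he
    refine ⟨⟨.inr none, fun i => ATM.act ((c.tape i).head, none) (c.tape i)⟩, ?_,
      (.inr none, fun i => ((c.tape i).head, none)), ?_, rfl, fun _ => rfl⟩
    · rw [h.kind]
      exact running_dual.2 hr
    · rw [h.moves]
      exact .inl ⟨he, rfl⟩

/-- The additional unit of time pays for the move out of a stuck configuration. -/
theorem Simulates.bounded (h : Simulates c c₀) {T K : ℕ} (hb : M.Bounded T K c₀) :
    M.padDual.Bounded (T + 1) K c := by
  induction T generalizing K c c₀ with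
  | zero =>
    refine Bounded.of_step fun c' hs => ⟨K, ?_, (Ensures.SwitchLe.of_halt ?_)⟩
    all_goals
      rcases h.of_step hs with ⟨-, hc'⟩ | ⟨c₀', hs₀, -⟩
      · first
        | exact (good_accept (by rw [hc'])).1
        | exact .inl (by rw [hc'])
      · obtain ⟨T', hT', -⟩ := hb.step_stay hs₀
        omega
  | succ T ih =>
    refine Bounded.of_step fun c' hs => ?_
    rcases h.of_step hs with ⟨-, hc'⟩ | ⟨c₀', hs₀, hsim⟩
    · exact ⟨K, (good_accept (by rw [hc'])).1, (Ensures.SwitchLe.of_halt (.inl (by rw [hc'])))⟩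
    · rw [h.kind, hsim.kind, switch_dual]
      by_cases hsw : (M.kind c₀.state).Switch (M.kind c₀'.state)
      · obtain ⟨T', K', hT', rfl, hb'⟩ := hb.step_switch hs₀ hsw
        obtain rfl : T = T' := by omega
        exact ⟨K', ih hsim hb', by omega, fun _ => le_rfl⟩
      · obtain ⟨T', hT', hb'⟩ := hb.step_stay hs₀
        obtain rfl : T = T' := by omega
        exact ⟨K, ih hsim hb', le_rfl, fun hc => absurd hc hsw⟩

/-- De Morgan duality by induction on the time bound. The bound is essential: acceptance is
inductive, so with an infinite path both a machine and its dual may fail to accept. -/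
theorem Simulates.acceptsFrom_iff (h : Simulates c c₀) {T K : ℕ} (hb : M.Bounded T K c₀) :
    M.padDual.AcceptsFrom c ↔ ¬ M.AcceptsFrom c₀ := by
  induction T using Nat.strong_induction_on generalizing c c₀ with
  | _ T ih =>
  have hk := h.kind
  have key : ∀ c' c₀', M.Step c₀ c₀' → Simulates c' c₀' →
      (M.padDual.AcceptsFrom c' ↔ ¬ M.AcceptsFrom c₀') := by
    intro c' c₀' hs hsim
    obtain ⟨T', hT', hb'⟩ := hb.step_stay hs
    exact ih T' (by omega) hsim hb'
  rcases hc : M.kind c₀.state with _ | _ | _ | _ <;> rw [hc] at hk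
  · rw [acceptsFrom_universal hk, acceptsFrom_existential hc]
    refine ⟨?_, fun hacc => ⟨h.exists_step (.inl hc), fun c' hs => ?_⟩⟩
    · rintro ⟨-, hall⟩ ⟨c₀', hs, hacc⟩
      obtain ⟨c', hs', hsim⟩ := h.step_of_step hs
      exact (key c' c₀' hs hsim).1 (hall c' hs') hacc
    · rcases h.of_step hs with ⟨-, hc'⟩ | ⟨c₀', hs₀, hsim⟩
      · exact .accept (by rw [hc'])
      · exact (key c' c₀' hs₀ hsim).2 fun h' => hacc ⟨c₀', hs₀, h'⟩
  · rw [acceptsFrom_existential hk, acceptsFrom_universal hc]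
    constructor
    · rintro ⟨c', hs, hacc⟩ ⟨⟨c₁, hs₁⟩, hall⟩
      rcases h.of_step hs with ⟨hno, -⟩ | ⟨c₀', hs₀, hsim⟩
      · exact hno _ hs₁
      · exact (key c' c₀' hs₀ hsim).1 hacc (hall c₀' hs₀)
    · intro hnot
      by_cases hex : ∃ c₀', M.Step c₀ c₀'
      · rw [not_and] at hnot
        have := hnot hex
        push Not at this
        obtain ⟨c₀', hs₀, hacc⟩ := this
        obtain ⟨c', hs', hsim⟩ := h.step_of_step hs₀
        exact ⟨c', hs', (key c' c₀' hs₀ hsim).2 hacc⟩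
      · obtain ⟨c', hs'⟩ := h.exists_step (.inr hc)
        rcases h.of_step hs' with ⟨-, hc'⟩ | ⟨c₀', hs₀, -⟩
        · exact ⟨c', hs', .accept (by rw [hc'])⟩
        · exact absurd ⟨c₀', hs₀⟩ hex
  · have h₁ := (good_accept (T := 0) (K := 0) hc).2
    have h₂ := (good_reject (T := 0) (K := 0) hk).2
    tauto
  · have h₁ := (good_reject (T := 0) (K := 0) hc).2
    have h₂ := (good_accept (T := 0) (K := 0) hk).2
    tauto

end simulates

end ATM

namespace ATM

variable {M : ATM}

/-- Contents of the tapes of `M.padDual` when all but the first and the last one are blank. -/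
def tapesOf {k : ℕ} {Γ : Type} [Inhabited Γ] (B C : ℤ → Γ) (i : Fin (k + 2)) : ℤ → Γ :=
  if i = 0 then B else if i = Fin.last _ then C else fun _ => default

/-- Positions of the heads of `M.padDual` when all but the first and the last one are at `0`. -/
def headsOf {k : ℕ} (a b : ℤ) (i : Fin (k + 2)) : ℤ :=
  if i = 0 then a else if i = Fin.last _ then b else 0

section ends

variable {k : ℕ} {Γ : Type} [Inhabited Γ] (B C : ℤ → Γ) (a b : ℤ)

@[simp] theorem tapesOf_zero : tapesOf (k := k) B C 0 = B := rfl

@[simp] theorem headsOf_zero : headsOf (k := k) a b 0 = a := rfl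

@[simp] theorem tapesOf_last : tapesOf (k := k) B C (Fin.last _) = C := by
  simp [tapesOf, Fin.ext_iff]

@[simp] theorem headsOf_last : headsOf (k := k) a b (Fin.last _) = b := by
  simp [headsOf, Fin.ext_iff]

theorem wr_onEnds (u v : Γ × Option Turing.Dir) :
    wr (tapesOf (k := k) B C) (headsOf a b)
      (onEnds (fun i => tapesOf B C i (headsOf a b i)) u v) =
    tapesOf (Function.update B a u.1) (Function.update C b v.1) := by
  funext i
  by_cases h0 : i = 0
  · subst h0
    simp [wr, onEnds]
  by_cases h1 : i = Fin.last _
  · subst h1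
    simp [wr, onEnds, h0]
  · simp [wr, onEnds, tapesOf, headsOf, h0, h1]

omit [Inhabited Γ] in
theorem mv_onEnds (r : Fin (k + 2) → Γ) (u v : Γ × Option Turing.Dir) :
    mv (headsOf a b) (onEnds r u v) = headsOf (a + shift u.2) (b + shift v.2) := by
  funext i
  by_cases h0 : i = 0
  · subst h0
    simp [mv, onEnds]
  by_cases h1 : i = Fin.last _
  · subst h1
    simp [mv, onEnds, h0]
  · simp [mv, onEnds, headsOf, h0, h1]

end ends

theorem update_onTape_length {Aux : Type} (y : List Bool) (b : Bool) :
    Function.update (onTape (Aux := Aux) y) y.length (some (.inl b)) = onTape (y ++ [b]) := by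
  funext z
  rw [Function.update_apply]
  split_ifs with hz
  · subst hz
    simp [onTape]
  · rcases lt_or_ge z 0 with h0 | h0
    · simp [onTape, not_le.2 h0]
    · lift z to ℕ using h0
      simp only [onTape, Nat.cast_nonneg, if_true, Int.toNat_natCast]
      congr 1
      rcases lt_or_ge z y.length with h1 | h1
      · rw [List.getElem?_append_left h1]
      · have : z ≠ y.length := by exact_mod_cast hz
        rw [List.getElem?_eq_none h1, List.getElem?_eq_none (by simp; omega)]

/-- The contents `D` with the cells from `lo` to `hi - 1` overwritten by `b`. -/
def fill {Aux : Type} (D : ℤ → Option (Bool ⊕ Aux)) (lo hi : ℤ) (b : Bool) (z : ℤ) :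
    Option (Bool ⊕ Aux) := if lo ≤ z ∧ z < hi then some (.inl b) else D z

section pad

variable {T K : ℕ} {P : Prop} {B C D : ℤ → Option (Bool ⊕ M.Aux)} {a b : ℤ}

/-- `ATM.Ensures` for configurations of `M.padDual` during the computation of `pad`. -/
def PadEnsures (M : ATM) (s : PadCtl) (B C : ℤ → Option (Bool ⊕ M.Aux)) (a b : ℤ) (T K : ℕ)
    (P : Prop) : Prop :=
  M.padDual.Ensures (.inl s) (tapesOf (k := M.extraTapes) B C) (headsOf a b) T K P

theorem PadEnsures.of_move {s s' : PadCtl} (u v : Option (Bool ⊕ M.Aux) × Option Turing.Dir)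
    (hm : M.padDual.moves (.inl s) (fun i => tapesOf (k := M.extraTapes) B C i (headsOf a b i)) =
      {(.inl s', onEnds (fun i => tapesOf (k := M.extraTapes) B C i (headsOf a b i)) u v)})
    (H : M.PadEnsures s' (Function.update B a u.1) (Function.update C b v.1)
      (a + shift u.2) (b + shift v.2) T K P) : M.PadEnsures s B C a b (T + 1) K P := by
  refine Ensures.det (K' := K) (.inl rfl) hm (Ensures.SwitchLe.refl_of_eq rfl) ?_
  have e₁ := wr_onEnds (k := M.extraTapes) B C a b u v
  have e₂ := mv_onEnds (k := M.extraTapes) a b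
    (fun i => tapesOf (k := M.extraTapes) B C i (headsOf a b i)) u v
  rw [e₁, e₂]
  exact H

/-- A move that leaves the contents and the head of the first tape unchanged. -/
theorem PadEnsures.of_move_last {s s' : PadCtl} (v : Option (Bool ⊕ M.Aux) × Option Turing.Dir)
    (hm : M.padDual.moves (.inl s) (fun i => tapesOf (k := M.extraTapes) B C i (headsOf a b i)) =
      {(.inl s', onEnds (fun i => tapesOf (k := M.extraTapes) B C i (headsOf a b i)) (B a, none) v)})
    (H : M.PadEnsures s' B (Function.update C b v.1) a (b + shift v.2) T K P) :
    M.PadEnsures s B C a b (T + 1) K P := by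
  refine PadEnsures.of_move (B a, none) v hm ?_
  rw [Function.update_eq_self, shift_none, add_zero]
  exact H

/-- The padding phase is existential throughout, so its only possible switch is the entry into the
dual of `M`; hence `K + 1`. -/
theorem padEnsures_rewind (y : List Bool) (m : ℕ) (hm : m ≤ y.length) (s : M.padDual.State)
    (hs : s = .inr (some M.start)) (H : M.padDual.Ensures s
      (tapesOf (k := M.extraTapes) (onTape y) C) (headsOf 0 b) T K P) :
    M.PadEnsures .rewind (onTape y) C (m - 1) b (m + 1 + T) (K + 1) P := by
  subst hs
  induction m with
  | zero =>
    rw [Nat.zero_add, Nat.add_comm]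
    refine Ensures.det (K' := K) (a := (.inr (some M.start), onEnds (fun i =>
      tapesOf (k := M.extraTapes) (onTape y) C i (headsOf (((0 : ℕ) : ℤ) - 1) b i))
        (none, some .right) (C b, none))) (.inl rfl) ?_ Ensures.SwitchLe.succ ?_
    · simp [onTape]
    · have e₁ := wr_onEnds (k := M.extraTapes) (onTape y) C (((0 : ℕ) : ℤ) - 1) b
        (none, some .right) (C b, none)
      have e₂ := mv_onEnds (k := M.extraTapes) (((0 : ℕ) : ℤ) - 1) b (fun i =>
        tapesOf (k := M.extraTapes) (onTape y) C i (headsOf (((0 : ℕ) : ℤ) - 1) b i))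
        (none, some .right) (C b, none)
      rw [e₁, e₂]
      have e₃ : Function.update (onTape (Aux := M.Aux) y) (-1) none = onTape y := by
        rw [Function.update_eq_self_iff]
        simp [onTape]
      simpa [e₃] using H
  | succ m ih =>
    have h0 : onTape (Aux := M.Aux) y (((m + 1 : ℕ) : ℤ) - 1) ≠ none := by
      have : ((m + 1 : ℕ) : ℤ) - 1 = m := by push_cast; ring
      rw [this]
      simp [onTape]
      omega
    rw [show m + 1 + 1 + T = (m + 1 + T) + 1 by ring]
    refine PadEnsures.of_move (s' := .rewind) (onTape y (((m + 1 : ℕ) : ℤ) - 1), some .left)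
      (C b, none) ?_ ?_
    · simp only [tapesOf_zero, headsOf_zero, tapesOf_last, headsOf_last, h0, if_false]
    · have := ih (by omega)
      simpa [← sub_eq_add_neg] using this

/-- The second half of a decrement: after the lowest one has been cleared, the zeros below it become
ones again. Reaching the blank behind the counter appends one `false` to the first tape. -/
theorem padEnsures_countRight (D : ℤ → Option (Bool ⊕ M.Aux)) (n : ℤ) (hn : D n = none)
    (y : List Bool) (lo : ℤ) (i : ℕ)
    (H : M.PadEnsures .countLeft (onTape (y ++ [false])) (fill D lo n true) (y.length + 1) (n - 1)
      T K P) (hi : lo ≤ n - i) :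
    M.PadEnsures .countRight (onTape y) (fill (fill D lo n false) lo (n - i) true) y.length (n - i)
      (i + 1 + T) K P := by
  induction i with
  | zero =>
    have e : fill (fill D lo n false) lo (n - (0 : ℕ)) true = fill D lo n true := by
      funext z
      simp only [fill]
      split_ifs <;> first | rfl | omega
    rw [e, Nat.zero_add, Nat.add_comm]
    have h0 : fill D lo n true (n - (0 : ℕ)) = none := by simp [fill, hn]
    refine PadEnsures.of_move (s' := .countLeft) (some (.inl false), some .right)
      (none, some .left) ?_ ?_
    · simp only [tapesOf_last, headsOf_last, h0, if_true]
    · rw [update_onTape_length, ← h0, Function.update_eq_self]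
      simpa [← sub_eq_add_neg] using H
  | succ i ih =>
    have h0 : fill (fill D lo n false) lo (n - (i + 1 : ℕ)) true (n - (i + 1 : ℕ)) ≠ none := by
      simp only [fill]
      rw [if_neg (by omega), if_pos (by push_cast at hi ⊢; omega)]
      simp
    rw [show i + 1 + 1 + T = (i + 1 + T) + 1 by ring]
    refine PadEnsures.of_move_last (s' := .countRight) (some (.inl true), some .right) ?_ ?_
    · simp only [tapesOf_zero, headsOf_zero, tapesOf_last, headsOf_last, h0, if_false]
    · have e : Function.update (fill (fill D lo n false) lo (n - (i + 1 : ℕ)) true)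
          (n - (i + 1 : ℕ)) (some (.inl true)) = fill (fill D lo n false) lo (n - i) true := by
        funext z
        rw [Function.update_apply]
        simp only [fill]
        push_cast at hi ⊢
        split_ifs <;> first | rfl | omega
      rw [e]
      have := ih (by push_cast at hi ⊢; omega)
      simpa [show n - ((i : ℤ) + 1) + 1 = n - i by ring] using this

/-- The time for the countdown of a counter with `j` bits. -/
def countTime : ℕ → ℕ
  | 0 => 0
  | j + 1 => 2 * countTime j + j + 3

theorem countTime_le (j : ℕ) : countTime j ≤ 4 ^ (j + 1) := by
  induction j with
  | zero => simp [countTime]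
  | succ j ih =>
    have : j + 1 < 4 ^ (j + 1) := Nat.lt_pow_self (by norm_num)
    rw [countTime, pow_succ 4 (j + 1)]
    omega

/-- Counting `j + 1` ones down to zeros means counting down the low `j` bits, clearing the top bit
while restoring the low ones, and counting down again. The appended letters add up to `(2 ^ j - 1) +
1 + (2 ^ j - 1)`. The low end is on the right. -/
theorem padEnsures_countLeft (j : ℕ) (D : ℤ → Option (Bool ⊕ M.Aux)) (n : ℤ) (hn : D n = none)
    (y : List Bool)
    (H : M.PadEnsures .countLeft (onTape (y ++ List.replicate (2 ^ j - 1) false))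
      (fill D (n - j) n false) (y.length + (2 ^ j - 1 : ℕ)) (n - j - 1) T K P) :
    M.PadEnsures .countLeft (onTape y) (fill D (n - j) n true) y.length (n - 1)
      (countTime j + T) K P := by
  induction j generalizing D y T with
  | zero =>
    have e : ∀ b, fill D (n - (0 : ℕ)) n b = D := fun b => by
      funext z
      simp only [fill]
      rw [if_neg (by push_cast; omega)]
    rw [e] at H ⊢
    simpa [countTime] using H
  | succ j ih =>
    set p : ℤ := n - j - 1 with hp
    have hpow := Nat.one_le_two_pow (n := j)
    have hfill : ∀ b, fill D (n - (j + 1 : ℕ)) n b =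
        fill (Function.update D p (some (.inl b))) (n - j) n b := fun b => by
      funext z
      simp only [fill, Function.update_apply]
      push_cast
      split_ifs <;> first | rfl | omega
    have hD : ∀ b, Function.update D p (some (.inl b)) n = none := fun b => by
      rw [Function.update_of_ne (by omega), hn]
    have hread : ∀ b b', fill (Function.update D p (some (.inl b))) (n - j) n b' p =
        some (.inl b) := fun b b' => by
      rw [fill, if_neg (by omega), Function.update_self]
    -- Between the two recursive countdowns come one step on the top bit and `j + 1` steps to the
    -- right; the last unit is the step to the left across the cleared top bit.
    rw [hfill, show countTime (j + 1) + T =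
      countTime j + ((j + 1 + (countTime j + (T + 1))) + 1) by rw [countTime]; ring]
    refine ih _ (hD true) y ?_
    refine PadEnsures.of_move_last (s' := .countRight) (some (.inl false), some .right) ?_ ?_
    · simp only [tapesOf_last, headsOf_last, tapesOf_zero, headsOf_zero, hread, if_true]
    have e₁ : Function.update (fill (Function.update D p (some (.inl true))) (n - j) n false) p
        (some (.inl false)) = fill (fill (Function.update D p (some (.inl false))) (n - j) n false)
          (n - j) (n - j) true := by
      funext z
      simp only [fill, Function.update_apply]
      split_ifs <;> first | rfl | omega
    rw [e₁]
    set y' := y ++ List.replicate (2 ^ j - 1) false with hy'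
    have hlen : (y.length : ℤ) + (2 ^ j - 1 : ℕ) = y'.length := by simp [hy']
    rw [shift_right, hlen, show p + 1 = n - j by omega]
    refine padEnsures_countRight _ n (hD false) y' (n - j) j ?_ le_rfl
    have hlen' : (y'.length : ℤ) + 1 = (y' ++ [false]).length := by simp
    rw [hlen']
    refine ih _ (hD false) (y' ++ [false]) ?_
    have e₂ : y' ++ [false] ++ List.replicate (2 ^ j - 1) false =
        y ++ List.replicate (2 ^ (j + 1) - 1) false := by
      rw [hy', List.append_assoc, List.append_assoc]
      congr 1
      rw [← List.replicate_one, List.replicate_append_replicate, List.replicate_append_replicate]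
      congr 1
      rw [pow_succ]
      omega
    have e₃ : ((y' ++ [false]).length : ℤ) + (2 ^ j - 1 : ℕ) =
        y.length + (2 ^ (j + 1) - 1 : ℕ) := by
      have := congrArg List.length e₂
      rw [List.length_append, List.length_replicate, List.length_append (as := y),
        List.length_replicate] at this
      exact_mod_cast this
    rw [e₂, e₃]
    refine PadEnsures.of_move_last (s' := .countLeft) (some (.inl false), some .left) ?_ ?_
    · simp only [tapesOf_last, headsOf_last, tapesOf_zero, headsOf_zero, hread, Option.some.injEq,
        Sum.inl.injEq, reduceCtorEq, if_false]
    · have e₄ : Function.update (fill (Function.update D p (some (.inl false))) (n - j) n false) p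
          (some (.inl false)) = fill D (n - (j + 1 : ℕ)) n false := by
        rw [hfill, Function.update_eq_self_iff, hread]
      rw [e₄]
      rw [show n - ((j + 1 : ℕ) : ℤ) - 1 = p - 1 by push_cast; omega] at H
      simpa [← sub_eq_add_neg] using H

/-- The contents of the counter while it is being filled. -/
def ones {Aux : Type} (m : ℤ) : ℤ → Option (Bool ⊕ Aux) := fill (fun _ => none) 0 m true

theorem padEnsures_copy (x : List Bool) (m n : ℕ) (hmn : m + n = x.length)
    (H : M.PadEnsures .countLeft (onTape (x ++ [true])) (ones x.length) (x.length + 1)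
      (x.length - 1) T K P) :
    M.PadEnsures .copy (onTape x) (ones m) m m (n + 1 + T) K P := by
  induction n generalizing m with
  | zero =>
    obtain rfl : m = x.length := hmn
    have h0 : onTape (Aux := M.Aux) x (x.length : ℕ) = none := by simp [onTape]
    rw [Nat.zero_add, Nat.add_comm]
    refine PadEnsures.of_move (s' := .countLeft) (some (.inl true), some .right)
      (ones x.length x.length, some .left) ?_ ?_
    · simp only [tapesOf_last, headsOf_last, tapesOf_zero, headsOf_zero, h0, if_true]
    · rw [update_onTape_length, Function.update_eq_self]
      simpa [← sub_eq_add_neg] using H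
  | succ n ih =>
    have h0 : onTape (Aux := M.Aux) x (m : ℕ) ≠ none := by
      simp [onTape]
      omega
    rw [show n + 1 + 1 + T = (n + 1 + T) + 1 by ring]
    refine PadEnsures.of_move (s' := .copy) (onTape x m, some .right)
      (some (.inl true), some .right) ?_ ?_
    · simp only [tapesOf_zero, headsOf_zero, h0, if_false]
    · have e : Function.update (ones (Aux := M.Aux) m) m (some (.inl true)) = ones (m + 1) := by
        funext z
        simp only [ones, fill, Function.update_apply]
        split_ifs <;> first | rfl | omega
      rw [Function.update_eq_self, e]
      have := ih (m + 1) (by omega)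
      push_cast at this
      exact this

end pad

/-- `M` does not see the counter tape, and its other tapes are as at the start on input `y`. -/
theorem simulates_init {c : M.padDual.Cfg} {C : ℤ → Option (Bool ⊕ M.Aux)} {b : ℤ} {y : List Bool}
    (hc : M.padDual.Rep c (.inr (some M.start)) (tapesOf (k := M.extraTapes) (onTape y) C)
      (headsOf 0 b)) : Simulates c (M.init y) := by
  refine ⟨hc.1, fun i => Turing.Tape.nth_injective (funext fun p => ?_)⟩
  have h := hc.2 i.castSucc p
  have h' := (rep_init (M := M) y).2 i p
  refine h.trans (Eq.trans ?_ h'.symm)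
  have hl : i.castSucc ≠ Fin.last _ := (Fin.castSucc_lt_last i).ne
  by_cases hi : i = 0
  · subst hi
    simp
  · simp [tapesOf, hi, hl]
    rfl

theorem good_padDual (x : List Bool) {T K : ℕ} (hb : M.Bounded T K (M.init (pad x))) :
    M.padDual.Good (x.length + 1 + (countTime x.length + ((x.length + 2 ^ x.length + 1 + (T + 1)) + 1)))
      (K + 1) (¬ M.AcceptsFrom (M.init (pad x))) (M.padDual.init x) := by
  have h₁ : M.padDual.Ensures (.inr (some M.start)) (tapesOf (k := M.extraTapes) (onTape (pad x))
      (fill (fun _ => none) 0 x.length false)) (headsOf 0 (-1)) (T + 1) K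
      (¬ M.AcceptsFrom (M.init (pad x))) := fun c hc =>
    ⟨(simulates_init hc).bounded hb, (simulates_init hc).acceptsFrom_iff hb⟩
  have h₂ := padEnsures_rewind (pad x) (pad x).length le_rfl _ rfl h₁
  have h₃ : M.PadEnsures .countLeft (onTape (pad x)) (fill (fun _ => none) 0 x.length false)
      (pad x).length (-1) ((pad x).length + 1 + (T + 1) + 1) (K + 1)
      (¬ M.AcceptsFrom (M.init (pad x))) := by
    have h0 : fill (Aux := M.Aux) (fun _ => none) 0 x.length false (-1) = none := by simp [fill]
    refine PadEnsures.of_move (s' := .rewind) (onTape (pad x) (pad x).length, some .left)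
      (none, none) ?_ ?_
    · simp only [tapesOf_last, headsOf_last, tapesOf_zero, headsOf_zero, h0, reduceCtorEq, if_false,
        if_true]
    · have e : Function.update (fill (Aux := M.Aux) (fun _ => none) 0 x.length false) (-1) none =
          fill (fun _ => none) 0 x.length false := by
        rw [Function.update_eq_self_iff, h0]
      rw [Function.update_eq_self, e]
      simpa [← sub_eq_add_neg] using h₂
  have h₄ := padEnsures_countLeft (M := M) x.length (fun _ => none) x.length rfl (x ++ [true])
    (T := (pad x).length + 1 + (T + 1) + 1) (K := K + 1)
    (P := ¬ M.AcceptsFrom (M.init (pad x))) (by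
      have e : (((x ++ [true]).length : ℕ) : ℤ) + ((2 ^ x.length - 1 : ℕ) : ℤ) = (pad x).length := by
        simp [pad]
      rw [e, sub_self, zero_sub]
      exact h₃)
  rw [sub_self] at h₄
  have h₅ := padEnsures_copy x 0 x.length (by simp) (by simpa [ones] using h₄)
  rw [length_pad] at h₅
  refine h₅ _ ?_
  have := rep_init (M := M.padDual) x
  refine ⟨this.1, fun i p => (this.2 i p).trans ?_⟩
  have e : ones (Aux := M.Aux) ((0 : ℕ) : ℤ) = fun _ => none := by
    funext z
    simp only [ones, fill]
    rw [if_neg (by push_cast; omega)]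
  rw [e]
  by_cases h0 : i = 0
  · subst h0
    simp
  · simp only [tapesOf, headsOf, h0, if_false]
    split_ifs <;> rfl

end ATM

/-- If `L` is in the linear-time hierarchy, then the words `x` with `pad x ∉ L` form a language in
the exponential-time hierarchy. -/
theorem setOf_pad_notMem_mem_eh {L : Language Bool} (hL : L ∈ LinH) :
    ({x | pad x ∉ L} : Language Bool) ∈ EH := by
  obtain ⟨k, g, hg, M, hs, ht, rfl⟩ := Set.mem_iUnion.1 hL
  obtain ⟨C, hC⟩ := hg.exists_le
  -- `2 * n` reflects that the countdown takes at most `4 ^ (n + 1)` steps; `2 ^ C` absorbs the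
  -- constant of the linear bound for `M`, and `10` the remaining summands.
  refine Set.mem_iUnion.2 ⟨k - 1 + 1 + 1, fun n => 2 * n + (C + 10),
    isLinearBound_of_le fun n => le_rfl, ?_⟩
  refine ATM.mem_sigmaTime (M := M.padDual) rfl fun x => ?_
  have hb := (ATM.bounded_init hs ht (pad x))
  have hgood := ATM.good_padDual x hb
  refine ⟨hgood.1.mono ?_ le_rfl, hgood.2⟩
  rw [ATM.length_pad]
  set n := x.length
  have h₁ := ATM.countTime_le n
  have h₂ := hC (n + 2 ^ n)
  have h₃ : n < 2 ^ n := Nat.lt_two_pow_self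
  have h₄ : 2 ^ n * 2 ^ n = 4 ^ n := by rw [← mul_pow]; norm_num
  have h₅ : C < 2 ^ C := Nat.lt_two_pow_self
  have h₆ : 2 ^ (2 * n + (C + 10)) = 1024 * 2 ^ C * 4 ^ n := by
    rw [pow_add, pow_mul, pow_add]
    norm_num
    ring
  have h₇ : 4 ^ (n + 1) = 4 * 4 ^ n := by ring
  have h₈ : 2 ^ n ≤ 4 ^ n := Nat.pow_le_pow_left (by norm_num) n
  have h₉ : 1 ≤ 2 ^ n := Nat.one_le_two_pow
  rw [h₆]
  have h₁₀ : (C + 1) * 4 ^ n ≤ 2 ^ C * 4 ^ n := Nat.mul_le_mul_right _ h₅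
  have h₁₁ : C * (n + 2 ^ n) ≤ C * (2 * 4 ^ n) := Nat.mul_le_mul_left _ (by omega)
  have h₁₂ : C * 1 ≤ C * 4 ^ n := Nat.mul_le_mul_left _ (by omega)
  nlinarith

/-! ### Acceptance as a game with a local rule -/

/-- A set of words of naturals is winning for the local rule `R` if for each of its words and each
challenge `a` there are an answer `b` and a word of the set such that all pairs of a window of the
first and the corresponding letter of the second word obey the rule. -/
def IsWinning (R : ℕ → ℕ → ℕ → ℕ → ℕ → ℕ → Prop) (acts : Set ℕ) (S : Set (List ℕ)) : Prop :=
  ∀ v ∈ S, ∀ a ∈ acts, ∃ b, ∃ u ∈ S, u.length = v.length ∧ ∀ i x y z w, v[i]? = some x →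
    v[i + 1]? = some y → v[i + 2]? = some z → u[i + 1]? = some w → R a b x y z w

namespace ATM

variable (M : ATM)

/-- The cells of all tapes in one position relative to the heads, and the state at the heads. -/
abbrev Cell : Type := Option M.State × (Fin (M.extraTapes + 1) → M.Symbol)

/-- Moves of `M`. -/
abbrev Move : Type := M.State × (Fin (M.extraTapes + 1) → M.Symbol × Option Turing.Dir)

instance finite_symbol : Finite M.Symbol := by
  have := M.finite_aux
  unfold Symbol
  infer_instance

instance finite_cell : Finite M.Cell := by
  have := M.finite_state
  unfold Cell
  infer_instance

instance finite_move : Finite M.Move := by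
  have := M.finite_state
  have : Finite Turing.Dir := Finite.of_injective (β := Bool) (fun d => d matches .left) <| by
    rintro (_ | _) (_ | _) <;> simp
  unfold Move
  infer_instance

variable {M}

/-- The cell of a configuration in the position `p`. -/
def cell (C : M.Cfg) (p : ℤ) : M.Cell :=
  (if p = 0 then some C.state else none, fun i => (C.tape i).nth p)

/-- The configuration after a move. -/
def Cfg.apply (C : M.Cfg) (α : M.Move) : M.Cfg := ⟨α.1, fun i => act (α.2 i) (C.tape i)⟩

theorem step_iff {C C' : M.Cfg} : M.Step C C' ↔ (M.kind C.state).Running ∧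
    ∃ α ∈ M.moves C.state (fun i => (C.tape i).head), C' = C.apply α := by
  refine and_congr Iff.rfl (exists_congr fun α => and_congr Iff.rfl ?_)
  constructor
  · rintro ⟨h₁, h₂⟩
    rcases C' with ⟨s, T⟩
    obtain rfl : s = _ := h₁
    obtain rfl : T = _ := funext h₂
    rfl
  · rintro rfl
    exact ⟨rfl, fun _ => rfl⟩

/-- The symbol on tape `i` of a cell after the move `α` has written. -/
def Cell.written (z : M.Cell) (α : M.Move) (i : Fin (M.extraTapes + 1)) : M.Symbol :=
  if z.1.isSome then (α.2 i).1 else z.2 i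

/-- The cell `m` with the neighbours `l` and `r` after the move `α`. -/
def Cell.after (l m r : M.Cell) (α : M.Move) : M.Cell :=
  (m.1.map fun _ => α.1, fun i => match (α.2 i).2 with
    | none => m.written α i
    | some .left => l.written α i
    | some .right => r.written α i)

theorem written_cell (C : M.Cfg) (p : ℤ) (α : M.Move) (i : Fin (M.extraTapes + 1)) :
    (cell C p).written α i = if p = 0 then (α.2 i).1 else (C.tape i).nth p := by
  unfold Cell.written cell
  by_cases hp : p = 0 <;> simp [hp]

theorem cell_apply (C : M.Cfg) (α : M.Move) (p : ℤ) :
    cell (C.apply α) p = Cell.after (cell C (p - 1)) (cell C p) (cell C (p + 1)) α := by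
  refine Prod.ext ?_ (funext fun i => ?_)
  · by_cases hp : p = 0 <;> simp [cell, Cell.after, Cfg.apply, hp]
  · have h : (cell (C.apply α) p).2 i = (act (α.2 i) (C.tape i)).nth p := rfl
    rw [h, act_nth]
    simp only [Cell.after, written_cell]
    rcases (α.2 i).2 with _ | _ | _ <;> simp [sub_eq_add_neg] <;> rfl

/-- The local rule of the acceptance game of `M`: against the challenge `a`, the answer `β` turns the
cell `m` with the neighbours `l` and `r` into `m'`. -/
def Rule (M : ATM) (a : M.Move) (β : Option M.Move) (l m r m' : M.Cell) : Prop :=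
  match β with
  | none => m' = m ∧ ∀ q, m.1 = some q → M.kind q = .accept ∨
      (M.kind q = .universal ∧ (M.moves q m.2).Nonempty ∧ a ∉ M.moves q m.2)
  | some α => m' = Cell.after l m r α ∧ ∀ q, m.1 = some q → α ∈ M.moves q m.2 ∧
      (M.kind q = .existential ∨ (M.kind q = .universal ∧ α = a))

/-- Codes of the cells and moves of `M` by numbers. -/
structure Coding (M : ATM) where
  cell : M.Cell → ℕ
  cell_injective : Function.Injective cell
  act : M.Move → ℕ
  act_injective : Function.Injective act
  answer : Option M.Move → ℕ
  answer_injective : Function.Injective answer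

/-- The local rule in terms of codes. -/
def Coding.Rule (e : M.Coding) (a b x y z w : ℕ) : Prop :=
  ∃ a' β l m r m', M.Rule a' β l m r m' ∧ a = e.act a' ∧ b = e.answer β ∧ x = e.cell l ∧
    y = e.cell m ∧ z = e.cell r ∧ w = e.cell m'

/-- The word of the cells of `C` in positions `-N`, …, `n - N - 1`. -/
def Coding.word (e : M.Coding) (N n : ℕ) (C : M.Cfg) : List ℕ :=
  (List.range n).map fun j : ℕ => e.cell (ATM.cell C ((j : ℤ) - N))

variable (e : M.Coding)

/-- An existential configuration answers with a move to an accepting successor, a universal one with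
the challenge itself. If the challenge is illegal there, or the state is accepting, the answer
`none` leaves the configuration unchanged. -/
theorem Coding.isWinning_words (N n : ℕ) :
    IsWinning e.Rule (Set.range e.act) {c | ∃ C, M.AcceptsFrom C ∧ c = e.word N n C} := by
  rintro _ ⟨C, hC, rfl⟩ _ ⟨a, rfl⟩
  suffices H : ∃ β C', M.AcceptsFrom C' ∧
      ∀ p, M.Rule a β (ATM.cell C (p - 1)) (ATM.cell C p) (ATM.cell C (p + 1)) (ATM.cell C' p) by
    obtain ⟨β, C', hC', hW⟩ := H
    refine ⟨e.answer β, _, ⟨C', hC', rfl⟩, by simp [Coding.word], fun i x y z w hx hy hz hw => ?_⟩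
    simp only [Coding.word, List.getElem?_map, Option.map_eq_some_iff, List.getElem?_eq_some_iff,
      List.getElem_range, List.length_range] at hx hy hz hw
    obtain ⟨_, ⟨_, rfl⟩, rfl⟩ := hx
    obtain ⟨_, ⟨_, rfl⟩, rfl⟩ := hy
    obtain ⟨_, ⟨_, rfl⟩, rfl⟩ := hz
    obtain ⟨_, ⟨_, rfl⟩, rfl⟩ := hw
    have := hW (((i + 1 : ℕ) : ℤ) - N)
    refine ⟨a, β, _, _, _, _, this, rfl, rfl, ?_, rfl, ?_, rfl⟩
    · congr 2
      push_cast
      ring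
    · congr 2
      push_cast
      ring
  have hstate : ∀ p q, (ATM.cell C p).1 = some q → p = 0 ∧ q = C.state := by
    intro p q hq
    by_cases hp : p = 0
    · simp [ATM.cell, hp] at hq
      exact ⟨hp, hq.symm⟩
    · simp [ATM.cell, hp] at hq
  have hhead : (ATM.cell C 0).2 = fun i => (C.tape i).head := by
    funext i
    simp [ATM.cell]
  have hmove : ∀ α ∈ M.moves C.state (fun i => (C.tape i).head), M.AcceptsFrom (C.apply α) →
      (M.kind C.state = .existential ∨ (M.kind C.state = .universal ∧ α = a)) →
      ∃ β C', M.AcceptsFrom C' ∧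
      ∀ p, M.Rule a β (ATM.cell C (p - 1)) (ATM.cell C p) (ATM.cell C (p + 1)) (ATM.cell C' p) := by
    intro α hα hacc hk
    refine ⟨some α, _, hacc, fun p => ⟨cell_apply .., fun q hq => ?_⟩⟩
    obtain ⟨rfl, rfl⟩ := hstate p q hq
    rw [hhead]
    exact ⟨hα, hk⟩
  rcases hk : M.kind C.state with _ | _ | _ | _
  · obtain ⟨C', hs, hacc⟩ := (acceptsFrom_existential hk).1 hC
    obtain ⟨-, α, hα, rfl⟩ := step_iff.1 hs
    exact hmove α hα hacc (.inl hk)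
  · obtain ⟨⟨C₁, hs₁⟩, hall⟩ := (acceptsFrom_universal hk).1 hC
    by_cases ha : a ∈ M.moves C.state (fun i => (C.tape i).head)
    · exact hmove a ha (hall _ (step_iff.2 ⟨.inr hk, a, ha, rfl⟩)) (.inr ⟨hk, rfl⟩)
    · refine ⟨none, C, hC, fun p => ⟨rfl, fun q hq => .inr ?_⟩⟩
      obtain ⟨rfl, rfl⟩ := hstate p q hq
      rw [hhead]
      obtain ⟨-, α, hα, -⟩ := step_iff.1 hs₁
      exact ⟨hk, ⟨α, hα⟩, ha⟩
  · refine ⟨none, C, hC, fun p => ⟨rfl, fun q hq => .inl ?_⟩⟩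
    obtain ⟨rfl, rfl⟩ := hstate p q hq
    exact hk
  · exact absurd ((good_reject (T := 0) (K := 0) hk).2.1 hC) id

/-- The word `v` shows the cells of `C` in the positions of absolute value at most `r`. -/
def Coding.Shows (e : M.Coding) (N : ℕ) (v : List ℕ) (C : M.Cfg) (r : ℕ) : Prop :=
  r ≤ N ∧ ∀ d : ℤ, |d| ≤ r → v[(N + d).toNat]? = some (e.cell (ATM.cell C d))

/-- Nothing constrains the ends of the words, so with every move the reliable region around the
heads may shrink by one cell on each side. The remaining time shrinks too, and radius `T + 1` always
keeps the window at the heads reliable. -/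
theorem Coding.acceptsFrom_of_isWinning {S : Set (List ℕ)} (hS : IsWinning e.Rule (Set.range e.act) S)
    (N T K : ℕ) (C : M.Cfg) (hb : M.Bounded T K C) (v : List ℕ) (hv : v ∈ S)
    (hshow : e.Shows N v C (T + 1)) : M.AcceptsFrom C := by
  induction T using Nat.strong_induction_on generalizing C v with
  | _ T ih =>
  have hhead : (ATM.cell C 0).2 = fun i => (C.tape i).head := by
    funext i
    simp [ATM.cell]
  have key : ∀ a : M.Move, ∃ β, (∀ q, C.state = q → match β with
        | none => M.kind q = .accept ∨ (M.kind q = .universal ∧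
            (M.moves q (ATM.cell C 0).2).Nonempty ∧ a ∉ M.moves q (ATM.cell C 0).2)
        | some α => α ∈ M.moves q (ATM.cell C 0).2 ∧
            (M.kind q = .existential ∨ (M.kind q = .universal ∧ α = a))) ∧
      ∀ α, β = some α → ∀ T', T = T' + 1 → ∃ u ∈ S, e.Shows N u (C.apply α) (T' + 1) := by
    intro a
    obtain ⟨b, u, hu, hlen, hW⟩ := hS v hv _ ⟨a, rfl⟩
    have hwin : ∀ d : ℤ, |d| ≤ T → ∃ β m', M.Rule a β (ATM.cell C (d - 1)) (ATM.cell C d)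
        (ATM.cell C (d + 1)) m' ∧ b = e.answer β ∧ u[(N + d).toNat]? = some (e.cell m') := by
      intro d hd
      have hN := hshow.1
      rw [abs_le] at hd
      obtain ⟨i, hi⟩ : ∃ i : ℕ, (i : ℤ) + 1 = N + d := ⟨(N + d - 1).toNat, by omega⟩
      have h₁ := hshow.2 (d - 1) (by rw [abs_le]; push_cast; omega)
      have h₂ := hshow.2 d (by rw [abs_le]; push_cast; omega)
      have h₃ := hshow.2 (d + 1) (by rw [abs_le]; push_cast; omega)
      rw [show ((N : ℤ) + (d - 1)).toNat = i by omega] at h₁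
      rw [show ((N : ℤ) + d).toNat = i + 1 by omega] at h₂ ⊢
      rw [show ((N : ℤ) + (d + 1)).toNat = i + 2 by omega] at h₃
      obtain ⟨w, hw⟩ : ∃ w, u[i + 1]? = some w := by
        rw [List.getElem?_eq_some_iff] at h₂
        obtain ⟨h, -⟩ := h₂
        exact ⟨_, List.getElem?_eq_getElem (hlen ▸ h)⟩
      obtain ⟨a', β, l, m, r, m', hR, ha, hβ, hl, hm, hr, rfl⟩ := hW i _ _ _ _ h₁ h₂ h₃ hw
      obtain rfl := e.act_injective ha
      obtain rfl := e.cell_injective hl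
      obtain rfl := e.cell_injective hm
      obtain rfl := e.cell_injective hr
      exact ⟨β, m', hR, hβ, hw⟩
    obtain ⟨β, m', hR, hβ, -⟩ := hwin 0 (by simp)
    refine ⟨β, ?_, ?_⟩
    · rintro q rfl
      have h0 : (ATM.cell C 0).1 = some C.state := by simp [ATM.cell]
      rcases β with _ | α
      · exact hR.2 _ h0
      · exact hR.2 _ h0
    · rintro α rfl T' rfl
      refine ⟨u, hu, by have := hshow.1; omega, fun d hd => ?_⟩
      obtain ⟨β', m', hR', hβ', hm'⟩ := hwin d hd
      -- One letter `b` answers for all windows, so by injectivity all of them perform the same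
      -- move.
      obtain rfl : some α = β' := e.answer_injective (hβ.symm.trans hβ')
      rw [hm', hR'.1, cell_apply]
  have hne : Nonempty M.Move := ⟨(M.start, fun _ => (none, none))⟩
  have hnext : ∀ a α, M.Step C (C.apply α) → (∀ T', T = T' + 1 → ∃ u ∈ S, e.Shows N u (C.apply α) (T' + 1)) →
      a = α → M.AcceptsFrom (C.apply α) := by
    rintro _ α hs hex rfl
    obtain ⟨T', rfl, hb'⟩ := hb.step_stay hs
    obtain ⟨u, hu, hsh⟩ := hex T' rfl
    exact ih T' (by omega) _ hb' u hu hsh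
  obtain ⟨a⟩ := hne
  obtain ⟨β, h₁, h₂⟩ := key a
  have h₁ := h₁ _ rfl
  rcases hk : M.kind C.state with _ | _ | _ | _ <;> simp only [hk, hhead] at h₁
  · rcases β with _ | α
    · simp at h₁
    · have hs := step_iff.2 ⟨.inl hk, α, h₁.1, rfl⟩
      exact .existential hk hs (hnext α α hs (h₂ α rfl) rfl)
  · refine .universal hk ?_ fun C' hs => ?_
    · rcases β with _ | α
      · simp only [reduceCtorEq, true_and, false_or] at h₁
        obtain ⟨α, hα⟩ := h₁.1
        exact ⟨_, step_iff.2 ⟨.inr hk, α, hα, rfl⟩⟩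
      · exact ⟨_, step_iff.2 ⟨.inr hk, α, h₁.1, rfl⟩⟩
    · obtain ⟨-, α, hα, rfl⟩ := step_iff.1 hs
      -- The challenge is the very move whose successor must be shown accepting; as it is legal, the
      -- only permitted answer is this move.
      obtain ⟨β, h₁, h₂⟩ := key α
      have h₁ := h₁ _ rfl
      rcases β with _ | α'
      · simp only [hk, hhead, reduceCtorEq, true_and, false_or] at h₁
        exact absurd hα h₁.2
      · simp only [hk, reduceCtorEq, true_and, false_or] at h₁
        obtain ⟨-, rfl⟩ := h₁
        exact hnext _ _ hs (h₂ _ rfl) rfl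
  · exact .accept hk
  · rcases β with _ | α <;> simp at h₁

end ATM

/-! ### From strings to words of naturals -/

/-- The code of a word of naturals: each letter in unary, terminated by `false`. -/
def code (v : List ℕ) : List Bool := v.flatMap fun n => List.replicate n true ++ [false]

namespace code

theorem append (u v : List ℕ) : code (u ++ v) = code u ++ code v := by simp [code]

theorem cons (n : ℕ) (v : List ℕ) : code (n :: v) = List.replicate n true ++ false :: code v := by
  simp [code]

theorem flatten (l : List (List ℕ)) : code l.flatten = (l.map code).flatten := by
  induction l with
  | nil => rfl
  | cons u l ih => simp [append, ih]

theorem count_false (v : List ℕ) : (code v).count false = v.length := by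
  induction v with
  | nil => rfl
  | cons n v ih => simp [cons, ih, List.count_replicate]

theorem injective : Function.Injective code := by
  intro u
  induction u with
  | nil =>
    rintro (_ | ⟨m, v⟩) h
    · rfl
    · simp [code] at h
  | cons n u ih =>
    rintro (_ | ⟨m, v⟩) h
    · simp [code] at h
    · rw [cons, cons] at h
      have key : ∀ n m : ℕ, List.replicate n true ++ false :: code u =
          List.replicate m true ++ false :: code v → n = m ∧ code u = code v := by
        intro n
        induction n with
        | zero => rintro (_ | m) h <;> simp_all [List.replicate_succ]
        | succ n ihn =>
          rintro (_ | m) h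
          · simp [List.replicate_succ] at h
          · simpa using ihn m (by simpa [List.replicate_succ] using h)
      obtain ⟨rfl, h₂⟩ := key n m h
      rw [ih h₂]

theorem terminated (v : List ℕ) : Terminated (code v) := by
  rcases List.eq_nil_or_concat v with rfl | ⟨v, n, rfl⟩
  · exact .inl rfl
  · exact .inr ⟨code v ++ List.replicate n true, by simp [code]⟩

theorem exists_of_terminated {y : List Bool} (h : Terminated y) : ∃ v, y = code v := by
  rcases h with rfl | ⟨y, rfl⟩
  · exact ⟨[], rfl⟩
  · induction y with
    | nil => exact ⟨[0], rfl⟩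
    | cons b y ih =>
      obtain ⟨v, hv⟩ := ih
      rcases b with _ | _
      · exact ⟨0 :: v, by simp [cons, ← hv]⟩
      · rcases v with _ | ⟨n, v⟩
        · simp [code] at hv
        · exact ⟨(n + 1) :: v, by rw [cons, List.replicate_succ, List.cons_append, List.cons_append, ← cons, ← hv]⟩

/-- Tape `1` thus offers the bits of the input as letters `0` and `1`, while tape `0`, read as a
code, offers the word that the input encodes. -/
theorem letterCode_eq (w : List Bool) : Fm.letterCode w = code (w.map Bool.toNat) := by
  induction w with
  | nil => rfl
  | cons b w ih => cases b <;> simpa [Fm.letterCode, code] using ih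

end code

/-- The words with a code of length at most `N`. -/
def Words (N : ℕ) : Set (List ℕ) := {v | (code v).length ≤ N}

namespace Fm

variable {K : ℕ}

/-- Satisfaction for words of naturals instead of strings. -/
def SatN (N : ℕ) : Fm K → (Fin K → List ℕ) → Prop
  | cats i js, τ => τ i = (js.map τ).flatten
  | eqc i j, τ => (τ i).length = (τ j).length
  | not φ, τ => ¬ SatN N φ τ
  | and φ ψ, τ => SatN N φ τ ∧ SatN N ψ τ
  | ex i φ, τ => ∃ y ∈ Words N, SatN N φ (Function.update τ i y)

/-- Terminated strings are exactly the codes, so both quantifiers have the same range; `code` is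
injective and multiplicative, and it turns the number of `false` into the length. -/
theorem sat_code (N : ℕ) (φ : Fm K) (τ : Fin K → List ℕ) :
    φ.Sat N (fun i => code (τ i)) ↔ φ.SatN N τ := by
  induction φ generalizing τ with
  | cats i js =>
    have h : (js.map fun i => code (τ i)).flatten = code (js.map τ).flatten := by
      rw [code.flatten, List.map_map]
      rfl
    rw [Sat, h, code.injective.eq_iff, SatN]
  | eqc i j => simp [Sat, SatN, code.count_false]
  | not φ ih => exact not_congr (ih τ)
  | and φ ψ ih₁ ih₂ => exact and_congr (ih₁ τ) (ih₂ τ)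
  | ex i φ ih =>
    have h : ∀ v, (Function.update (fun i => code (τ i)) i (code v)) =
        fun j => code (Function.update τ i v j) := by
      intro v
      funext j
      by_cases hj : j = i
      · subst hj
        simp
      · simp [hj]
    constructor
    · rintro ⟨y, hy, hN, hs⟩
      obtain ⟨v, rfl⟩ := code.exists_of_terminated hy
      rw [h] at hs
      exact ⟨v, hN, (ih _).1 hs⟩
    · rintro ⟨v, hN, hs⟩
      refine ⟨_, code.terminated v, hN, ?_⟩
      rw [h]
      exact (ih _).2 hs

/-- Universal quantification. -/
def all (i : Fin K) (φ : Fm K) : Fm K := not (ex i (not φ))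

/-- Implication. -/
def imp (φ ψ : Fm K) : Fm K := not (and φ (not ψ))

/-- Quantification over several variables. -/
def exs (is : List (Fin K)) (φ : Fm K) : Fm K := is.foldr ex φ

/-- Universal quantification over several variables. -/
def alls (is : List (Fin K)) (φ : Fm K) : Fm K := is.foldr all φ

variable {N : ℕ} {τ : Fin K → List ℕ}

theorem satN_all {i : Fin K} {φ : Fm K} :
    (all i φ).SatN N τ ↔ ∀ y ∈ Words N, φ.SatN N (Function.update τ i y) := by
  simp [all, SatN]

theorem satN_imp {φ ψ : Fm K} : (imp φ ψ).SatN N τ ↔ (φ.SatN N τ → ψ.SatN N τ) := by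
  simp [imp, SatN]

/-! ### The formula for the game -/

/-- Conjunction of several formulas. -/
def conj (φ : Fm K) (φs : List (Fm K)) : Fm K := match φs with
  | [] => φ
  | ψ :: φs => and φ (conj ψ φs)

/-- The formula says that some set of words, which are separated by the letter `mk` in the word `S`,
is winning for the local rule that is listed in the input. -/
def game : Fm 35 :=
  let E := 0; let X := 1; let z := 2; let o := 3; let B := 4; let O := 5; let mk := 6
  let rest := 7; let mk' := 8; let xt := 9; let o' := 10; let o'' := 11
  let Z₁ := 12; let Z₂ := 13; let Z₃ := 14; let t := 15; let L := 16; let L' := 17; let c₀ := 18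
  let S := 19; let g := 20; let g' := 21; let c := 22; let a := 23; let b := 24; let u := 25
  let p := 26; let l := 27; let m := 28; let r := 29; let s := 30
  let p' := 31; let l' := 32; let m' := 33; let s' := 34
  -- Members of the set are the maximal stretches of `S` between two markers. Primed names such as
  -- `mk'` are copies, needed since no atom may use a variable twice.
  let mem (c : Fin 35) := and (exs [g, g'] (cats S [g, mk, c, mk', g']))
    (not (exs [g, g'] (cats c [g, mk, g'])))
  let commute (i j : Fin 35) := ex t (and (cats t [i, j]) (cats t [j, i]))
  exs [z, o, B, O, mk, rest, mk', xt, o', o'', Z₁, Z₂, Z₃, L, L', c₀, S] <| conj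
    -- A nonempty word without a proper factorization is a single letter, and words as long as `z`
    -- are single letters too. Commuting with a letter means being a power of it. So `Z₁`, `Z₂`,
    -- `Z₃` are blocks of zeros, `L` is a block of blanks as long as `Z₁`, and `c₀` is the initial
    -- configuration with this margin.
    (not (cats z [])) [alls [g, g'] (imp (cats z [g, g']) (not (and (not (cats g []))
      (not (cats g' []))))),
    eqc o z, eqc B z, eqc O z, eqc mk z, cats mk' [mk], cats o' [o], cats o'' [o], cats L' [L],
    eqc L Z₁, cats E [z, o, B, O, mk, rest], cats X [z, xt, o, Z₁, o', Z₂, o'', Z₃],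
    commute Z₁ z, commute Z₂ z, commute Z₃ z, commute L B, cats c₀ [L, O, xt, L'], mem c₀,
    all c <| imp (mem c) <| all a <| imp (and (eqc a z) (exs [g, g'] (cats E [g, mk, a, g']))) <|
    exs [b, u] <| conj (eqc b z) [mem u, eqc u c, alls [p, l, m, r, s, p', l', m', s'] <| imp
      (conj (cats c [p, l, m, r, s]) [cats u [p', l', m', s'], eqc p p', eqc l z, eqc m z, eqc r z,
        eqc l' z, eqc m' z])
      (exs [g, g'] (cats E [g, mk, a, b, l, m, r, m', g']))]]

theorem wf_game : game.WF {0, 1} := by decide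

end Fm


namespace Words

variable {N : ℕ}

theorem mem_iff {v : List ℕ} : v ∈ Words N ↔ (code v).length ≤ N := Iff.rfl

theorem append_iff {u v : List ℕ} :
    u ++ v ∈ Words N ↔ (code u).length + (code v).length ≤ N := by
  simp [Words, code.append]

theorem of_append_left {u v : List ℕ} (h : u ++ v ∈ Words N) : u ∈ Words N :=
  (Nat.le_add_right _ _).trans (append_iff.1 h)

theorem of_append_right {u v : List ℕ} (h : u ++ v ∈ Words N) : v ∈ Words N :=
  (Nat.le_add_left _ _).trans (append_iff.1 h)

theorem of_cons {n : ℕ} {v : List ℕ} (h : n :: v ∈ Words N) : v ∈ Words N :=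
  of_append_right (u := [n]) h

theorem of_head {n : ℕ} {v : List ℕ} (h : n :: v ∈ Words N) : [n] ∈ Words N :=
  of_append_left (u := [n]) h

theorem of_infix {u v : List ℕ} (h : u <:+: v) (hv : v ∈ Words N) : u ∈ Words N := by
  obtain ⟨s, t, rfl⟩ := h
  exact of_append_right (of_append_left hv)

end Words

/-- A word that commutes with a letter is a power of it. -/
theorem List.eq_replicate_of_append_singleton {n : ℕ} {v : List ℕ} (h : v ++ [n] = [n] ++ v) :
    v = List.replicate v.length n := by
  induction v with
  | nil => rfl
  | cons m v ih =>
    simp only [List.cons_append, List.nil_append, List.cons.injEq] at h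
    obtain ⟨rfl, h⟩ := h
    rw [List.length_cons, List.replicate_succ, ← ih h]

theorem List.append_cons_inj_right {n : ℕ} {u v u' v' : List ℕ} (hv : n ∉ v) (hv' : n ∉ v')
    (h : u ++ n :: v = u' ++ n :: v') : u = u' ∧ v = v' := by
  rcases List.append_eq_append_iff.1 h with ⟨w, rfl, h'⟩ | ⟨w, rfl, h'⟩
  · rcases w with _ | ⟨k, w⟩
    · simpa using h'
    · simp only [List.cons_append, List.cons.injEq] at h'
      exact absurd (h'.2 ▸ by simp) hv
  · rcases w with _ | ⟨k, w⟩
    · simpa [eq_comm] using h'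
    · simp only [List.cons_append, List.cons.injEq] at h'
      exact absurd (h'.2 ▸ by simp) hv'

theorem List.append_cons_inj_left {n : ℕ} {u v u' v' : List ℕ} (hu : n ∉ u) (hu' : n ∉ u')
    (h : u ++ n :: v = u' ++ n :: v') : u = u' ∧ v = v' := by
  rcases List.append_eq_append_iff.1 h with ⟨w, rfl, h'⟩ | ⟨w, rfl, h'⟩
  · rcases w with _ | ⟨k, w⟩
    · simpa using h'
    · simp only [List.cons_append, List.cons.injEq] at h'
      exact absurd (by simp [h'.1]) hu'
  · rcases w with _ | ⟨k, w⟩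
    · simpa [eq_comm] using h'
    · simp only [List.cons_append, List.cons.injEq] at h'
      exact absurd (by simp [h'.1]) hu

/-- The words of `rows`, each preceded by the letter `2`. -/
def marked (rows : List (List ℕ)) : List ℕ := (rows.map (2 :: ·)).flatten

theorem marked_cons (r : List ℕ) (rows : List (List ℕ)) :
    marked (r :: rows) = 2 :: (r ++ marked rows) := by
  simp [marked]

theorem marked_append (rows rows' : List (List ℕ)) :
    marked (rows ++ rows') = marked rows ++ marked rows' := by
  simp [marked]

/-- Since `2` occurs nowhere else, any occurrence of it starts a row. Allowing an arbitrary prefix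
without `2` lets the induction absorb the first row into the prefix. -/
theorem exists_of_marked_eq {rows : List (List ℕ)} {pre suf g v : List ℕ}
    (hr : ∀ r ∈ rows, 2 ∉ r) (hpre : 2 ∉ pre) (hsuf : 2 ∉ suf)
    (h : pre ++ (marked rows ++ suf) = g ++ 2 :: v) :
    ∃ r₁ r r₂, rows = r₁ ++ r :: r₂ ∧ v = r ++ (marked r₂ ++ suf) := by
  induction rows generalizing pre g with
  | nil =>
    have : 2 ∈ pre ++ (marked [] ++ suf) := h ▸ by simp
    simp [marked, hpre, hsuf] at this
  | cons r rows ih =>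
    rw [marked_cons, List.cons_append, List.append_assoc] at h
    rcases List.append_eq_append_iff.1 h with ⟨w, rfl, h'⟩ | ⟨w, rfl, h'⟩
    · rcases w with _ | ⟨k, w⟩
      · simp only [List.nil_append, List.cons.injEq, true_and] at h'
        exact ⟨[], r, rows, rfl, h'.symm⟩
      · simp only [List.cons_append, List.cons.injEq] at h'
        obtain ⟨r₁, r', r₂, rfl, hv⟩ := ih (fun r hr' => hr r (by simp [hr'])) (hr r (by simp)) h'.2
        exact ⟨r :: r₁, r', r₂, rfl, hv⟩
    · rcases w with _ | ⟨k, w⟩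
      · simp only [List.nil_append, List.cons.injEq, true_and] at h'
        exact ⟨[], r, rows, rfl, h'⟩
      · simp only [List.cons_append, List.cons.injEq] at h'
        exact absurd (by simp [h'.1]) hpre

/-- The local rule that is listed in the word `E`. -/
def listedRule (E : List ℕ) (a b x y z w : ℕ) : Prop := [2, a, b, x, y, z, w] <:+: E

/-- The challenges that are listed in the word `E`. -/
def listedActs (E : List ℕ) : Set ℕ := {a | [2, a] <:+: E}

namespace Fm

variable {N : ℕ} {τ : Fin 35 → List ℕ}

set_option maxHeartbeats 1000000 in
-- The winning set consists of the members of the guessed word `S`. Bounded quantifiers suffice, as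
-- all words in question are factors of `S` or of `E`, which belong to `Words N`.
theorem isWinning_of_satN_game {E E' xt : List ℕ} {B O t₁ t₂ t₃ : ℕ}
    (hE : E = 0 :: 1 :: B :: O :: 2 :: E') (hEN : E ∈ Words N) (h₀ : τ 0 = E)
    (h₁ : τ 1 = 0 :: (xt ++ 1 :: (List.replicate t₁ 0 ++ 1 :: (List.replicate t₂ 0 ++
      1 :: List.replicate t₃ 0)))) (h : game.SatN N τ) :
    ∃ S, IsWinning (listedRule E) (listedActs E) S ∧
      List.replicate t₁ B ++ (O :: (xt ++ List.replicate t₁ B)) ∈ S := by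
  simp (maxSteps := 1000000) only [game, exs, alls, List.foldr, SatN, satN_all, satN_imp, conj,
    List.map, Function.update_apply, List.flatten_cons, List.flatten_nil, List.append_nil,
    Fin.reduceEq, if_true, if_false, h₀, h₁] at h
  obtain ⟨z, hz, o, -, b, -, O', -, mk, -, rest, -, mk', -, xt', -, o', -, o'', -, Z₁, hZ₁, Z₂, -,
    Z₃, -, L, hL, L', -, c₀, -, S, hS, hz0, hirr, ho, hb, hO, hmk, rfl, rfl, rfl, rfl, hLZ, hEeq, hXeq,
    ⟨_, -, rfl, hc₁⟩, ⟨_, -, rfl, hc₂⟩, ⟨_, -, rfl, hc₃⟩, ⟨_, -, rfl, hcL⟩, rfl, hmem, hall⟩ := h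
  obtain ⟨z, rfl⟩ : ∃ a, z = [a] := by
    rcases z with _ | ⟨a, z⟩
    · exact absurd rfl hz0
    · rcases z with _ | ⟨a', z⟩
      · exact ⟨a, rfl⟩
      · exact absurd ⟨by simp, by simp⟩
          (hirr [a] (Words.of_head hz) (a' :: z) (Words.of_cons hz) rfl)
  obtain ⟨o, rfl⟩ := List.length_eq_one_iff.1 ho
  obtain ⟨b, rfl⟩ := List.length_eq_one_iff.1 hb
  obtain ⟨O', rfl⟩ := List.length_eq_one_iff.1 hO
  obtain ⟨mk, rfl⟩ := List.length_eq_one_iff.1 hmk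
  rw [hE] at hEeq
  simp only [List.cons_append, List.nil_append, List.cons.injEq] at hEeq
  obtain ⟨rfl, rfl, rfl, rfl, rfl, rfl⟩ := hEeq
  rw [List.eq_replicate_of_append_singleton hc₁, List.eq_replicate_of_append_singleton hc₂,
    List.eq_replicate_of_append_singleton hc₃] at hXeq
  simp only [List.cons_append, List.nil_append, List.cons.injEq, true_and] at hXeq
  -- `xt` may contain the letter `1`, but the blocks of zeros do not; splitting at the last three
  -- ones makes the parse unique.
  obtain ⟨rfl, ht⟩ : xt = xt' ∧ t₁ = Z₁.length := by
    have h0 : ∀ n, 1 ∉ List.replicate n 0 := fun n => by simp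
    have e : ∀ (a b c d : List ℕ), a ++ 1 :: (b ++ 1 :: (c ++ 1 :: d)) =
        (a ++ 1 :: (b ++ 1 :: c)) ++ 1 :: d := fun a b c d => by simp
    have e' : ∀ (a b c : List ℕ), a ++ 1 :: (b ++ 1 :: c) = (a ++ 1 :: b) ++ 1 :: c :=
      fun a b c => by simp
    rw [e, e] at hXeq
    have h₂ := (List.append_cons_inj_right (h0 _) (h0 _) hXeq).1
    rw [e', e'] at h₂
    have h₃ := List.append_cons_inj_right (h0 _) (h0 _)
      (List.append_cons_inj_right (h0 _) (h0 _) h₂).1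
    exact ⟨h₃.1, by simpa using congrArg List.length h₃.2⟩
  have hWS : ∀ {u v w : List ℕ}, S = u ++ ([2] ++ (v ++ ([2] ++ w))) → v ∈ Words N := by
    rintro u v w rfl
    exact Words.of_append_left (Words.of_append_right (Words.of_append_right hS))
  refine ⟨{v | (∃ g ∈ Words N, ∃ g' ∈ Words N, S = g ++ ([2] ++ (v ++ ([2] ++ g')))) ∧
    ¬ ∃ g ∈ Words N, ∃ g' ∈ Words N, v = g ++ ([2] ++ g')}, fun v hv a ha => ?_, by
    rw [List.eq_replicate_of_append_singleton hcL, hLZ, ← ht] at hmem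
    exact hmem⟩
  have hvN : v ∈ Words N := by
    obtain ⟨⟨u, -, w, -, hS'⟩, -⟩ := hv
    exact hWS hS'
  obtain ⟨g, g', hg⟩ := id ha
  simp only [List.append_assoc] at hg
  have haN : [a] ∈ Words N := Words.of_infix (List.infix_append' [2] [a] []) (Words.of_infix ha hEN)
  rw [← hg] at hEN
  obtain ⟨b, -, u, -, hb, hu, hlen, hrule⟩ := hall v hvN hv [a] haN ⟨rfl, g,
    Words.of_append_left hEN, g', Words.of_append_right (u := [2, a]) (Words.of_append_right hEN),
    by simp [← hg]⟩
  obtain ⟨b, rfl⟩ := List.length_eq_one_iff.1 hb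
  have huN : u ∈ Words N := by
    obtain ⟨⟨u, -, w, -, hS'⟩, -⟩ := hu
    exact hWS hS'
  refine ⟨b, u, hu, hlen, fun i x y z w hx hy hz hw => ?_⟩
  have h1 : v = v.take i ++ ([x] ++ ([y] ++ ([z] ++ v.drop (i + 3)))) := by
    obtain ⟨hi, rfl⟩ := List.getElem?_eq_some_iff.1 hz
    obtain ⟨_, rfl⟩ := List.getElem?_eq_some_iff.1 hy
    obtain ⟨_, rfl⟩ := List.getElem?_eq_some_iff.1 hx
    simp
  obtain ⟨w', h2⟩ : ∃ w', u = u.take i ++ ([w'] ++ ([w] ++ u.drop (i + 2))) := by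
    obtain ⟨hi, rfl⟩ := List.getElem?_eq_some_iff.1 hw
    exact ⟨u[i], by simp⟩
  have hl : i + 2 < v.length := (List.getElem?_eq_some_iff.1 hz).1
  have hv' := hvN
  have hu' := huN
  rw [h1] at hv'
  rw [h2] at hu'
  simp only [Words.append_iff, code.append, List.length_append] at hv' hu'
  obtain ⟨g, -, g', -, hE⟩ := hrule (v.take i) (Words.mem_iff.2 (by omega)) [x] (Words.mem_iff.2 (by omega))
    [y] (Words.mem_iff.2 (by omega)) [z] (Words.mem_iff.2 (by omega)) (v.drop (i + 3)) (Words.mem_iff.2 (by omega))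
    (u.take i) (Words.mem_iff.2 (by omega)) [w'] (Words.mem_iff.2 (by omega)) [w] (Words.mem_iff.2 (by omega))
    (u.drop (i + 2)) (Words.mem_iff.2 (by omega)) ⟨h1, h2, by simp; omega, rfl, rfl, rfl, rfl, rfl⟩
  exact ⟨g, g', by simp [hE]⟩

set_option maxHeartbeats 1000000 in
-- The list `cs`, with a closing marker, serves as `S`. The hypotheses on `Words N` say that every
-- witness fits below the length bound.
theorem satN_game_of_isWinning {E E' xt : List ℕ} {B O t₁ t₂ t₃ : ℕ} {cs : List (List ℕ)}
    (hE : E = 0 :: 1 :: B :: O :: 2 :: E') (hEN : E ∈ Words N) (h₀ : τ 0 = E)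
    (h₁ : τ 1 = 0 :: (xt ++ 1 :: (List.replicate t₁ 0 ++ 1 :: (List.replicate t₂ 0 ++
      1 :: List.replicate t₃ 0)))) (ht₁ : [0] ++ List.replicate t₁ 0 ∈ Words N)
    (ht₂ : [0] ++ List.replicate t₂ 0 ∈ Words N) (ht₃ : [0] ++ List.replicate t₃ 0 ∈ Words N)
    (hB : [B] ++ List.replicate t₁ B ∈ Words N) (hcs : ∀ v ∈ cs, 2 ∉ v ∧ 3 ≤ v.length)
    (hS : marked cs ++ [2] ∈ Words N)
    (hwin : IsWinning (listedRule E) (listedActs E) {v | v ∈ cs})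
    (hc : List.replicate t₁ B ++ (O :: (xt ++ List.replicate t₁ B)) ∈ cs) : game.SatN N τ := by
  have hmem : ∀ v ∈ cs, (∃ g ∈ Words N, ∃ g' ∈ Words N,
      marked cs ++ [2] = g ++ ([2] ++ (v ++ ([2] ++ g')))) ∧
      ¬ ∃ g ∈ Words N, ∃ g' ∈ Words N, v = g ++ ([2] ++ g') := by
    intro v hv
    constructor
    · obtain ⟨r₁, r₂, rfl⟩ := List.append_of_mem hv
      obtain ⟨g', hg'⟩ : ∃ g', marked r₂ ++ [2] = [2] ++ g' := by
        rcases r₂ with _ | ⟨r, r₂⟩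
        · exact ⟨[], rfl⟩
        · exact ⟨_, by rw [marked_cons]; rfl⟩
      have h : marked (r₁ ++ v :: r₂) ++ [2] = marked r₁ ++ ([2] ++ (v ++ ([2] ++ g'))) := by
        rw [marked_append, marked_cons, ← hg']
        simp
      rw [h] at hS
      exact ⟨_, Words.of_append_left hS, g', Words.of_append_right (Words.of_append_right
        (Words.of_append_right (Words.of_append_right hS))), h⟩
    · rintro ⟨g, -, g', -, rfl⟩
      exact (hcs _ hv).1 (by simp)
  have hmem' : ∀ v : List ℕ, (∃ g ∈ Words N, ∃ g' ∈ Words N,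
      marked cs ++ [2] = g ++ ([2] ++ (v ++ ([2] ++ g')))) ∧
      (¬ ∃ g ∈ Words N, ∃ g' ∈ Words N, v = g ++ ([2] ++ g')) → v ∈ cs := by
    rintro v ⟨⟨g, -, g', -, h⟩, hv⟩
    have hvN : v ∈ Words N := by
      rw [h] at hS
      exact Words.of_append_left (Words.of_append_right (Words.of_append_right hS))
    have hv2 : 2 ∉ v := fun h2 => by
      obtain ⟨a, b, rfl⟩ := List.append_of_mem h2
      exact hv ⟨a, Words.of_append_left hvN, b, Words.of_cons (Words.of_append_right hvN), rfl⟩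
    -- The closing marker is treated as the marker of an additional empty row.
    obtain ⟨r₁, r, r₂, hr, hvr⟩ := exists_of_marked_eq (rows := cs ++ [[]]) (pre := []) (suf := [])
      (g := g) (v := v ++ ([2] ++ g')) (by
        intro r hr
        rcases List.mem_append.1 hr with hr | hr
        · exact (hcs r hr).1
        · simp_all) (by simp) (by simp)
      (by rw [marked_append, List.nil_append, List.append_nil]; exact h)
    rcases List.eq_nil_or_concat r₂ with rfl | ⟨r₂, q, rfl⟩
    · obtain rfl : [] = r := by simpa using List.append_inj_right' hr rfl
      simp [marked] at hvr
    · have hr' : r ∈ cs := by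
        have : cs ++ [[]] = (r₁ ++ r :: r₂) ++ [q] := by simpa using hr
        rw [(List.append_inj' this rfl).1]
        simp
      obtain ⟨w, hw⟩ : ∃ w, marked (r₂ ++ [q]) = 2 :: w := by
        rcases r₂ with _ | ⟨r, r₂⟩
        · exact ⟨_, marked_cons ..⟩
        · exact ⟨_, marked_cons ..⟩
      rw [List.concat_eq_append, hw, List.append_nil] at hvr
      rwa [(List.append_cons_inj_left hv2 (hcs r hr').1 hvr).1]
  have hcsN : ∀ v ∈ cs, v ∈ Words N := by
    intro v hv
    obtain ⟨⟨g, -, g', -, h⟩, -⟩ := hmem v hv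
    rw [h] at hS
    exact Words.of_append_left (Words.of_append_right (Words.of_append_right hS))
  have hcN := hcsN _ hc
  have hEN' := hEN
  rw [hE] at hEN'
  have hLN := Words.of_append_left hcN
  have hcomm : ∀ n t : ℕ, [n] ++ List.replicate t n ∈ Words N → ∃ v ∈ Words N,
      v = List.replicate t n ++ [n] ∧ v = [n] ++ List.replicate t n := fun n t h =>
    ⟨_, h, by rw [← List.replicate_succ', List.singleton_append, List.replicate_succ], rfl⟩
  have hw1 := Words.of_cons hEN'
  have hw2 := Words.of_cons hw1
  have hw3 := Words.of_cons hw2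
  have hw4 := Words.of_cons hw3
  simp (maxSteps := 1000000) only [game, exs, alls, List.foldr, SatN, satN_all, satN_imp, conj,
    List.map, Function.update_apply, List.flatten_cons, List.flatten_nil, List.append_nil,
    Fin.reduceEq, if_true, if_false, h₀, h₁]
  refine ⟨[0], Words.of_head hEN', [1], Words.of_head hw1, [B], Words.of_head hw2, [O],
    Words.of_head hw3, [2], Words.of_head hw4, E', Words.of_cons hw4, [2], Words.of_head hw4, xt,
    Words.of_append_left (Words.of_cons (Words.of_append_right hcN)), [1], Words.of_head hw1, [1],
    Words.of_head hw1, _, Words.of_append_right ht₁, _, Words.of_append_right ht₂, _,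
    Words.of_append_right ht₃, _, hLN, _, hLN, _, hcN, _, hS, by simp, ?_, rfl, rfl, rfl, rfl, rfl,
    rfl, rfl, rfl, by simp, hE, rfl, hcomm _ _ ht₁, hcomm _ _ ht₂, hcomm _ _ ht₃, hcomm _ _ hB, rfl,
    hmem _ hc, ?_⟩
  · rintro g - g' - h ⟨hg, hg'⟩
    have := congrArg List.length h
    have := List.length_pos_iff.2 hg
    have := List.length_pos_iff.2 hg'
    simp at *
    omega
  rintro v - hv a - ⟨ha, g, -, g', -, hEa⟩
  obtain ⟨a, rfl⟩ := List.length_eq_one_iff.1 ha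
  have hv := hmem' v hv
  obtain ⟨b, u, hu, hlen, hrule⟩ := hwin v hv a ⟨g, g', by simp [hEa]⟩
  have hv3 := (hcs v hv).2
  -- A word of at least three letters has a window, so `b` occurs in a listed row and is short
  -- enough to be quantified over.
  have hb : [b] ∈ Words N := by
    have h := hrule 0 _ _ _ _ (List.getElem?_eq_getElem (by omega))
      (List.getElem?_eq_getElem (by omega)) (List.getElem?_eq_getElem (by omega))
      (List.getElem?_eq_getElem (by omega))
    exact Words.of_head (Words.of_cons (Words.of_cons (Words.of_infix h hEN)))
  refine ⟨[b], hb, u, hcsN u hu, rfl, hmem u hu, hlen, ?_⟩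
  rintro p - l - m - r - s - p' - l' - m' - s' - ⟨rfl, rfl, hp, hl, hm, hr, hl', hm'⟩
  obtain ⟨l, rfl⟩ := List.length_eq_one_iff.1 hl
  obtain ⟨m, rfl⟩ := List.length_eq_one_iff.1 hm
  obtain ⟨r, rfl⟩ := List.length_eq_one_iff.1 hr
  obtain ⟨l', rfl⟩ := List.length_eq_one_iff.1 hl'
  obtain ⟨m', rfl⟩ := List.length_eq_one_iff.1 hm'
  obtain ⟨g, g', h⟩ := hrule p.length l m r m' (by simp) (by simp) (by simp) (by simp [hp])
  rw [← h, List.append_assoc] at hEN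
  exact ⟨g, Words.of_append_left hEN, g', Words.of_append_right (Words.of_append_right hEN),
    by simp [← h]⟩

end Fm

/-! ### Standard codings and the table of the rule -/

namespace ATM

variable {M : ATM}

/-- The cell besides the heads that shows the bit `b` on the input tape and blanks elsewhere. -/
def bitSymbols (M : ATM) (b : Bool) (i : Fin (M.extraTapes + 1)) : M.Symbol :=
  if i = 0 then some (.inl b) else none

theorem bitSymbols_injective : Function.Injective M.bitSymbols := by
  intro b b' h
  simpa [bitSymbols] using congrFun h 0

/-- A coding is standard if the bits of the input are coded by `0` and `1`, and `2` is not used as a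
code. -/
structure Coding.Standard (e : M.Coding) : Prop where
  bit : ∀ b, e.cell (none, M.bitSymbols b) = b.toNat
  cell_ne : ∀ c, e.cell c ≠ 2
  act_ne : ∀ a, e.act a ≠ 2
  answer_ne : ∀ b, e.answer b ≠ 2

open Classical in
-- Shifting arbitrary injections by `3` frees `0` and `1` for the two bit cells and `2` for the
-- marker.
theorem exists_standard_coding (M : ATM) : ∃ e : M.Coding, e.Standard := by
  obtain ⟨f, hf⟩ := Countable.exists_injective_nat M.Cell
  obtain ⟨g, hg⟩ := Countable.exists_injective_nat M.Move
  obtain ⟨h, hh⟩ := Countable.exists_injective_nat (Option M.Move)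
  let F : M.Cell → ℕ := fun c =>
    if c = (none, M.bitSymbols false) then 0 else if c = (none, M.bitSymbols true) then 1 else f c + 3
  have hF : Function.Injective F := by
    intro c c' hc
    simp only [F] at hc
    split_ifs at hc with h₁ h₂ h₃ h₄ h₅ h₆ <;> first | omega | simp_all
    exact hf hc
  refine ⟨⟨F, hF, fun a => g a + 3, fun a b hab => hg (by simpa using hab), fun a => h a + 3,
    fun a b hab => hh (by simpa using hab)⟩, ⟨?_, ?_, ?_, ?_⟩⟩
  · rintro (_ | _)
    · simp [F]
    · have : M.bitSymbols true ≠ M.bitSymbols false := fun h => by simpa using bitSymbols_injective h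
      simp [F, this]
  · intro c
    simp only [F]
    split_ifs <;> omega
  · intro a
    simp only
    omega
  · intro a
    simp only
    omega

theorem Coding.exists_rows (e : M.Coding) : ∃ rows : List (List ℕ), ∀ v, v ∈ rows ↔
    ∃ a b x y z w, e.Rule a b x y z w ∧ v = [a, b, x, y, z, w] := by
  have hfin : {v | ∃ a b x y z w, e.Rule a b x y z w ∧ v = [a, b, x, y, z, w]}.Finite := by
    refine (Set.finite_range fun t : M.Move × Option M.Move × M.Cell × M.Cell × M.Cell × M.Cell =>
      [e.act t.1, e.answer t.2.1, e.cell t.2.2.1, e.cell t.2.2.2.1, e.cell t.2.2.2.2.1,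
        e.cell t.2.2.2.2.2]).subset ?_
    rintro _ ⟨_, _, _, _, _, _, ⟨a, b, l, m, r, m', -, rfl, rfl, rfl, rfl, rfl, rfl⟩, rfl⟩
    exact ⟨(a, b, l, m, r, m'), rfl⟩
  exact ⟨hfin.toFinset.toList, by simp⟩

/-- Away from the heads the answer `none` is always allowed; hence every challenge occurs in some
row of the table. -/
theorem rule_none (a : M.Move) (s : Fin (M.extraTapes + 1) → M.Symbol) :
    M.Rule a none (none, s) (none, s) (none, s) (none, s) := ⟨rfl, by simp⟩

section listed

variable {e : M.Coding} {rows : List (List ℕ)} {pre suf : List ℕ}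

theorem Coding.Standard.two_notMem (he : e.Standard)
    (hr : ∀ v, v ∈ rows ↔ ∃ a b x y z w, e.Rule a b x y z w ∧ v = [a, b, x, y, z, w]) :
    ∀ r ∈ rows, 2 ∉ r := by
  intro r h
  obtain ⟨_, _, _, _, _, _, ⟨a, b, l, m, r, m', -, rfl, rfl, rfl, rfl, rfl, rfl⟩, rfl⟩ := (hr r).1 h
  simp [he.act_ne, he.answer_ne, he.cell_ne, eq_comm (a := 2)]

theorem Coding.Standard.listedRule_eq (he : e.Standard)
    (hr : ∀ v, v ∈ rows ↔ ∃ a b x y z w, e.Rule a b x y z w ∧ v = [a, b, x, y, z, w])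
    (hpre : 2 ∉ pre) (hsuf : 2 ∉ suf) : listedRule (pre ++ (marked rows ++ suf)) = e.Rule := by
  funext a b x y z w
  refine propext ⟨?_, fun h => ?_⟩
  · rintro ⟨g, g', h⟩
    obtain ⟨r₁, r, r₂, rfl, hv⟩ := exists_of_marked_eq (he.two_notMem hr) hpre hsuf
      (v := [a, b, x, y, z, w] ++ g') (g := g) (by simp [← h])
    obtain ⟨_, _, _, _, _, _, hR, rfl⟩ := (hr r).1 (by simp)
    simp only [List.cons_append, List.nil_append, List.cons.injEq] at hv
    obtain ⟨rfl, rfl, rfl, rfl, rfl, rfl, -⟩ := hv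
    exact hR
  · obtain ⟨r₁, r₂, rfl⟩ := List.append_of_mem ((hr _).2 ⟨_, _, _, _, _, _, h, rfl⟩)
    exact ⟨pre ++ marked r₁, marked r₂ ++ suf, by simp [marked_append, marked_cons]⟩

theorem Coding.Standard.listedActs_eq (he : e.Standard)
    (hr : ∀ v, v ∈ rows ↔ ∃ a b x y z w, e.Rule a b x y z w ∧ v = [a, b, x, y, z, w])
    (hpre : 2 ∉ pre) (hsuf : 2 ∉ suf) :
    listedActs (pre ++ (marked rows ++ suf)) = Set.range e.act := by
  ext a
  constructor
  · rintro ⟨g, g', h⟩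
    obtain ⟨r₁, r, r₂, rfl, hv⟩ := exists_of_marked_eq (he.two_notMem hr) hpre hsuf
      (v := a :: g') (g := g) (by simp [← h])
    obtain ⟨_, _, _, _, _, _, ⟨a', b, l, m, r, m', -, rfl, rfl, rfl, rfl, rfl, rfl⟩, rfl⟩ :=
      (hr r).1 (by simp)
    simp only [List.cons_append, List.nil_append, List.cons.injEq] at hv
    exact ⟨a', hv.1.symm⟩
  · rintro ⟨a, rfl⟩
    obtain ⟨r₁, r₂, rfl⟩ := List.append_of_mem ((hr _).2 ⟨_, _, _, _, _, _,
      ⟨a, none, _, _, _, _, rule_none a (M.bitSymbols false), rfl, rfl, rfl, rfl, rfl, rfl⟩, rfl⟩)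
    exact ⟨pre ++ marked r₁, _, by simp [marked_append, marked_cons]; rfl⟩

end listed

theorem cell_init (x : List Bool) (p : ℤ) : cell (M.init x) p =
    (if p = 0 then some M.start else none, fun i => if i = 0 then onTape x p else none) := by
  refine Prod.ext rfl (funext fun i => ?_)
  have := (rep_init (M := M) x).2 i p
  simp only [zero_add] at this
  simp only [cell, this]
  split_ifs <;> rfl

/-- With bits coded by `0` and `1`, the bits of the input appear verbatim in the initial word, apart
from the first one, whose cell also shows the state. Fixing that bit as `false` determines this cell
in advance. -/
theorem Coding.Standard.word_init {e : M.Coding} (he : e.Standard) (N : ℕ) (x : List Bool) :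
    e.word N (2 * N + (x.length + 1)) (M.init (false :: x)) =
      List.replicate N (e.cell (none, fun _ => none)) ++ (e.cell (some M.start, M.bitSymbols false) ::
        (x.map Bool.toNat ++ List.replicate N (e.cell (none, fun _ => none)))) := by
  refine List.ext_getElem (by simp [Coding.word]; omega) fun j h₁ h₂ => ?_
  replace h₁ : j < 2 * N + (x.length + 1) := by simpa [Coding.word] using h₁
  have hout : ∀ p : ℤ, p < 0 ∨ x.length < p →
      ATM.cell (M.init (false :: x)) p = (none, fun _ => none) := by
    intro p hp
    rw [cell_init, if_neg (by omega)]
    refine Prod.ext rfl (funext fun i => ?_)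
    simp only [onTape]
    split_ifs with h₁ h₂
    · rw [List.getElem?_eq_none (by simp; omega), Option.map_none]
    · rfl
    · rfl
  simp only [Coding.word, List.getElem_map, List.getElem_range, List.getElem_append,
    List.length_replicate, List.getElem_replicate, List.getElem_cons, List.length_map]
  rcases lt_trichotomy j N with h | rfl | h
  · rw [dif_pos h, hout _ (by omega)]
  · rw [dif_neg (by omega), dif_pos (by omega), cell_init, if_pos (by omega)]
    congr 2
    funext i
    simp [onTape, bitSymbols]
  · obtain ⟨q, rfl⟩ := Nat.exists_eq_add_of_lt h
    rw [dif_neg (by omega), dif_neg (by omega)]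
    by_cases hq : q < x.length
    · rw [dif_pos (by omega), ← he.bit, cell_init, if_neg (by omega)]
      congr 2
      funext i
      have h₄ : (((N + q + 1 : ℕ) : ℤ) - N).toNat = q + 1 := by omega
      have h₅ : N + q + 1 - N - 1 = q := by omega
      have h₆ : onTape (Aux := M.Aux) (false :: x) ((N + q + 1 : ℕ) - N) = some (.inl x[q]) := by
        rw [onTape, if_pos (by omega), h₄, List.getElem?_cons_succ, List.getElem?_eq_getElem hq]
        rfl
      simp only [h₅, h₆, bitSymbols]
    · rw [dif_neg (by omega), hout _ (by omega)]

theorem Coding.shows_word (e : M.Coding) {N n r : ℕ} (hr : r ≤ N) (hn : 1 ≤ n) (C : M.Cfg) :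
    e.Shows N (e.word N (2 * N + n) C) C r := by
  refine ⟨hr, fun d hd => ?_⟩
  rw [abs_le] at hd
  rw [List.getElem?_eq_some_iff]
  refine ⟨by simp [Coding.word]; omega, ?_⟩
  simp only [Coding.word, List.getElem_map, List.getElem_range]
  congr 2
  omega

end ATM

/-! ### Sizes of codes and paddings -/

theorem code.length_le {m : ℕ} {v : List ℕ} (h : ∀ a ∈ v, a ≤ m) :
    (code v).length ≤ v.length * (m + 1) := by
  induction v with
  | nil => simp [code]
  | cons a v ih =>
    have := ih fun b hb => h b (by simp [hb])
    have := h a (by simp)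
    simp only [code.cons, List.length_append, List.length_replicate, List.length_cons]
    nlinarith

theorem code.length_marked_le {b : ℕ} {rows : List (List ℕ)}
    (h : ∀ v ∈ rows, (code v).length ≤ b) :
    (code (marked rows)).length ≤ rows.length * (b + 3) := by
  induction rows with
  | nil => simp [marked, code]
  | cons r rows ih =>
    have := ih fun v hv => h v (by simp [hv])
    have := h r (by simp)
    simp only [marked_cons, code.cons, code.append, List.length_append, List.length_replicate,
      List.length_cons]
    nlinarith

/-- The marker `true` and the `false` after it together code the letter `1`; so the decoded word has
one zero fewer than the padding has letters `false`. -/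
theorem code.pad_eq {u : List ℕ} {s : ℕ} (h : s + 2 = 2 ^ (code u).length) :
    pad (code u) = code (u ++ 1 :: List.replicate s 0) := by
  have : ∀ s, code (List.replicate s 0) = List.replicate s false := by
    intro s
    induction s with
    | zero => rfl
    | succ s ih => simp [List.replicate_succ, code.cons, ih]
  rw [pad, ← h, code.append, code.cons, this]
  simp [List.replicate_succ]

theorem map_toNat_pad (x : List Bool) : (pad x).map Bool.toNat =
    x.map Bool.toNat ++ 1 :: List.replicate (2 ^ x.length - 1) 0 := by
  simp [pad]

theorem Nat.sq_le_two_pow {n : ℕ} (h : 4 ≤ n) : n * n ≤ 2 ^ n := by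
  induction n, h using Nat.le_induction with
  | base => norm_num
  | succ n hn ih =>
    rw [pow_succ]
    nlinarith


/-- A bound for the size of a list of `d ^ l` words of length `l`. -/
theorem size_bound {d m n l : ℕ} (hl : l ≤ 3 * 2 ^ n) (hn : 3 * d + 3 * m + 12 ≤ n) :
    d ^ l * (l * (m + 1) + 3) + 3 ≤ 2 ^ 2 ^ (n + 2 ^ n) := by
  set q := 2 ^ n with hq
  have hq1 : 1 ≤ q := Nat.one_le_two_pow
  have hnq : n < 2 ^ q := (Nat.lt_two_pow_self).trans Nat.lt_two_pow_self
  have h₁ : d ^ l ≤ 2 ^ (d * (3 * q)) := by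
    rw [pow_mul]
    exact (Nat.pow_le_pow_left Nat.lt_two_pow_self.le _).trans
      (Nat.pow_le_pow_right Nat.one_le_two_pow hl)
  have h₂ : l * (m + 1) + 6 ≤ 2 ^ (3 * q * (m + 1) + 6) :=
    le_trans (by nlinarith) Nat.lt_two_pow_self.le
  have h₃ : 1 ≤ 2 ^ (d * (3 * q)) := Nat.one_le_two_pow
  calc d ^ l * (l * (m + 1) + 3) + 3
      ≤ 2 ^ (d * (3 * q)) * (l * (m + 1) + 3) + 2 ^ (d * (3 * q)) * 3 := by
        gcongr
        omega
    _ = 2 ^ (d * (3 * q)) * (l * (m + 1) + 6) := by ring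
    _ ≤ 2 ^ (d * (3 * q)) * 2 ^ (3 * q * (m + 1) + 6) := by gcongr
    _ = 2 ^ (d * (3 * q) + (3 * q * (m + 1) + 6)) := (pow_add ..).symm
    _ ≤ 2 ^ 2 ^ (n + 2 ^ n) := by
        refine Nat.pow_le_pow_right (by norm_num) ?_
        rw [pow_add, ← hq]
        calc d * (3 * q) + (3 * q * (m + 1) + 6) ≤ q * (3 * d + 3 * m + 12) := by nlinarith
          _ ≤ q * 2 ^ q := by gcongr; omega

/-! ### The diagonal input -/

namespace ATM

variable {M : ATM}

/-- The words of the accepting configurations can be listed. -/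
theorem Coding.exists_words (e : M.Coding) {m : ℕ} (hm : ∀ z, e.cell z ≤ m) (N n : ℕ) :
    ∃ cs : List (List ℕ), (∀ v, v ∈ cs ↔ ∃ C, M.AcceptsFrom C ∧ v = e.word N n C) ∧
      (code (marked cs)).length ≤ Nat.card M.Cell ^ n * (n * (m + 1) + 3) := by
  classical
  have := Fintype.ofFinite M.Cell
  let F : (Fin n → M.Cell) → List ℕ := fun f => List.ofFn fun i => e.cell (f i)
  let cs := ((Finset.univ : Finset (Fin n → M.Cell)).toList.map F).filter
    fun v => ∃ C, M.AcceptsFrom C ∧ v = e.word N n C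
  refine ⟨cs, fun v => ?_, ?_⟩
  · simp only [cs, List.mem_filter, List.mem_map, Finset.mem_toList, Finset.mem_univ, true_and,
      decide_eq_true_eq, and_iff_right_iff_imp]
    rintro ⟨C, -, rfl⟩
    refine ⟨fun i => ATM.cell C ((i : ℕ) - N), List.ext_getElem (by simp [F, Coding.word]) ?_⟩
    intro i h₁ h₂
    simp [F, Coding.word]
  · have hlen : cs.length ≤ Nat.card M.Cell ^ n := by
      refine (List.length_filter_le _ _).trans ?_
      simp
    refine (code.length_marked_le (b := n * (m + 1)) fun v hv => ?_).trans
      (Nat.mul_le_mul_right _ hlen)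
    obtain ⟨v, hv, rfl⟩ := List.mem_map.1 (List.mem_filter.1 hv).1
    refine (code.length_le (m := m) fun a ha => ?_).trans (by simp [F])
    obtain ⟨i, rfl⟩ := List.mem_ofFn.1 ha
    exact hm _

open Fm in
/-- On a suitable input, the formula evaluates the acceptance game of `M`. -/
theorem exists_sat_iff_acceptsFrom {C K : ℕ}
    (hb : ∀ x, M.Bounded (C * x.length + C) K (M.init x)) :
    ∃ x, (game.Sat (pad (pad (pad x))).length (inputs (pad (pad (pad x)))) ↔
      M.AcceptsFrom (M.init x)) := by
  obtain ⟨e, he⟩ := exists_standard_coding M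
  obtain ⟨rows, hrows⟩ := e.exists_rows
  obtain ⟨m, hm⟩ : ∃ m, ∀ z, e.cell z ≤ m := by
    obtain ⟨m, hm⟩ := (Set.finite_range e.cell).bddAbove
    exact ⟨m, fun z => hm ⟨z, rfl⟩⟩
  set B := e.cell (none, fun _ => none) with hB
  set O := e.cell (some M.start, M.bitSymbols false) with hO
  -- A lower bound for the length of the input beyond which all later estimates hold; it depends
  -- only on `M` and the coding.
  set G := C + 3 * Nat.card M.Cell + 3 * m + 12 with hG
  obtain ⟨row, hrow⟩ : ∃ row, row ∈ rows :=
    ⟨_, (hrows _).2 ⟨_, _, _, _, _, _, ⟨(M.start, fun _ => (none, none)), none, _, _, _, _,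
      rule_none _ (M.bitSymbols false), rfl, rfl, rfl, rfl, rfl, rfl⟩, rfl⟩⟩
  obtain ⟨rows', hrows', hlen⟩ : ∃ rows' : List (List ℕ),
      (∀ v, v ∈ row :: rows' ↔ ∃ a b x y z w, e.Rule a b x y z w ∧ v = [a, b, x, y, z, w]) ∧
      G ≤ (marked (row :: rows')).length := by
    -- Repeating a row lengthens the input without changing the listed rule.
    refine ⟨rows ++ List.replicate G row, fun v => ?_, ?_⟩
    · rw [← hrows v]
      simp only [List.mem_cons, List.mem_append, List.mem_replicate]
      constructor
      · rintro (rfl | h | ⟨-, rfl⟩) <;> assumption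
      · exact fun h => .inr (.inl h)
    · have : ∀ l : List (List ℕ), l.length ≤ (marked l).length := by
        intro l
        induction l with
        | nil => simp
        | cons r l ih =>
          rw [marked_cons]
          simp
          omega
      refine le_trans ?_ (this _)
      simp
      omega
  set y := code ([1, B, O] ++ marked (row :: rows')) with hy
  set x := false :: y with hx
  have hxc : x = code ([0, 1, B, O] ++ marked (row :: rows')) := by simp [hx, hy, code]
  set n := y.length + 1 with hn
  have hxn : x.length = n := by simp [hx, hn]
  have hGn : G ≤ n := by
    have : ([1, B, O] ++ marked (row :: rows')).length ≤ y.length := by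
      rw [hy, ← code.count_false]
      exact List.count_le_length
    rw [List.length_append] at this
    omega
  refine ⟨x, ?_⟩
  have hsq := Nat.sq_le_two_pow (n := n) (by omega)
  have h₁ : 2 ≤ 2 ^ n := by nlinarith
  set n₁ := n + 2 ^ n with hn₁
  have h₂ : 2 ≤ 2 ^ n₁ := by
    have := Nat.lt_two_pow_self (n := n₁)
    omega
  set n₂ := n₁ + 2 ^ n₁ with hn₂
  have h₃ : 2 ≤ 2 ^ n₂ := by
    have := Nat.lt_two_pow_self (n := n₂)
    omega
  have hl₁ : (pad x).length = n₁ := by rw [length_pad, hxn]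
  have hl₂ : (pad (pad x)).length = n₂ := by rw [length_pad, hl₁]
  set N := (pad (pad (pad x))).length with hN
  have hl₃ : N = n₂ + 2 ^ n₂ := by rw [hN, length_pad, hl₂]
  -- Read as a code, the three paddings contribute only letters `0` and `1`, so they add no rows to
  -- the table.
  set suf := 1 :: (List.replicate (2 ^ n - 2) 0 ++ 1 :: (List.replicate (2 ^ n₁ - 2) 0 ++
    1 :: List.replicate (2 ^ n₂ - 2) 0)) with hsuf
  set E := [0, 1, B, O] ++ (marked (row :: rows') ++ suf) with hE
  have hw : pad (pad (pad x)) = code E := by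
    rw [hxc] at hl₁ hl₂ hxn ⊢
    rw [code.pad_eq (s := 2 ^ n - 2) (by rw [hxn]; omega)] at hl₁ hl₂ ⊢
    rw [code.pad_eq (s := 2 ^ n₁ - 2) (by rw [hl₁]; omega)] at hl₂ ⊢
    rw [code.pad_eq (s := 2 ^ n₂ - 2) (by rw [hl₂]; omega)]
    simp [hE, hsuf]
  have hX : (pad (pad (pad x))).map Bool.toNat = 0 :: (y.map Bool.toNat ++
      1 :: (List.replicate (2 ^ n - 1) 0 ++ 1 :: (List.replicate (2 ^ n₁ - 1) 0 ++
      1 :: List.replicate (2 ^ n₂ - 1) 0))) := by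
    rw [map_toNat_pad, map_toNat_pad, map_toNat_pad, hl₂, hl₁, hxn]
    simp [hx]
  set τ : Fin 35 → List ℕ := fun i => if i = 0 then E else if i = 1 then
    (pad (pad (pad x))).map Bool.toNat else [] with hτ
  have hin : inputs (pad (pad (pad x))) = fun i => code (τ i) := by
    funext i
    simp only [inputs, hτ, code.letterCode_eq]
    split_ifs
    · exact hw
    · rfl
    · rfl
  rw [hin, sat_code]
  have h2pre : 2 ∉ [0, 1, B, O] := by simp [hB, hO, eq_comm (a := 2), he.cell_ne]
  have h2suf : 2 ∉ suf := by simp [hsuf]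
  have hEN : E ∈ Words N := Words.mem_iff.2 (by rw [← hw])
  have hE' : ∃ E', E = 0 :: 1 :: B :: O :: 2 :: E' := ⟨_, by rw [hE, marked_cons]; rfl⟩
  obtain ⟨E', hE'⟩ := hE'
  have hword : e.word (2 ^ n - 1) (2 * (2 ^ n - 1) + n) (M.init x) =
      List.replicate (2 ^ n - 1) B ++ (O :: (y.map Bool.toNat ++ List.replicate (2 ^ n - 1) B)) :=
    he.word_init _ _
  have hrule : listedRule E = e.Rule := he.listedRule_eq hrows' h2pre h2suf
  have hacts : listedActs E = Set.range e.act := he.listedActs_eq hrows' h2pre h2suf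
  constructor
  · intro h
    obtain ⟨S, hwin, hS⟩ := isWinning_of_satN_game hE' hEN rfl hX h
    rw [hrule, hacts] at hwin
    rw [← hword] at hS
    refine Coding.acceptsFrom_of_isWinning e hwin _ _ _ _ (hb x) _ hS
      (e.shows_word ?_ (by omega) _)
    rw [hxn]
    -- The required radius `C * n + C + 1` is at most the margin `2 ^ n - 1`.
    have : C * n + C + 2 ≤ n * n := by nlinarith
    omega
  · intro h
    obtain ⟨cs, hcs, hsize⟩ := e.exists_words hm (2 ^ n - 1) (2 * (2 ^ n - 1) + n)
    have hwin := e.isWinning_words (2 ^ n - 1) (2 * (2 ^ n - 1) + n)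
    have hlt := Nat.lt_two_pow_self (n := n)
    have hbound := size_bound (d := Nat.card M.Cell) (m := m) (n := n)
      (l := 2 * (2 ^ n - 1) + n) (by omega) (by omega)
    rw [← hn₁] at hbound
    -- The list of accepting configurations has size at most `2 ^ 2 ^ n₁`, which is below the length
    -- `n₂ + 2 ^ n₂` after the third padding.
    have hbig : 2 ^ 2 ^ n₁ ≤ 2 ^ n₂ := Nat.pow_le_pow_right (by norm_num) (by omega)
    have hzero : ∀ s, s + 1 ≤ N → [0] ++ List.replicate s 0 ∈ Words N := by
      intro s hs
      rw [Words.mem_iff]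
      refine (code.length_le (m := 0) fun a ha => ?_).trans ?_
      · simp at ha
        omega
      · simp
        omega
    refine satN_game_of_isWinning hE' hEN rfl hX (hzero _ (by omega)) (hzero _ (by omega))
      (hzero _ (by omega)) ?_ ?_ (Words.mem_iff.2 ?_) ?_ ((hcs _).2 ⟨_, h, hword.symm⟩)
    · have hd : 1 ≤ Nat.card M.Cell ^ (2 * (2 ^ n - 1) + n) :=
        Nat.pow_pos (Nat.card_pos_iff.2 ⟨⟨(none, fun _ => none)⟩, inferInstance⟩)
      have hl := Nat.le_mul_of_pos_left ((2 * (2 ^ n - 1) + n) * (m + 1) + 3) hd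
      have hs : (2 ^ n - 1 + 1) * (m + 1) ≤ (2 * (2 ^ n - 1) + n) * (m + 1) :=
        Nat.mul_le_mul_right _ (by omega)
      rw [Words.mem_iff]
      refine (code.length_le (m := m) fun a ha => ?_).trans ?_
      · obtain rfl : a = B := by simp at ha; omega
        exact hm _
      · simp only [List.length_append, List.length_cons, List.length_nil, List.length_replicate]
        rw [show 0 + 1 + (2 ^ n - 1) = 2 ^ n - 1 + 1 by omega]
        omega
    · intro v hv
      obtain ⟨C, -, rfl⟩ := (hcs v).1 hv
      refine ⟨?_, by simp [Coding.word]; omega⟩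
      simp only [Coding.word, List.mem_map, not_exists, not_and]
      exact fun _ _ => he.cell_ne _
    · simp only [code.append, List.length_append, show (code [2]).length = 3 from rfl]
      omega
    · rw [hrule, hacts]
      simpa only [hcs] using hwin

end ATM

theorem mainTheorem11 : EH ≠ LinH := by
  intro h
  have hU := Fm.setOf_sat_mem_linH Fm.game Fm.wf_game
  have hD := setOf_pad_notMem_mem_eh (h ▸ setOf_pad_notMem_mem_eh (h ▸ setOf_pad_notMem_mem_eh hU))
  rw [h] at hD
  obtain ⟨k, g, hg, M, hs, ht, hM⟩ := Set.mem_iUnion.1 hD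
  obtain ⟨C, hC⟩ := hg.exists_le
  obtain ⟨x, hx⟩ := ATM.exists_sat_iff_acceptsFrom (M := M) fun x =>
    (ATM.bounded_init hs ht x).mono (hC _) le_rfl
  -- Each of the three paddings contributes a negation; an odd number of them makes this contradict
  -- `hx`.
  have : M.AcceptsFrom (M.init x) ↔ ¬ ¬ ¬ Fm.game.Sat _ _ := Set.ext_iff.1 hM x
  tauto
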